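/- Let $\mathcal A$ be a planar annulus with a finite triangulation $\mathcal T$, outer boundary component $E_1$ and inner boundary component $E_2$. Let every edge $(u,w)$ of $\mathcal T$ carry a conductance $c(u,w)=c(w,u)>0$, let $k>0$, and let $g$ be the solution of the discrete Dirichlet problem: $g=k$ at the vertices of $E_1$, $g=0$ at the vertices of $E_2$, and $\sum_{w\sim v}c(v,w)(g(v)-g(w))=0$ at every other vertex $v$. Assume that two adjacent vertices have the same $g$-value only if the edge joining them lies in $\partial\mathcal A$. Extend $g$ affinely over the edges and triangles. Let the slit be a simple path in the $1$-skeleton of $\mathcal T$ from $E_1$ to $E_2$ along which $g$ is strictly decreasing, and let $\mathcal Q_{\rm slit}$ be the quadrilateral obtained by cutting $\mathcal A$ open along the slit, with two copies of the slit attached: the base, from which the counter-clockwise level curves of $g$ start, and the top, at which they end. Call the points where an edge with distinct end values meets a level curve of $g$ through a vertex of $\mathcal T$, and which are not vertices of $\mathcal T$, vertices of type I. The level curves of $g$ through the vertices of $\mathcal T$ cut the triangles of $\mathcal T$ into triangles and quadrilaterals, whose corners are vertices of $\mathcal T$ or of type I; when an edge $(u,w)$ is cut, its piece between $w$ and the point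 $x$ has the conductance $\tilde c(x,w)=c(u,w)\,\frac{g(u)-g(w)}{g(x)-g(w)}$. The conjugate function $g^*$ of $g$ on $\mathcal Q_{\rm slit}$ is defined as follows. If $v$ is a vertex of $\mathcal T$ or of type I, then $g^*(v)$ is the sum, over the vertices $u$ (of $\mathcal T$ or of type I) on the level curve $L(v)$ of $g$ through $v$ that one meets in the counter-clockwise direction from its starting point on the base (excluded) to $v$ (included), of the normal derivative $\sum_{y}\tilde c(u,y)(g(u)-g(y))$, where $y$ runs over the lower endpoints of the edges of $\mathcal A$ that descend from $u$ to smaller values of $g$ (for $u$ on the top, all these edges in $\mathcal A$ are taken); if $v\in E_2$, the summand is instead $-\sum_{y}\tilde c(u,y)(g(u)-g(y))$, where $y$ runs over the neighbours of $u$ with larger values of $g$. At all other points $g^*$ is given by affine extension over the edges and triangles, and bilinear extension over the quadrilaterals, of this refined decomposition. Then every level curve (non-empty level set in $\mathcal Q_{\rm slit}$) of $g^*$ meets every level curve of $g$ in exactly one point. -/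

import Mathlib

/-- A (finite, pure two-dimensional, coherently oriented) simplicial complex with vertex set `V`,
given by its positively oriented triangles: `tri a b c` says that `a, b, c` are, in this
counter-clockwise cyclic order, the vertices of a triangle. Coherence of the orientations means
that every directed edge is followed counter-clockwise by at most one triangle; in particular
every edge lies in at most two triangles. -/
structure OrientedTriangulation (V : Type*) where
  tri : V → V → V → Prop
  rotate : ∀ {a b c : V}, tri a b c → tri b c a
  ne : ∀ {a b c : V}, tri a b c → a ≠ b
  not_swap : ∀ {a b c : V}, tri a b c → ¬ tri b a c
  unique : ∀ {a b c d : V}, tri a b c → tri a b d → c = d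

namespace OrientedTriangulation

/-- The one-skeleton: the edges are the sides of the triangles. -/
def graph {V : Type*} (T : OrientedTriangulation V) : SimpleGraph V where
  Adj a b := (∃ c, T.tri a b c) ∨ (∃ c, T.tri b a c)
  symm := ⟨fun _ _ h => h.symm⟩
  loopless := ⟨fun _ h => by
    rcases h with ⟨c, h⟩ | ⟨c, h⟩ <;> exact T.ne h rfl⟩

/-- The boundary edges: the edges that lie in exactly one triangle. -/
def boundaryGraph {V : Type*} (T : OrientedTriangulation V) : SimpleGraph V where
  Adj a b := Xor (∃ c, T.tri a b c) (∃ c, T.tri b a c)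
  symm := ⟨fun _ _ h => Or.symm h⟩
  loopless := ⟨fun _ h => by
    rcases h with ⟨⟨c, h⟩, _⟩ | ⟨⟨c, h⟩, _⟩ <;> exact T.ne h rfl⟩

/-- The (unoriented) triangles. -/
def faces {V : Type*} [DecidableEq V] (T : OrientedTriangulation V) : Set (Finset V) :=
  {f | ∃ a b c, T.tri a b c ∧ f = {a, b, c}}

/-- `T` triangulates an annulus with boundary components `E₁` and `E₂`: it is a connected
oriented surface (the link of every vertex is connected, hence a path or a cycle), its boundary
has exactly the two components `E₁` and `E₂`, and its Euler characteristic is zero. -/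
structure IsAnnulus {V : Type*} [Fintype V] [DecidableEq V] (T : OrientedTriangulation V)
    (E₁ E₂ : Finset V) : Prop where
  connected : T.graph.Connected
  link_connected : ∀ v a b : V, T.graph.Adj v a → T.graph.Adj v b →
    Relation.EqvGen (fun p q => T.tri v p q) a b
  euler : (Fintype.card V : ℤ) - (T.graph.edgeSet.ncard : ℤ) + (T.faces.ncard : ℤ) = 0
  nonempty₁ : E₁.Nonempty
  nonempty₂ : E₂.Nonempty
  disjoint : Disjoint E₁ E₂
  boundary : ∀ v : V, (v ∈ E₁ ∨ v ∈ E₂) ↔ ∃ w, T.boundaryGraph.Adj v w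
  component₁ : ∀ v ∈ E₁, ∀ w : V, T.boundaryGraph.Reachable v w ↔ w ∈ E₁
  component₂ : ∀ v ∈ E₂, ∀ w : V, T.boundaryGraph.Reachable v w ↔ w ∈ E₂

open Classical in
/-- The discrete Laplacian at `v` for the conductances `c`. -/
noncomputable def laplacian {V : Type*} [Fintype V] (T : OrientedTriangulation V)
    (c : V → V → ℝ) (g : V → ℝ) (v : V) : ℝ :=
  ∑ w ∈ Finset.univ.filter (fun w => T.graph.Adj v w), c v w * (g v - g w)

/-- `g` solves the discrete Dirichlet boundary value problem with boundary values `k` on `E₁` and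
`0` on `E₂`. -/
structure IsDirichletSolution {V : Type*} [Fintype V] (T : OrientedTriangulation V)
    (E₁ E₂ : Finset V) (c : V → V → ℝ) (k : ℝ) (g : V → ℝ) : Prop where
  outer : ∀ v ∈ E₁, g v = k
  inner : ∀ v ∈ E₂, g v = 0
  harmonic : ∀ v, v ∉ E₁ → v ∉ E₂ → T.laplacian c g v = 0

/-- A slit: a simple path in the one-skeleton from `E₁` to `E₂` along which `g` decreases. -/
structure IsSlit {V : Type*} (T : OrientedTriangulation V) (E₁ E₂ : Finset V) (g : V → ℝ)
    {x y : V} (p : T.graph.Walk x y) : Prop where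
  start_mem : x ∈ E₁
  end_mem : y ∈ E₂
  simple : p.IsPath
  decreasing : ∀ d ∈ p.darts, g d.snd < g d.fst

/-- A point of a triangle `face`, in barycentric coordinates. -/
structure FacePoint {V : Type*} [Fintype V] [DecidableEq V] (T : OrientedTriangulation V) where
  face : Finset V
  face_mem : face ∈ T.faces
  wt : V → ℝ
  wt_mem : wt ∈ stdSimplex ℝ V
  wt_support : ∀ v, v ∉ face → wt v = 0

/-- The value at a point with barycentric coordinates `wt` of the affine extension of `g`. -/
def level {V : Type*} [Fintype V] (g : V → ℝ) (wt : V → ℝ) : ℝ := ∑ v, wt v * g v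

/-- Two triangles are glued along their common side if that side is not an edge of the slit. -/
def Glue {V : Type*} [Fintype V] [DecidableEq V] (T : OrientedTriangulation V) {x y : V}
    (p : T.graph.Walk x y) (z z' : T.FacePoint) : Prop :=
  z.wt = z'.wt ∧ ∃ a b : V, a ≠ b ∧ z.face ∩ z'.face = {a, b} ∧ s(a, b) ∉ p.edges

/-- The slit annulus: the annulus cut open along the slit, with two copies of the slit attached.
It is the disjoint union of the closed triangles, glued along all common sides except those on the
slit. -/
def SlitAnnulus {V : Type*} [Fintype V] [DecidableEq V] (T : OrientedTriangulation V) {x y : V}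
    (p : T.graph.Walk x y) : Type _ := Quot (T.Glue p)

section slit

variable {V : Type*} [Fintype V] [DecidableEq V] (T : OrientedTriangulation V) {x y : V}
  (p : T.graph.Walk x y)

/-- The barycentric coordinates of (the image in the annulus of) a point of the slit annulus. -/
def bary (q : T.SlitAnnulus p) : V → ℝ := Quot.lift FacePoint.wt (fun _ _ h => h.1) q

/-- The affine extension of `g` to the slit annulus. -/
def extend (g : V → ℝ) (q : T.SlitAnnulus p) : ℝ := level g (T.bary p q)

/-- The copy of the slit from which the counter-clockwise level curves of `g` start: it belongs to
the triangles on the right of the slit, directed from `E₁` to `E₂`. -/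
def base : Set (T.SlitAnnulus p) :=
  {q | ∃ d ∈ p.darts, ∃ (e : V) (z : T.FacePoint), T.tri d.snd d.fst e ∧
    z.face = {d.snd, d.fst, e} ∧ z.wt e = 0 ∧ q = Quot.mk _ z}

/-- `q` lies in a common triangle with `r`, on the same level segment of `g` and after `r` in the
counter-clockwise direction. In a positively oriented triangle `a, b, e` the gradient of `g`,
rotated counter-clockwise by a right angle, is a positive multiple of the vector with barycentric
coordinates `(g e - g b, g a - g e, g b - g a)`. As `g` grows from the inner boundary `E₂` to the
outer boundary `E₁`, this is the counter-clockwise direction of the level curves. -/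
def Ahead (g : V → ℝ) (r q : T.SlitAnnulus p) : Prop :=
  ∃ (z z' : T.FacePoint) (a b e : V) (m : ℝ), r = Quot.mk _ z ∧ q = Quot.mk _ z' ∧
    T.tri a b e ∧ z.face = {a, b, e} ∧ z'.face = {a, b, e} ∧ 0 < m ∧
    z'.wt a - z.wt a = m * (g e - g b) ∧
    z'.wt b - z.wt b = m * (g a - g e) ∧
    z'.wt e - z.wt e = m * (g b - g a)

/-- A vertex of the triangulation. -/
def IsVertex (wt : V → ℝ) : Prop := ∃ v, wt v = 1

/-- A vertex of type I: an interior point of an edge with distinct end values, where the edge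
meets a level curve of `g` through a vertex of the triangulation. -/
def IsTypeI (g : V → ℝ) (wt : V → ℝ) : Prop :=
  ∃ u w, T.graph.Adj u w ∧ g u ≠ g w ∧ 0 < wt u ∧ 0 < wt w ∧ wt u + wt w = 1 ∧
    ∃ v, g v = level g wt

/-- The vertices of the refined cell decomposition. -/
def IsNode (g : V → ℝ) (q : T.SlitAnnulus p) : Prop :=
  IsVertex (T.bary p q) ∨ T.IsTypeI g (T.bary p q)

/-- The conductance of the piece, from `w` to the point with `g`-value `t`, of the edge `u w`. It
is `c u w` when that point is `u` itself. -/
noncomputable def pieceConductance (c : V → V → ℝ) (g : V → ℝ) (u w : V) (t : ℝ) : ℝ :=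
  c u w * (g u - g w) / (t - g w)

open Classical in
/-- The normal derivative of `g`, at a vertex of the refined decomposition with barycentric
coordinates `wt` in the annulus, with respect to the side of its level curve on which the values
of `g` lie in `U`: the sum over the (pieces of) edges `u w` that leave the point into that side. -/
noncomputable def normalDerivative (c : V → V → ℝ) (g : V → ℝ) (U : Set ℝ) (wt : V → ℝ) : ℝ :=
  ∑ u, ∑ w, if T.graph.Adj u w ∧ wt u ≠ 0 ∧ (∀ v, v ≠ u → v ≠ w → wt v = 0) ∧ g w ∈ U then
    pieceConductance c g u w (level g wt) * (level g wt - g w) else 0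

open Classical in
/-- The integrand of the conjugate function: the normal derivative with respect to the side of
smaller values, and, on `E₂`, minus the normal derivative with respect to the other side. -/
noncomputable def flux (E₂ : Finset V) (c : V → V → ℝ) (g : V → ℝ) (wt : V → ℝ) : ℝ :=
  if ∃ v ∈ E₂, wt v = 1 then - T.normalDerivative c g (Set.Ioi (level g wt)) wt
  else T.normalDerivative c g (Set.Iio (level g wt)) wt

/-- The conjugate function at a vertex `q` of the refined decomposition: the integral of the normal
derivative, along the level curve of `g` through `q`, counter-clockwise from its starting point
on the base (exclusive) to `q` (inclusive). -/
noncomputable def nodeValue (E₂ : Finset V) (c : V → V → ℝ) (g : V → ℝ) (q : T.SlitAnnulus p) :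
    ℝ :=
  ∑ᶠ u ∈ {u : T.SlitAnnulus p | T.IsNode p g u ∧ Relation.ReflTransGen (T.Ahead p g) u q ∧
    u ∉ T.base p}, T.flux E₂ c g (T.bary p u)

/-- `X` is the value at `q` of the affine (on triangles) or bilinear (on quadrilaterals) extension
of the conjugate function over a cell of the refined decomposition that contains `q`. Such a cell
is the part of a triangle `a, b, e` between two consecutive levels `t₀ < t₁` of vertices of the
triangulation. It has the corners `A₀`, `A₁` on one side `a b` of the triangle and `B₀`, `B₁` on
another side `a e`. If `A₀ = B₀` or `A₁ = B₁`, then the cell is a triangle and the formula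
gives the affine extension. -/
def HasConjugateValue (E₂ : Finset V) (c : V → V → ℝ) (g : V → ℝ) (q : T.SlitAnnulus p)
    (X : ℝ) : Prop :=
  ∃ (a b e : V) (A₀ A₁ B₀ B₁ z : T.FacePoint) (t₀ t₁ r s : ℝ),
    A₀.face = {a, b, e} ∧ A₁.face = {a, b, e} ∧ B₀.face = {a, b, e} ∧ B₁.face = {a, b, e} ∧
    A₀.wt e = 0 ∧ A₁.wt e = 0 ∧ B₀.wt b = 0 ∧ B₁.wt b = 0 ∧
    t₀ ∈ Set.range g ∧ t₁ ∈ Set.range g ∧ t₀ < t₁ ∧ (∀ v, ¬ (t₀ < g v ∧ g v < t₁)) ∧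
    level g A₀.wt = t₀ ∧ level g B₀.wt = t₀ ∧ level g A₁.wt = t₁ ∧ level g B₁.wt = t₁ ∧
    r ∈ Set.Icc (0 : ℝ) 1 ∧ s ∈ Set.Icc (0 : ℝ) 1 ∧
    z.face = {a, b, e} ∧ q = Quot.mk _ z ∧
    z.wt = (1 - s) • ((1 - r) • A₀.wt + r • B₀.wt) + s • ((1 - r) • A₁.wt + r • B₁.wt) ∧
    X = (1 - s) * ((1 - r) * T.nodeValue p E₂ c g (Quot.mk _ A₀)
          + r * T.nodeValue p E₂ c g (Quot.mk _ B₀))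
      + s * ((1 - r) * T.nodeValue p E₂ c g (Quot.mk _ A₁)
          + r * T.nodeValue p E₂ c g (Quot.mk _ B₁))

/-- The conjugate function of `g` on the slit annulus. -/
noncomputable def conjugate (E₂ : Finset V) (c : V → V → ℝ) (g : V → ℝ)
    (q : T.SlitAnnulus p) : ℝ :=
  Classical.epsilon (T.HasConjugateValue p E₂ c g q)

end slit

end OrientedTriangulation

/-- The level curves of a function are its non-empty level sets. -/
def IsLevelCurve {X : Type*} (f : X → ℝ) (L : Set X) : Prop :=
  L.Nonempty ∧ ∃ t : ℝ, L = {q | f q = t}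

set_option linter.unusedSectionVars false

/-!
On every level curve of `g` in the slit annulus, the conjugate function increases strictly and
continuously from `0`, at the base, to the total current `K` that flows out of the outer boundary,
at the top. As `K` does not depend on the level, a non-empty level set of the conjugate function
belongs to a value in `[0, K]`, and this value is taken exactly once on every level curve of `g`.

The level curves are single chains of segments. By the maximum principle a counter-clockwise level
curve leaves every vertex `v` into at least one triangle `v, a, b` (with `g b ≤ g v ≤ g a`), and it
arrives from at least one (with `g a ≤ g v ≤ g b`). Triangles have few such corners, and as the
Euler characteristic is zero there are not more than two per vertex (`card_corners`); hence there
is exactly one of each kind, so that `g` has no saddles (`DirichletData.regular`). The points at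
which a level set meets the edges therefore have unique successors and predecessors. They form a
single cycle: at the outer boundary this is the boundary curve, and connectedness is carried
downwards through the level sets of `g` (`nodesConnected`). A level curve meets the slit once, and
the rotation around a slit vertex, with the single out-going and the single in-coming corner,
shows that cutting along the slit turns the cycle into a chain that starts on the base and ends on
the top (`exists_corner_side`, `exists_levelChain`, `position_unique`).

At the critical levels, those of the vertices, the conjugate function is therefore the partial sum
along the chain of the fluxes through its nodes (`nodeValue_eq`). The fluxes are positive, and
their sum is the current through the cut of the network at this level, which is `K` by harmonicity
(`flux_eq`, `flux_pos`, `sum_flux`). Between two critical levels, the value at the point where a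
level curve meets an edge is interpolated between the values at the ends of the piece of this edge
between the two levels. The two ends of a segment bound a cell, whose sides have values in the
right order at both levels, and strictly so at one level at least; so the interpolated values also
increase along the chain (`exists_levelValues_of_not_mem`). Finally, a bilinear function is
affine on the segments of the level curves, which gives strict monotonicity and continuity
(`exists_conjugate_eq`, `existsUnique_conjugate`).
-/

namespace OrientedTriangulation

/-! ### Triangles and links -/

section Combinatorics

variable {V : Type*} {T : OrientedTriangulation V}

lemma tri_ne_snd {a b c : V} (h : T.tri a b c) : b ≠ c := T.ne (T.rotate h)

lemma tri_ne_trd {a b c : V} (h : T.tri a b c) : c ≠ a := T.ne (T.rotate (T.rotate h))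

lemma tri_unique_snd {a b c d : V} (h : T.tri a b c) (h' : T.tri a d c) : b = d :=
  T.unique (T.rotate (T.rotate h)) (T.rotate (T.rotate h'))

lemma not_tri_odd {a b c : V} (h : T.tri a b c) : ¬ T.tri a c b := fun h' =>
  T.not_swap (T.rotate (T.rotate h')) (T.rotate (T.rotate (T.rotate h)))

lemma adj_of_tri {a b c : V} (h : T.tri a b c) : T.graph.Adj a b := Or.inl ⟨c, h⟩

lemma adj_of_tri' {a b c : V} (h : T.tri a b c) : T.graph.Adj a c :=
  Or.inr ⟨b, T.rotate (T.rotate h)⟩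

/-- A finite set that an injective relation maps into itself is also closed under the inverse
relation. -/
lemma closed_pred_of_closed_succ {α : Type*} {R : α → α → Prop}
    (hR : ∀ p p' q, R p q → R p' q → p = p')
    {S : Set α} (hfin : S.Finite) (hS : ∀ p ∈ S, ∃ q ∈ S, R p q) {p q : α} (hq : q ∈ S)
    (h : R p q) : p ∈ S := by
  choose! f hf hfR using hS
  have hinj : Set.InjOn f S := fun a ha b hb hab => hR a b (f b) (hab ▸ hfR a ha) (hfR b hb)
  have himg : f '' S = S := Set.eq_of_subset_of_ncard_le (Set.image_subset_iff.2 hf)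
    hinj.ncard_image.ge hfin
  obtain ⟨p', hp', rfl⟩ := himg ▸ hq
  rwa [hR _ _ _ h (hfR p' hp')]

lemma tri_rotation_of_face_eq [DecidableEq V] {a b c a' b' c' : V} (h : T.tri a b c)
    (h' : T.tri a' b' c') (hf : ({a', b', c'} : Finset V) = {a, b, c}) :
    (a' = a ∧ b' = b ∧ c' = c) ∨ (a' = b ∧ b' = c ∧ c' = a) ∨ (a' = c ∧ b' = a ∧ c' = b) := by
  have key : ∀ {p q r : V}, T.tri p q r → ({a', b', c'} : Finset V) = {p, q, r} → a' = p →
      b' = q ∧ c' = r := by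
    intro p q r hp hf hap
    subst hap
    have hb : b' ∈ ({a', q, r} : Finset V) := by rw [← hf]; simp
    have hc : c' ∈ ({a', q, r} : Finset V) := by rw [← hf]; simp
    simp only [Finset.mem_insert, Finset.mem_singleton] at hb hc
    have h1 := T.ne h'
    have h2 := tri_ne_snd h'
    have h3 := tri_ne_trd h'
    rcases hb with hb | hb | hb
    · exact absurd hb.symm h1
    · subst hb
      exact ⟨rfl, T.unique h' hp⟩
    · subst hb
      rcases hc with hc | hc | hc
      · exact absurd hc h3
      · subst hc
        exact absurd h' (not_tri_odd hp)
      · exact absurd hc.symm h2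
  have ha : a' ∈ ({a, b, c} : Finset V) := by rw [← hf]; simp
  simp only [Finset.mem_insert, Finset.mem_singleton] at ha
  rcases ha with ha | ha | ha
  · exact Or.inl ⟨ha, key h hf ha⟩
  · refine Or.inr (Or.inl ⟨ha, key (T.rotate h) (hf.trans ?_) ha⟩)
    ext; simp; tauto
  · refine Or.inr (Or.inr ⟨ha, key (T.rotate (T.rotate h)) (hf.trans ?_) ha⟩)
    ext; simp; tauto

lemma exists_tri_of_mem [DecidableEq V] {a b c v : V} (h : T.tri a b c)
    (hv : v ∈ ({a, b, c} : Finset V)) :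
    ∃ p q, T.tri v p q ∧ ({v, p, q} : Finset V) = {a, b, c} := by
  simp only [Finset.mem_insert, Finset.mem_singleton] at hv
  rcases hv with rfl | rfl | rfl
  · exact ⟨b, c, h, rfl⟩
  · exact ⟨c, a, T.rotate h, by ext; simp; tauto⟩
  · exact ⟨a, b, T.rotate (T.rotate h), by ext; simp; tauto⟩

/-- A connected link cannot be left by a set of neighbours all of which have a successor. -/
lemma exists_exit {v : V} (hlink : ∀ a b : V, T.graph.Adj v a → T.graph.Adj v b →
      Relation.EqvGen (fun p q => T.tri v p q) a b) {S : Set V} (hfin : S.Finite) {a b : V}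
    (ha : a ∈ S) (hva : T.graph.Adj v a) (hvb : T.graph.Adj v b) (hb : b ∉ S)
    (hS : ∀ p ∈ S, ∃ q, T.tri v p q) : ∃ p q, T.tri v p q ∧ p ∈ S ∧ q ∉ S := by
  by_contra! hcon
  have hpred : ∀ p q, T.tri v p q → (p ∈ S ↔ q ∈ S) := fun p q h =>
    ⟨fun hp => hcon p q h hp, fun hq => closed_pred_of_closed_succ
      (R := fun p q => T.tri v p q) (fun _ _ _ => tri_unique_snd) hfin
      (fun p hp => (hS p hp).imp fun q hq => ⟨hcon p q hq hp, hq⟩) hq h⟩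
  have : ∀ x y, Relation.EqvGen (fun p q => T.tri v p q) x y → (x ∈ S ↔ y ∈ S) := by
    intro x y h
    induction h with
    | rel _ _ h => exact hpred _ _ h
    | refl => rfl
    | symm _ _ _ ih => exact ih.symm
    | trans _ _ _ _ _ ih ih' => exact ih.trans ih'
  exact hb ((this a b (hlink a b hva hvb)).1 ha)

lemma exists_entry {v : V} (hlink : ∀ a b : V, T.graph.Adj v a → T.graph.Adj v b →
      Relation.EqvGen (fun p q => T.tri v p q) a b) {S : Set V} (hfin : S.Finite) {a b : V}
    (ha : a ∈ S) (hva : T.graph.Adj v a) (hvb : T.graph.Adj v b) (hb : b ∉ S)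
    (hS : ∀ q ∈ S, ∃ p, T.tri v p q) : ∃ p q, T.tri v p q ∧ p ∉ S ∧ q ∈ S := by
  by_contra! hcon
  have hpred : ∀ p q, T.tri v p q → (p ∈ S ↔ q ∈ S) := fun p q h =>
    ⟨fun hp => closed_pred_of_closed_succ
      (R := fun p q => T.tri v q p) (fun _ _ _ => T.unique) hfin
      (fun q hq => (hS q hq).imp fun p hp => ⟨by_contra fun hn => hcon p q hp hn hq, hp⟩) hp h,
      fun hq => by_contra fun hn => hcon p q h hn hq⟩
  have : ∀ x y, Relation.EqvGen (fun p q => T.tri v p q) x y → (x ∈ S ↔ y ∈ S) := by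
    intro x y h
    induction h with
    | rel _ _ h => exact hpred _ _ h
    | refl => rfl
    | symm _ _ _ ih => exact ih.symm
    | trans _ _ _ _ _ ih ih' => exact ih.trans ih'
  exact hb ((this a b (hlink a b hva hvb)).1 ha)

end Combinatorics

/-! ### Counting triangles, edges and corners -/

section Counting

open Finset Classical

variable {V : Type*} [Fintype V] (T : OrientedTriangulation V)

/-- The ordered triangles, each triangle being listed with its three rotations. -/
noncomputable def triples : Finset (V × V × V) :=
  univ.filter fun t => T.tri t.1 t.2.1 t.2.2

variable {T}

lemma mem_triples {t : V × V × V} : t ∈ T.triples ↔ T.tri t.1 t.2.1 t.2.2 := by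
  simp [triples]

lemma sum_triples_rotate (f : V → V → V → ℕ) :
    ∑ t ∈ T.triples, f t.2.1 t.2.2 t.1 = ∑ t ∈ T.triples, f t.1 t.2.1 t.2.2 := by
  refine Finset.sum_nbij' (fun t => (t.2.1, t.2.2, t.1)) (fun t => (t.2.2, t.1, t.2.1))
    ?_ ?_ ?_ ?_ ?_
  · intro t ht
    exact mem_triples.2 (T.rotate (mem_triples.1 ht))
  · intro t ht
    exact mem_triples.2 (T.rotate (T.rotate (mem_triples.1 ht)))
  all_goals simp

lemma card_triples [DecidableEq V] : T.triples.card = 3 * T.faces.ncard := by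
  have hf : T.faces = ((T.triples.image fun t => ({t.1, t.2.1, t.2.2} : Finset V) :
      Finset (Finset V)) : Set (Finset V)) := by
    ext f
    simp only [faces, Set.mem_ofPred_eq, coe_image, Set.mem_image, mem_coe, mem_triples,
      Prod.exists]
    constructor
    · rintro ⟨a, b, c, h, rfl⟩
      exact ⟨a, b, c, h, rfl⟩
    · rintro ⟨a, b, c, h, rfl⟩
      exact ⟨a, b, c, h, rfl⟩
  rw [hf, Set.ncard_coe_finset,
    card_eq_sum_card_image (fun t : V × V × V => ({t.1, t.2.1, t.2.2} : Finset V)) T.triples,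
    mul_comm, ← smul_eq_mul, ← sum_const]
  refine sum_congr rfl fun f hf => ?_
  obtain ⟨⟨a, b, c⟩, ht, rfl⟩ := mem_image.1 hf
  have h := mem_triples.1 ht
  dsimp only at h ⊢
  rw [card_eq_three]
  refine ⟨(a, b, c), (b, c, a), (c, a, b), ?_, ?_, ?_, ?_⟩
  · simpa using fun h' => absurd h' (T.ne h)
  · simpa using fun h' => absurd h' (tri_ne_trd h).symm
  · simpa using fun h' => absurd h' (tri_ne_snd h)
  · ext ⟨a', b', c'⟩
    simp only [mem_filter, mem_triples, mem_insert, mem_singleton, Prod.mk.injEq]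
    constructor
    · rintro ⟨h', hf⟩
      exact tri_rotation_of_face_eq h h' hf
    · rintro (⟨rfl, rfl, rfl⟩ | ⟨rfl, rfl, rfl⟩ | ⟨rfl, rfl, rfl⟩)
      · exact ⟨h, rfl⟩
      · exact ⟨T.rotate h, by ext; simp; tauto⟩
      · exact ⟨T.rotate (T.rotate h), by ext; simp; tauto⟩

lemma two_mul_card_edges :
    2 * T.graph.edgeSet.ncard = (univ.filter fun q : V × V => T.graph.Adj q.1 q.2).card := by
  have h1 := T.graph.sum_degrees_eq_twice_card_edges
  have h2 : T.graph.edgeSet.ncard = T.graph.edgeFinset.card := by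
    rw [← SimpleGraph.coe_edgeFinset, Set.ncard_coe_finset]
  rw [h2, ← h1, card_filter, Fintype.sum_prod_type]
  refine sum_congr rfl fun v _ => ?_
  rw [← card_filter, ← SimpleGraph.card_neighborFinset_eq_degree]
  congr 1
  ext w
  simp

end Counting

end OrientedTriangulation

namespace OrientedTriangulation

/-! ### Regularity of the Dirichlet solution -/

/-- A function without singular vertices: level curves run through every vertex exactly once.
The corner `a, b` at `v` of a triangle `v, a, b` is *out-going* if `g b ≤ g v ≤ g a`: the
counter-clockwise level curve leaves `v` into this triangle. It is *in-coming* if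
`g a ≤ g v ≤ g b`. Edges with equal end values are boundary edges, all others lie in two
triangles. The conditions are invariant under `g ↦ -g`, which reverses the level curves. -/
structure Regular {V : Type*} (T : OrientedTriangulation V) (g : V → ℝ) : Prop where
  not_const : ∀ {a b e : V}, T.tri a b e → ¬ (g a = g b ∧ g b = g e)
  opp : ∀ {a b e : V}, T.tri a b e → g a ≠ g b → ∃ e', T.tri b a e'
  no_opp : ∀ {a b e e' : V}, T.tri a b e → g a = g b → ¬ T.tri b a e'
  exists_out : ∀ v, ∃ a b, T.tri v a b ∧ g b ≤ g v ∧ g v ≤ g a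
  exists_in : ∀ v, ∃ a b, T.tri v a b ∧ g a ≤ g v ∧ g v ≤ g b
  out_unique : ∀ {v a b a' b' : V}, T.tri v a b → g b ≤ g v → g v ≤ g a →
    T.tri v a' b' → g b' ≤ g v → g v ≤ g a' → a = a' ∧ b = b'
  in_unique : ∀ {v a b a' b' : V}, T.tri v a b → g a ≤ g v → g v ≤ g b →
    T.tri v a' b' → g a' ≤ g v → g v ≤ g b' → a = a' ∧ b = b'

lemma Regular.neg {V : Type*} {T : OrientedTriangulation V} {g : V → ℝ} (R : T.Regular g) :
    T.Regular (-g) where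
  not_const h := by simpa using R.not_const h
  opp h hab := R.opp h (by simpa using hab)
  no_opp h hab := R.no_opp h (by simpa using hab)
  exists_out v := by simpa [and_comm] using R.exists_in v
  exists_in v := by simpa [and_comm] using R.exists_out v
  out_unique h h1 h2 h' h1' h2' := R.in_unique h (by simpa using h2) (by simpa using h1) h'
    (by simpa using h2') (by simpa using h1')
  in_unique h h1 h2 h' h1' h2' := R.out_unique h (by simpa using h2) (by simpa using h1) h'
    (by simpa using h2') (by simpa using h1')

/-- The standing assumptions on the triangulation, the conductances and the solution. -/
structure DirichletData {V : Type*} [Fintype V] [DecidableEq V] (T : OrientedTriangulation V)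
    (E₁ E₂ : Finset V) (c : V → V → ℝ) (k : ℝ) (g : V → ℝ) : Prop where
  annulus : T.IsAnnulus E₁ E₂
  cond_symm : ∀ v w, c v w = c w v
  cond_pos : ∀ v w, T.graph.Adj v w → 0 < c v w
  k_pos : 0 < k
  sol : T.IsDirichletSolution E₁ E₂ c k g
  ne_of_adj : ∀ v w, T.graph.Adj v w → g v = g w → T.boundaryGraph.Adj v w

namespace DirichletData

variable {V : Type*} [Fintype V] [DecidableEq V] {T : OrientedTriangulation V}
  {E₁ E₂ : Finset V} {c : V → V → ℝ} {k : ℝ} {g : V → ℝ}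

lemma exists_adj (D : T.DirichletData E₁ E₂ c k g) (v : V) : ∃ w, T.graph.Adj v w := by
  obtain ⟨x, hx⟩ := D.annulus.nonempty₁
  obtain ⟨y, hy⟩ := D.annulus.nonempty₂
  have hxy : x ≠ y := fun h => Finset.disjoint_left.1 D.annulus.disjoint hx (h ▸ hy)
  have : Nontrivial V := ⟨x, y, hxy⟩
  exact D.annulus.connected.preconnected.exists_adj_of_nontrivial v

lemma boundary_adj (D : T.DirichletData E₁ E₂ c k g) {v w : V} (h : T.boundaryGraph.Adj v w) :
    (v ∈ E₁ ∧ w ∈ E₁) ∨ (v ∈ E₂ ∧ w ∈ E₂) := by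
  rcases (D.annulus.boundary v).2 ⟨w, h⟩ with hv | hv
  · exact Or.inl ⟨hv, (D.annulus.component₁ v hv w).1 h.reachable⟩
  · exact Or.inr ⟨hv, (D.annulus.component₂ v hv w).1 h.reachable⟩

lemma eq_of_boundary_adj (D : T.DirichletData E₁ E₂ c k g) {v w : V}
    (h : T.boundaryGraph.Adj v w) : g v = g w := by
  rcases D.boundary_adj h with ⟨hv, hw⟩ | ⟨hv, hw⟩
  · rw [D.sol.outer v hv, D.sol.outer w hw]
  · rw [D.sol.inner v hv, D.sol.inner w hw]

lemma ne_of_interior (D : T.DirichletData E₁ E₂ c k g) {v w : V} (h₁ : v ∉ E₁) (h₂ : v ∉ E₂)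
    (h : T.graph.Adj v w) : g v ≠ g w := fun he =>
  ((D.annulus.boundary v).2 ⟨w, D.ne_of_adj v w h he⟩).elim h₁ h₂

lemma exists_lt_of_interior (D : T.DirichletData E₁ E₂ c k g) {v : V} (h₁ : v ∉ E₁)
    (h₂ : v ∉ E₂) : ∃ w, T.graph.Adj v w ∧ g w < g v := by
  by_contra! hcon
  obtain ⟨w, hw⟩ := D.exists_adj v
  have hlap := D.sol.harmonic v h₁ h₂
  refine hlap.not_lt (Finset.sum_neg' (fun u hu => ?_) ⟨w, by simpa using hw, ?_⟩)
  · have hu : T.graph.Adj v u := by simpa using hu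
    nlinarith [D.cond_pos v u hu, hcon u hu]
  · nlinarith [D.cond_pos v w hw, lt_of_le_of_ne (hcon w hw) (D.ne_of_interior h₁ h₂ hw)]

lemma exists_gt_of_interior (D : T.DirichletData E₁ E₂ c k g) {v : V} (h₁ : v ∉ E₁)
    (h₂ : v ∉ E₂) : ∃ w, T.graph.Adj v w ∧ g v < g w := by
  by_contra! hcon
  obtain ⟨w, hw⟩ := D.exists_adj v
  have hlap := D.sol.harmonic v h₁ h₂
  refine hlap.not_gt (Finset.sum_pos' (fun u hu => ?_) ⟨w, by simpa using hw, ?_⟩)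
  · have hu : T.graph.Adj v u := by simpa using hu
    exact mul_nonneg (D.cond_pos v u hu).le (sub_nonneg.2 (hcon u hu))
  · exact mul_pos (D.cond_pos v w hw)
      (sub_pos.2 (lt_of_le_of_ne (hcon w hw) (D.ne_of_interior h₁ h₂ hw).symm))

lemma le_outer (D : T.DirichletData E₁ E₂ c k g) (v : V) : g v ≤ k := by
  have : Nonempty V := ⟨v⟩
  obtain ⟨m, hm⟩ := Finite.exists_max g
  refine (hm v).trans ?_
  by_cases h₁ : m ∈ E₁
  · exact (D.sol.outer m h₁).le
  by_cases h₂ : m ∈ E₂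
  · exact (D.sol.inner m h₂).trans_le D.k_pos.le
  obtain ⟨w, -, hw⟩ := D.exists_gt_of_interior h₁ h₂
  exact absurd (hm w) hw.not_ge

lemma inner_le (D : T.DirichletData E₁ E₂ c k g) (v : V) : 0 ≤ g v := by
  have : Nonempty V := ⟨v⟩
  obtain ⟨m, hm⟩ := Finite.exists_min g
  refine le_trans ?_ (hm v)
  by_cases h₁ : m ∈ E₁
  · exact D.k_pos.le.trans_eq (D.sol.outer m h₁).symm
  by_cases h₂ : m ∈ E₂
  · exact (D.sol.inner m h₂).ge
  obtain ⟨w, -, hw⟩ := D.exists_lt_of_interior h₁ h₂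
  exact absurd (hm w) hw.not_ge

lemma mem_outer_iff (D : T.DirichletData E₁ E₂ c k g) {v : V} : v ∈ E₁ ↔ g v = k := by
  refine ⟨D.sol.outer v, fun h => by_contra fun h₁ => ?_⟩
  by_cases h₂ : v ∈ E₂
  · exact D.k_pos.ne (D.sol.inner v h₂ ▸ h)
  · obtain ⟨w, -, hw⟩ := D.exists_gt_of_interior h₁ h₂
    exact absurd (D.le_outer w) (by linarith)

lemma mem_inner_iff (D : T.DirichletData E₁ E₂ c k g) {v : V} : v ∈ E₂ ↔ g v = 0 := by
  refine ⟨D.sol.inner v, fun h => by_contra fun h₂ => ?_⟩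
  by_cases h₁ : v ∈ E₁
  · exact D.k_pos.ne ((D.sol.outer v h₁ ▸ h).symm)
  · obtain ⟨w, -, hw⟩ := D.exists_lt_of_interior h₁ h₂
    exact absurd (D.inner_le w) (by linarith)

/-- An edge of a triangle with equal end values lies in no further triangle. -/
lemma no_opp (D : T.DirichletData E₁ E₂ c k g) {a b e e' : V} (h : T.tri a b e)
    (hab : g a = g b) : ¬ T.tri b a e' := fun h' => by
  rcases D.ne_of_adj a b (adj_of_tri h) hab with ⟨-, hn⟩ | ⟨-, hn⟩
  · exact hn ⟨e', h'⟩
  · exact hn ⟨e, h⟩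

lemma opp (D : T.DirichletData E₁ E₂ c k g) {a b e : V} (h : T.tri a b e)
    (hab : g a ≠ g b) : ∃ e', T.tri b a e' := by
  by_contra hn
  exact hab (D.eq_of_boundary_adj (Or.inl ⟨⟨e, h⟩, hn⟩))

lemma exists_tri_of_adj (D : T.DirichletData E₁ E₂ c k g) {a b : V} (h : T.graph.Adj a b)
    (hab : g a ≠ g b) : (∃ e, T.tri a b e) ∧ ∃ e, T.tri b a e := by
  rcases h with ⟨e, h⟩ | ⟨e, h⟩
  · exact ⟨⟨e, h⟩, D.opp h hab⟩
  · exact ⟨D.opp h hab.symm, ⟨e, h⟩⟩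

/-- A triangle with three equal values would have three boundary edges, and would be a connected
component of the triangulation. -/
lemma not_const (D : T.DirichletData E₁ E₂ c k g) {a b e : V} (h : T.tri a b e) :
    ¬ (g a = g b ∧ g b = g e) := by
  rintro ⟨hab, hbe⟩
  have key : ∀ {a b e : V}, T.tri a b e → g a = g b → g b = g e → ∀ w, T.graph.Adj a w →
      w = b ∨ w = e := by
    intro a b e h hab hbe w hw
    have hstep : ∀ p q, T.tri a p q → ((p = b ∨ p = e) ↔ (q = b ∨ q = e)) := by
      intro p q hpq
      constructor
      · rintro (rfl | rfl)
        · exact Or.inr (T.unique hpq h)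
        · exact absurd hpq (D.no_opp (T.rotate (T.rotate h)) (hbe.symm.trans hab.symm))
      · rintro (rfl | rfl)
        · exact absurd (T.rotate (T.rotate hpq)) (D.no_opp h hab)
        · exact Or.inl (tri_unique_snd hpq h)
    have : ∀ x y, Relation.EqvGen (fun p q => T.tri a p q) x y →
        ((x = b ∨ x = e) ↔ (y = b ∨ y = e)) := by
      intro x y h
      induction h with
      | rel _ _ h => exact hstep _ _ h
      | refl => rfl
      | symm _ _ _ ih => exact ih.symm
      | trans _ _ _ _ _ ih ih' => exact ih.trans ih'
    exact (this b w (D.annulus.link_connected a b w (adj_of_tri h) hw)).1 (Or.inl rfl)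
  have hclosed : ∀ u w, T.graph.Reachable u w → (u = a ∨ u = b ∨ u = e) →
      (w = a ∨ w = b ∨ w = e) := by
    rintro u w ⟨q⟩
    induction q with
    | nil => exact id
    | cons hadj _ ih =>
      intro hu
      apply ih
      rcases hu with rfl | rfl | rfl
      · rcases key h hab hbe _ hadj with h | h <;> simp [h]
      · rcases key (T.rotate h) hbe (hbe.symm.trans hab.symm) _ hadj with h | h <;> simp [h]
      · rcases key (T.rotate (T.rotate h)) (hbe.symm.trans hab.symm) hab _ hadj with h | h <;>
          simp [h]
  have hall : ∀ w, g w = g a := by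
    intro w
    rcases hclosed a w (D.annulus.connected.preconnected a w) (Or.inl rfl) with rfl | rfl | rfl
    · rfl
    · exact hab.symm
    · exact hbe.symm.trans hab.symm
  obtain ⟨x, hx⟩ := D.annulus.nonempty₁
  obtain ⟨y, hy⟩ := D.annulus.nonempty₂
  have hk := D.k_pos
  rw [← D.sol.outer x hx, hall x, ← hall y, D.sol.inner y hy] at hk
  exact lt_irrefl _ hk

lemma exists_boundary_apex (D : T.DirichletData E₁ E₂ c k g) {v : V} (h : v ∈ E₁ ∨ v ∈ E₂) :
    ∃ w e, T.graph.Adj v w ∧ T.graph.Adj v e ∧ g w = g v ∧ g e ≠ g v := by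
  obtain ⟨w, hw⟩ := (D.annulus.boundary v).1 h
  have hg := D.eq_of_boundary_adj hw
  rcases hw with ⟨⟨e, he⟩, -⟩ | ⟨⟨e, he⟩, -⟩
  · exact ⟨w, e, adj_of_tri he, adj_of_tri' he, hg.symm,
      fun h => D.not_const he ⟨hg, hg.symm.trans h.symm⟩⟩
  · exact ⟨w, e, (adj_of_tri he).symm, adj_of_tri (T.rotate he), hg.symm,
      fun h => D.not_const he ⟨hg.symm, h.symm⟩⟩

lemma exists_lower (D : T.DirichletData E₁ E₂ c k g) {v : V} (h : v ∉ E₂) :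
    ∃ w, T.graph.Adj v w ∧ g w < g v := by
  by_cases h₁ : v ∈ E₁
  · obtain ⟨_, e, -, he, -, hne⟩ := D.exists_boundary_apex (Or.inl h₁)
    exact ⟨e, he, lt_of_le_of_ne (by rw [D.sol.outer v h₁]; exact D.le_outer e) hne⟩
  · exact D.exists_lt_of_interior h₁ h

lemma exists_upper (D : T.DirichletData E₁ E₂ c k g) {v : V} (h : v ∉ E₁) :
    ∃ w, T.graph.Adj v w ∧ g v < g w := by
  by_cases h₂ : v ∈ E₂
  · obtain ⟨_, e, -, he, -, hne⟩ := D.exists_boundary_apex (Or.inr h₂)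
    exact ⟨e, he, lt_of_le_of_ne (by rw [D.sol.inner v h₂]; exact D.inner_le e) hne.symm⟩
  · exact D.exists_gt_of_interior h h₂

lemma exists_out_in (D : T.DirichletData E₁ E₂ c k g) (v : V) :
    (∃ a b, T.tri v a b ∧ g b ≤ g v ∧ g v ≤ g a) ∧
      ∃ a b, T.tri v a b ∧ g a ≤ g v ∧ g v ≤ g b := by
  by_cases h₂ : v ∈ E₂
  · obtain ⟨w, e, hw, -, hgw, -⟩ := D.exists_boundary_apex (Or.inr h₂)
    obtain ⟨u, hu, hgu⟩ := D.exists_upper (v := v)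
      (fun h₁ => Finset.disjoint_left.1 D.annulus.disjoint h₁ h₂)
    have huS : u ∈ {u | T.graph.Adj v u ∧ g v < g u} := ⟨hu, hgu⟩
    have hw' : w ∉ {u | T.graph.Adj v u ∧ g v < g u} := fun h => by
      have := h.2; linarith
    have htri : ∀ p ∈ {u | T.graph.Adj v u ∧ g v < g u}, (∃ q, T.tri v p q) ∧
        ∃ q, T.tri v q p := fun p hp => by
      obtain ⟨⟨q, hq⟩, ⟨r, hr⟩⟩ := D.exists_tri_of_adj hp.1 hp.2.ne
      exact ⟨⟨q, hq⟩, ⟨r, T.rotate hr⟩⟩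
    obtain ⟨p, q, h1, hp, hq⟩ := exists_exit (D.annulus.link_connected v) (Set.toFinite _)
      huS hu hw hw' fun p hp => (htri p hp).1
    obtain ⟨p', q', h1', hp', hq'⟩ := exists_entry (D.annulus.link_connected v) (Set.toFinite _)
      huS hu hw hw' fun p hp => (htri p hp).2
    exact ⟨⟨p, q, h1, not_lt.1 fun h => hq ⟨adj_of_tri' h1, h⟩, hp.2.le⟩,
      ⟨p', q', h1', not_lt.1 fun h => hp' ⟨adj_of_tri h1', h⟩, hq'.2.le⟩⟩
  · obtain ⟨u, hu, hgu⟩ := D.exists_lower h₂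
    obtain ⟨w, hw, hgw⟩ : ∃ w, T.graph.Adj v w ∧ g v ≤ g w := by
      by_cases h₁ : v ∈ E₁
      · obtain ⟨w, e, hw, -, hgw, -⟩ := D.exists_boundary_apex (Or.inl h₁)
        exact ⟨w, hw, hgw.ge⟩
      · obtain ⟨w, hw, hgw⟩ := D.exists_upper h₁
        exact ⟨w, hw, hgw.le⟩
    have huS : u ∈ {u | T.graph.Adj v u ∧ g u < g v} := ⟨hu, hgu⟩
    have hw' : w ∉ {u | T.graph.Adj v u ∧ g u < g v} := fun h => by
      have := h.2; linarith
    have htri : ∀ p ∈ {u | T.graph.Adj v u ∧ g u < g v}, (∃ q, T.tri v p q) ∧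
        ∃ q, T.tri v q p := fun p hp => by
      obtain ⟨⟨q, hq⟩, ⟨r, hr⟩⟩ := D.exists_tri_of_adj hp.1 hp.2.ne'
      exact ⟨⟨q, hq⟩, ⟨r, T.rotate hr⟩⟩
    obtain ⟨p, q, h1, hp, hq⟩ := exists_exit (D.annulus.link_connected v) (Set.toFinite _)
      huS hu hw hw' fun p hp => (htri p hp).1
    obtain ⟨p', q', h1', hp', hq'⟩ := exists_entry (D.annulus.link_connected v) (Set.toFinite _)
      huS hu hw hw' fun p hp => (htri p hp).2
    exact ⟨⟨p', q', h1', hq'.2.le, not_lt.1 fun h => hp' ⟨adj_of_tri h1', h⟩⟩,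
      ⟨p, q, h1, hp.2.le, not_lt.1 fun h => hq ⟨adj_of_tri' h1, h⟩⟩⟩

section Euler

open Finset Classical

/-- Each triangle without an edge of equal end values contributes one in-coming or out-going
corner, each other triangle two. With the Euler characteristic, the total number is twice the
number of the vertices. -/
lemma card_corners (D : T.DirichletData E₁ E₂ c k g) :
    (T.triples.filter fun t => g t.2.2 ≤ g t.1 ∧ g t.1 ≤ g t.2.1).card +
      (T.triples.filter fun t => g t.2.1 ≤ g t.1 ∧ g t.1 ≤ g t.2.2).card =
      2 * Fintype.card V := by
  set H := (T.triples.filter fun t => g t.1 = g t.2.1).card with hH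
  set f : V → V → V → ℕ := fun a b e =>
    (if g e ≤ g a ∧ g a ≤ g b then 1 else 0) + (if g b ≤ g a ∧ g a ≤ g e then 1 else 0) with hf
  set h : V → V → V → ℕ := fun a b _ => if g a = g b then 1 else 0 with hh
  have hcount : ∑ t ∈ T.triples, f t.1 t.2.1 t.2.2 =
      (T.triples.filter fun t => g t.2.2 ≤ g t.1 ∧ g t.1 ≤ g t.2.1).card +
      (T.triples.filter fun t => g t.2.1 ≤ g t.1 ∧ g t.1 ≤ g t.2.2).card := by
    rw [card_filter, card_filter, ← sum_add_distrib]
  have hcountH : ∑ t ∈ T.triples, h t.1 t.2.1 t.2.2 = H := by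
    rw [hH, card_filter]
  have hpt : ∀ t ∈ T.triples, f t.1 t.2.1 t.2.2 + f t.2.1 t.2.2 t.1 + f t.2.2 t.1 t.2.1 =
      1 + h t.1 t.2.1 t.2.2 + h t.2.1 t.2.2 t.1 + h t.2.2 t.1 t.2.1 := by
    rintro ⟨a, b, e⟩ ht
    have hnc := D.not_const (mem_triples.1 ht)
    simp only [hf, hh]
    simp only at hnc
    rcases lt_trichotomy (g a) (g b) with h1 | h1 | h1 <;>
    rcases lt_trichotomy (g b) (g e) with h2 | h2 | h2 <;>
    rcases lt_trichotomy (g e) (g a) with h3 | h3 | h3 <;>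
    first
      | (exfalso; linarith)
      | (exfalso; exact hnc ⟨by linarith, by linarith⟩)
      | (simp [h1.le, h1.ne, h1.ne', h1.not_ge, h2.le, h2.ne, h2.ne', h2.not_ge,
          h3.le, h3.ne, h3.ne', h3.not_ge])
      | (simp [h1, h2.le, h2.ne, h2.ne', h2.not_ge]; done)
      | (simp [h2, h3.le, h3.ne, h3.ne', h3.not_ge])
      | (simp [h3, h1.le, h1.ne, h1.ne', h1.not_ge])
  have hsum := sum_congr rfl hpt
  simp only [sum_add_distrib] at hsum
  have e1 := sum_triples_rotate (T := T) f
  have e2 := sum_triples_rotate (T := T) fun a b c => f b c a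
  have e3 := sum_triples_rotate (T := T) h
  have e4 := sum_triples_rotate (T := T) fun a b c => h b c a
  rw [e2, e1, e4, e3, hcount, hcountH] at hsum
  simp only [sum_const, smul_eq_mul, mul_one] at hsum
  have hedges : (univ.filter fun q : V × V => T.graph.Adj q.1 q.2).card = T.triples.card + H := by
    have hsplit : (univ.filter fun q : V × V => T.graph.Adj q.1 q.2) =
        (T.triples.image fun t => (t.1, t.2.1)) ∪
        ((T.triples.filter fun t => g t.1 = g t.2.1).image fun t => (t.2.1, t.1)) := by
      ext ⟨a, b⟩
      simp only [mem_filter, mem_univ, true_and, mem_union, mem_image, mem_triples, Prod.exists,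
        Prod.mk.injEq]
      constructor
      · rintro (⟨e, he⟩ | ⟨e, he⟩)
        · exact Or.inl ⟨a, b, e, he, rfl, rfl⟩
        · by_cases hab : g b = g a
          · exact Or.inr ⟨b, a, e, ⟨he, hab⟩, rfl, rfl⟩
          · obtain ⟨e', he'⟩ := D.opp he hab
            exact Or.inl ⟨a, b, e', he', rfl, rfl⟩
      · rintro (⟨a, b, e, he, rfl, rfl⟩ | ⟨a, b, e, ⟨he, -⟩, rfl, rfl⟩)
        · exact adj_of_tri he
        · exact (adj_of_tri he).symm
    rw [hsplit, card_union_of_disjoint, card_image_of_injOn, card_image_of_injOn]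
    · rintro ⟨a, b, e⟩ ht ⟨a', b', e'⟩ ht' heq
      simp only [Prod.mk.injEq] at heq
      obtain ⟨rfl, rfl⟩ := heq
      have h1 := mem_triples.1 (mem_filter.1 (mem_coe.1 ht)).1
      have h2 := mem_triples.1 (mem_filter.1 (mem_coe.1 ht')).1
      simp only [Prod.mk.injEq, true_and]
      exact T.unique h1 h2
    · rintro ⟨a, b, e⟩ ht ⟨a', b', e'⟩ ht' heq
      simp only [Prod.mk.injEq] at heq
      obtain ⟨rfl, rfl⟩ := heq
      simp only [Prod.mk.injEq, true_and]
      exact T.unique (mem_triples.1 (mem_coe.1 ht)) (mem_triples.1 (mem_coe.1 ht'))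
    · rw [disjoint_left]
      rintro ⟨a, b⟩ h1 h2
      simp only [mem_image, mem_filter, mem_triples, Prod.exists, Prod.mk.injEq] at h1 h2
      obtain ⟨a, b, e, h1, rfl, rfl⟩ := h1
      obtain ⟨a', b', e', ⟨h2, h3⟩, rfl, rfl⟩ := h2
      exact D.no_opp h2 h3 h1
  have h2E := two_mul_card_edges (T := T)
  have h3F := card_triples (T := T)
  have hχ := D.annulus.euler
  omega

lemma corner_unique (O : V → V → V → Prop) [∀ v a b, Decidable (O v a b)]
    (hO : ∀ v, ∃ a b, T.tri v a b ∧ O v a b)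
    (hcard : (T.triples.filter fun t => O t.1 t.2.1 t.2.2).card ≤ Fintype.card V)
    {v a b a' b' : V} (h : T.tri v a b) (hab : O v a b) (h' : T.tri v a' b')
    (hab' : O v a' b') : a = a' ∧ b = b' := by
  have := Finset.inj_on_of_surj_on_of_card_le
    (s := T.triples.filter fun t => O t.1 t.2.1 t.2.2) (t := univ)
    (fun t _ => t.1) (fun _ _ => mem_univ _)
    (fun v _ => by
      obtain ⟨a, b, h1, h2⟩ := hO v
      exact ⟨(v, a, b), mem_filter.2 ⟨mem_triples.2 h1, h2⟩, rfl⟩) (by simpa using hcard)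
    (a₁ := (v, a, b)) (mem_filter.2 ⟨mem_triples.2 h, hab⟩)
    (a₂ := (v, a', b')) (mem_filter.2 ⟨mem_triples.2 h', hab'⟩) rfl
  simpa using this

lemma card_le_corners (O : V → V → V → Prop) [∀ v a b, Decidable (O v a b)]
    (hO : ∀ v, ∃ a b, T.tri v a b ∧ O v a b) :
    Fintype.card V ≤ (T.triples.filter fun t => O t.1 t.2.1 t.2.2).card := by
  rw [← card_univ]
  exact card_le_card_of_surjOn (fun t => t.1) fun v _ => by
    obtain ⟨a, b, h1, h2⟩ := hO v
    exact ⟨(v, a, b), mem_filter.2 ⟨mem_triples.2 h1, h2⟩, rfl⟩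

/-- By the Euler characteristic, no vertex is singular: the corners counted in `card_corners` are
at least one in-coming and one out-going corner at every vertex, so they are exactly these. -/
lemma regular (D : T.DirichletData E₁ E₂ c k g) : T.Regular g := by
  have h1 := card_le_corners (T := T) (fun v a b => g b ≤ g v ∧ g v ≤ g a)
    fun v => (D.exists_out_in v).1
  have h2 := card_le_corners (T := T) (fun v a b => g a ≤ g v ∧ g v ≤ g b)
    fun v => (D.exists_out_in v).2
  have h3 := D.card_corners
  exact
  { not_const := D.not_const
    opp := D.opp
    no_opp := D.no_opp
    exists_out := fun v => (D.exists_out_in v).1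
    exists_in := fun v => (D.exists_out_in v).2
    out_unique := fun h ha hb h' ha' hb' =>
      corner_unique (fun v a b => g b ≤ g v ∧ g v ≤ g a) (fun v => (D.exists_out_in v).1)
        (by omega) h ⟨ha, hb⟩ h' ⟨ha', hb'⟩
    in_unique := fun h ha hb h' ha' hb' =>
      corner_unique (fun v a b => g a ≤ g v ∧ g v ≤ g b) (fun v => (D.exists_out_in v).2)
        (by omega) h ⟨ha, hb⟩ h' ⟨ha', hb'⟩ }

end Euler

end DirichletData

end OrientedTriangulation

namespace OrientedTriangulation

/-! ### Points of triangles and level segments -/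

section Points

variable {V : Type*} [Fintype V] [DecidableEq V] {T : OrientedTriangulation V} {g : V → ℝ}

/-- The point at level `s` of the line through the vertices `a` and `b`, in barycentric
coordinates; a junk value if `g a = g b`. -/
noncomputable def edgePoint (g : V → ℝ) (a b : V) (s : ℝ) : V → ℝ :=
  Pi.single a (1 - (s - g a) / (g b - g a)) + Pi.single b ((s - g a) / (g b - g a))

variable (T) in
/-- `n` is (the system of barycentric coordinates of) a point of the triangle `f`. -/
def Mem (f : Finset V) (n : V → ℝ) : Prop :=
  f ∈ T.faces ∧ n ∈ stdSimplex ℝ V ∧ ∀ v, v ∉ f → n v = 0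

/-- The direction of the counter-clockwise level segments in the triangle `a, b, e`. -/
def dir (g : V → ℝ) (a b e : V) : V → ℝ :=
  Pi.single a (g e - g b) + Pi.single b (g a - g e) + Pi.single e (g b - g a)

variable (T) in
/-- The point `n'` of the plane of the triangle `f` lies counter-clockwise after `n` on a level
line of `g`. -/
def FaceAhead (g : V → ℝ) (f : Finset V) (n n' : V → ℝ) : Prop :=
  ∃ (a b e : V) (m : ℝ), T.tri a b e ∧ f = {a, b, e} ∧ 0 < m ∧ n' = n + m • dir g a b e

variable (T) in
/-- The points at level `s` of the edges with distinct end values. For a regular function they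
include all vertices at level `s`, and, if `s` is the level of a vertex, they are the vertices at
level `s` of the refined decomposition. -/
def nodes (g : V → ℝ) (s : ℝ) : Set (V → ℝ) :=
  {n | ∃ w u, T.graph.Adj w u ∧ g w < g u ∧ g w ≤ s ∧ s ≤ g u ∧ n = edgePoint g w u s}

lemma face_mem {a b e : V} (h : T.tri a b e) : ({a, b, e} : Finset V) ∈ T.faces :=
  ⟨a, b, e, h, rfl⟩

lemma dir_rotate (g : V → ℝ) (a b e : V) : dir g b e a = dir g a b e := by
  unfold dir; abel

lemma dir_fst {a b e : V} (h : T.tri a b e) : dir g a b e a = g e - g b := by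
  simp [dir, T.ne h, (tri_ne_trd h).symm]

lemma dir_snd {a b e : V} (h : T.tri a b e) : dir g a b e b = g a - g e := by
  rw [← dir_rotate]; exact dir_fst (T.rotate h)

lemma dir_trd {a b e : V} (h : T.tri a b e) : dir g a b e e = g b - g a := by
  rw [← dir_rotate, ← dir_rotate]; exact dir_fst (T.rotate (T.rotate h))

lemma dir_neg (g : V → ℝ) (a b e : V) : dir (-g) a b e = - dir g a b e := by
  simp only [dir, Pi.neg_apply, neg_add, ← Pi.single_neg]
  congr 2 <;> congr 1 <;> ring

lemma edgePoint_neg (g : V → ℝ) (a b : V) (s : ℝ) :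
    edgePoint (-g) a b (-s) = edgePoint g a b s := by
  have : (-s - -g a) / (-g b - -g a) = (s - g a) / (g b - g a) := by
    rw [← neg_div_neg_eq]; congr 1 <;> ring
  simp only [edgePoint, Pi.neg_apply, this]

lemma edgePoint_fst {a b : V} (hab : a ≠ b) (s : ℝ) :
    edgePoint g a b s a = 1 - (s - g a) / (g b - g a) := by
  simp [edgePoint, hab]

lemma edgePoint_snd {a b : V} (hab : a ≠ b) (s : ℝ) :
    edgePoint g a b s b = (s - g a) / (g b - g a) := by
  simp [edgePoint, hab.symm]

lemma edgePoint_of_ne {a b v : V} (ha : v ≠ a) (hb : v ≠ b) (s : ℝ) :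
    edgePoint g a b s v = 0 := by
  simp [edgePoint, ha, hb]

lemma edgePoint_self_left (g : V → ℝ) (a b : V) : edgePoint g a b (g a) = Pi.single a 1 := by
  simp [edgePoint]

lemma edgePoint_self_right {a b : V} (h : g a ≠ g b) :
    edgePoint g a b (g b) = Pi.single b 1 := by
  simp [edgePoint, div_self (sub_ne_zero.2 h.symm)]

lemma edgePoint_comm {a b : V} (h : g a ≠ g b) (s : ℝ) :
    edgePoint g a b s = edgePoint g b a s := by
  have h1 : g b - g a ≠ 0 := sub_ne_zero.2 h.symm
  have h2 : g a - g b ≠ 0 := sub_ne_zero.2 h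
  have h3 : 1 - (s - g a) / (g b - g a) = (s - g b) / (g a - g b) := by
    field_simp; ring
  have h4 : (s - g a) / (g b - g a) = 1 - (s - g b) / (g a - g b) := by
    rw [← h3]; ring
  rw [edgePoint, edgePoint, h3, h4, add_comm]

lemma edgePoint_affine (g : V → ℝ) (a b : V) (t₀ t₁ r : ℝ) :
    edgePoint g a b ((1 - r) * t₀ + r * t₁) =
      (1 - r) • edgePoint g a b t₀ + r • edgePoint g a b t₁ := by
  ext v
  simp only [edgePoint, Pi.add_apply, Pi.smul_apply, smul_eq_mul, Pi.single_apply]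
  split_ifs <;> ring

lemma sum_edgePoint (g h : V → ℝ) (a b : V) (s : ℝ) :
    ∑ v, edgePoint g a b s v * h v =
      (1 - (s - g a) / (g b - g a)) * h a + (s - g a) / (g b - g a) * h b := by
  simp [edgePoint, add_mul, Finset.sum_add_distrib, Pi.single_apply, ite_mul]

lemma level_edgePoint {a b : V} (h : g a ≠ g b) (s : ℝ) : level g (edgePoint g a b s) = s := by
  have h1 : g b - g a ≠ 0 := sub_ne_zero.2 h.symm
  rw [level, sum_edgePoint]
  field_simp; ring

lemma ratio_mem {x y s : ℝ} (h : x ≠ y) (hs : (x ≤ s ∧ s ≤ y) ∨ (y ≤ s ∧ s ≤ x)) :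
    0 ≤ (s - x) / (y - x) ∧ (s - x) / (y - x) ≤ 1 := by
  rcases lt_or_gt_of_ne h with h | h
  · have h1 : 0 < y - x := sub_pos.2 h
    rcases hs with hs | hs
    · exact ⟨div_nonneg (by linarith) h1.le, (div_le_one h1).2 (by linarith)⟩
    · exact absurd (hs.1.trans hs.2) h.not_ge
  · have h1 : y - x < 0 := sub_neg.2 h
    rcases hs with hs | hs
    · exact absurd (hs.1.trans hs.2) h.not_ge
    · exact ⟨div_nonneg_of_nonpos (by linarith) h1.le, (div_le_one_of_neg h1).2 (by linarith)⟩

lemma edgePoint_mem_stdSimplex {a b : V} {s : ℝ} (h : g a ≠ g b)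
    (hs : (g a ≤ s ∧ s ≤ g b) ∨ (g b ≤ s ∧ s ≤ g a)) :
    edgePoint g a b s ∈ stdSimplex ℝ V := by
  obtain ⟨h0, h1⟩ := ratio_mem h hs
  refine ⟨fun v => ?_, ?_⟩
  · simp only [edgePoint, Pi.add_apply, Pi.single_apply]
    split_ifs <;> linarith
  · have := sum_edgePoint g (fun _ => 1) a b s
    simpa using this

lemma mem_edgePoint {f : Finset V} {a b : V} {s : ℝ} (hf : f ∈ T.faces) (ha : a ∈ f)
    (hb : b ∈ f) (h : g a ≠ g b) (hs : (g a ≤ s ∧ s ≤ g b) ∨ (g b ≤ s ∧ s ≤ g a)) :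
    T.Mem f (edgePoint g a b s) :=
  ⟨hf, edgePoint_mem_stdSimplex h hs, fun v hv =>
    edgePoint_of_ne (fun h => hv (by rwa [h])) (fun h => hv (by rwa [h])) s⟩

lemma mem_single {f : Finset V} {a : V} (hf : f ∈ T.faces) (ha : a ∈ f) :
    T.Mem f (Pi.single a 1) :=
  ⟨hf, single_mem_stdSimplex ℝ a, fun v hv => Pi.single_eq_of_ne (fun h => hv (by rwa [h])) 1⟩

lemma Mem.combo {f : Finset V} {n n' : V → ℝ} (h : T.Mem f n) (h' : T.Mem f n') {r : ℝ}
    (h0 : 0 ≤ r) (h1 : r ≤ 1) : T.Mem f ((1 - r) • n + r • n') :=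
  ⟨h.1, convex_stdSimplex ℝ V h.2.1 h'.2.1 (by linarith) h0 (by ring), fun v hv => by
    simp [h.2.2 v hv, h'.2.2 v hv]⟩

lemma sum_face {a b e : V} (h : T.tri a b e) {n : V → ℝ}
    (hn : ∀ v, v ∉ ({a, b, e} : Finset V) → n v = 0) (w : V → ℝ) :
    ∑ v, n v * w v = n a * w a + n b * w b + n e * w e := by
  rw [← Finset.sum_subset (Finset.subset_univ ({a, b, e} : Finset V))
    (fun v _ hv => by rw [hn v hv, zero_mul]), Finset.sum_insert, Finset.sum_pair (tri_ne_snd h)]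
  · ring
  · simp [T.ne h, (tri_ne_trd h).symm]

lemma Mem.sum_eq {a b e : V} (h : T.tri a b e) {n : V → ℝ} (hn : T.Mem {a, b, e} n) :
    n a + n b + n e = 1 := by
  have := sum_face h hn.2.2 (fun _ => 1)
  simpa [hn.2.1.2] using this.symm

lemma Mem.level_eq {a b e : V} (h : T.tri a b e) {n : V → ℝ} (hn : T.Mem {a, b, e} n) :
    level g n = n a * g a + n b * g b + n e * g e :=
  sum_face h hn.2.2 g

lemma Mem.nonneg {f : Finset V} {n : V → ℝ} (h : T.Mem f n) (v : V) : 0 ≤ n v := h.2.1.1 v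

lemma level_single (v : V) : level g (Pi.single v 1) = g v := by
  simp [level, Pi.single_apply]

lemma level_combo (r : ℝ) (n n' : V → ℝ) :
    level g ((1 - r) • n + r • n') = (1 - r) * level g n + r * level g n' := by
  simp only [level, Pi.add_apply, Pi.smul_apply, smul_eq_mul, add_mul, Finset.sum_add_distrib,
    mul_assoc, ← Finset.mul_sum]

lemma eq_single {n : V → ℝ} (hn : n ∈ stdSimplex ℝ V) {v : V} (hv : n v = 1) :
    n = Pi.single v 1 := by
  have h0 : ∑ u ∈ Finset.univ.erase v, n u = 0 := by
    have := Finset.add_sum_erase Finset.univ n (Finset.mem_univ v)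
    rw [hn.2, hv] at this
    linarith
  rw [Finset.sum_eq_zero_iff_of_nonneg fun u _ => hn.1 u] at h0
  ext u
  by_cases hu : u = v
  · subst hu; simpa using hv
  · simpa [hu] using h0 u (by simp [hu])

lemma sum_of_support {n : V → ℝ} {a b : V} (hab : a ≠ b) (h : ∀ v, v ≠ a → v ≠ b → n v = 0)
    (w : V → ℝ) : ∑ v, n v * w v = n a * w a + n b * w b := by
  rw [← Finset.sum_subset (Finset.subset_univ ({a, b} : Finset V)), Finset.sum_pair hab]
  intro v _ hv
  simp only [Finset.mem_insert, Finset.mem_singleton, not_or] at hv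
  rw [h v hv.1 hv.2, zero_mul]

lemma eq_edgePoint {n : V → ℝ} (hn : n ∈ stdSimplex ℝ V) {a b : V} (hab : g a ≠ g b)
    (h : ∀ v, v ≠ a → v ≠ b → n v = 0) : n = edgePoint g a b (level g n) := by
  have hne : a ≠ b := fun h => hab (h ▸ rfl)
  have h1 : g b - g a ≠ 0 := sub_ne_zero.2 hab.symm
  have key := sum_of_support hne h
  have hsum : n a + n b = 1 := by
    have := key fun _ => 1
    simpa [hn.2] using this.symm
  have hb : n b = (level g n - g a) / (g b - g a) := by
    rw [level, key g, eq_div_iff h1]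
    linear_combination (-g a) * hsum
  ext v
  by_cases hva : v = a
  · subst hva; rw [edgePoint_fst hne, ← hb]; linarith
  by_cases hvb : v = b
  · subst hvb; rw [edgePoint_snd hne, ← hb]
  · rw [edgePoint_of_ne hva hvb, h v hva hvb]

lemma edgePoint_sub {a b e : V} (h : T.tri a b e) (hb : g a ≠ g b) (he : g a ≠ g e) (s : ℝ) :
    edgePoint g a e s = edgePoint g a b s +
      ((s - g a) / ((g b - g a) * (g e - g a))) • dir g a b e := by
  have h1 : g b - g a ≠ 0 := sub_ne_zero.2 hb.symm
  have h2 : g e - g a ≠ 0 := sub_ne_zero.2 he.symm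
  ext v
  simp only [Pi.add_apply, Pi.smul_apply, smul_eq_mul]
  by_cases hva : v = a
  · subst hva
    rw [edgePoint_fst (T.ne h), edgePoint_fst (tri_ne_trd h).symm, dir_fst h]
    field_simp; ring
  by_cases hvb : v = b
  · subst hvb
    rw [edgePoint_snd (T.ne h), edgePoint_of_ne hva (tri_ne_snd h), dir_snd h]
    field_simp; ring
  by_cases hve : v = e
  · subst hve
    rw [edgePoint_of_ne hva hvb, edgePoint_snd (tri_ne_trd h).symm, dir_trd h]
    field_simp; ring
  · rw [edgePoint_of_ne hva hvb, edgePoint_of_ne hva hve]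
    simp [dir, hva, hvb, hve]

lemma faceAhead_low {a b e : V} (h : T.tri a b e) {s : ℝ} (ha : g a < s) (hb : s ≤ g b)
    (he : s ≤ g e) : T.FaceAhead g {a, b, e} (edgePoint g a b s) (edgePoint g a e s) :=
  ⟨a, b, e, _, h, rfl, div_pos (sub_pos.2 ha) (mul_pos (by linarith) (by linarith)),
    edgePoint_sub h (by linarith : g a < g b).ne (by linarith : g a < g e).ne s⟩

lemma FaceAhead.neg {f : Finset V} {n n' : V → ℝ} (h : T.FaceAhead g f n n') :
    T.FaceAhead (-g) f n' n := by
  obtain ⟨a, b, e, m, h, hf, hm, rfl⟩ := h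
  exact ⟨a, b, e, m, h, hf, hm, by rw [dir_neg]; simp⟩

lemma FaceAhead.of_neg {f : Finset V} {n n' : V → ℝ} (h : T.FaceAhead (-g) f n n') :
    T.FaceAhead g f n' n := by simpa using h.neg

lemma faceAhead_high {a b e : V} (h : T.tri a b e) {s : ℝ} (ha : s < g a) (hb : g b ≤ s)
    (he : g e ≤ s) : T.FaceAhead g {a, b, e} (edgePoint g a e s) (edgePoint g a b s) := by
  have := faceAhead_low (g := -g) h (s := -s) (by simpa using ha) (by simpa using hb)
    (by simpa using he)
  rw [edgePoint_neg, edgePoint_neg] at this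
  exact this.of_neg

lemma nodes_neg (g : V → ℝ) (s : ℝ) : T.nodes (-g) (-s) = T.nodes g s := by
  have key : ∀ (g : V → ℝ) (s : ℝ), T.nodes g s ⊆ T.nodes (-g) (-s) := by
    rintro g s n ⟨w, u, h, hwu, hw, hu, rfl⟩
    refine ⟨u, w, h.symm, by simpa using hwu, by simpa using hu, by simpa using hw, ?_⟩
    rw [edgePoint_neg, edgePoint_comm hwu.ne]
  refine Set.Subset.antisymm ?_ (key g s)
  simpa using key (-g) (-s)

lemma edgePoint_mem_nodes {a b : V} {s : ℝ} (hadj : T.graph.Adj a b) (h : g a ≠ g b)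
    (hs : (g a ≤ s ∧ s ≤ g b) ∨ (g b ≤ s ∧ s ≤ g a)) : edgePoint g a b s ∈ T.nodes g s := by
  rcases hs with hs | hs
  · exact ⟨a, b, hadj, lt_of_le_of_ne (hs.1.trans hs.2) h, hs.1, hs.2, rfl⟩
  · exact ⟨b, a, hadj.symm, lt_of_le_of_ne (hs.1.trans hs.2) h.symm, hs.1, hs.2,
      edgePoint_comm h s⟩

lemma mem_nodes_of_support {n : V → ℝ} (hn : n ∈ stdSimplex ℝ V) {a b : V}
    (hadj : T.graph.Adj a b) (hab : g a ≠ g b) (h : ∀ v, v ≠ a → v ≠ b → n v = 0) :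
    n ∈ T.nodes g (level g n) := by
  have hsum := sum_of_support hadj.ne h (fun _ => 1)
  simp only [mul_one, hn.2] at hsum
  have hlev : level g n = n a * g a + n b * g b := sum_of_support hadj.ne h g
  have h1 : level g n - g a = n b * (g b - g a) := by
    rw [hlev]; linear_combination -g a * hsum
  have h2 : g b - level g n = n a * (g b - g a) := by
    rw [hlev]; linear_combination g b * hsum
  rw [eq_edgePoint hn hab h, level_edgePoint hab]
  refine edgePoint_mem_nodes hadj hab ?_
  rcases le_total (g a) (g b) with h3 | h3
  · have := mul_nonneg (hn.1 b) (sub_nonneg.2 h3)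
    have := mul_nonneg (hn.1 a) (sub_nonneg.2 h3)
    exact Or.inl ⟨by linarith, by linarith⟩
  · have := mul_nonpos_of_nonneg_of_nonpos (hn.1 b) (sub_nonpos.2 h3)
    have := mul_nonpos_of_nonneg_of_nonpos (hn.1 a) (sub_nonpos.2 h3)
    exact Or.inr ⟨by linarith, by linarith⟩

lemma mem_stdSimplex_of_mem_nodes {n : V → ℝ} {s : ℝ} (h : n ∈ T.nodes g s) :
    n ∈ stdSimplex ℝ V := by
  obtain ⟨w, u, -, hwu, hw, hu, rfl⟩ := h
  exact edgePoint_mem_stdSimplex hwu.ne (Or.inl ⟨hw, hu⟩)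

lemma level_of_mem_nodes {n : V → ℝ} {s : ℝ} (h : n ∈ T.nodes g s) : level g n = s := by
  obtain ⟨w, u, -, hwu, hw, hu, rfl⟩ := h
  exact level_edgePoint hwu.ne s

lemma finite_nodes (s : ℝ) : (T.nodes g s).Finite :=
  (Set.finite_range fun q : V × V => edgePoint g q.1 q.2 s).subset
    fun _ ⟨w, u, _, _, _, _, h⟩ => ⟨(w, u), h.symm⟩

lemma nodes_cases {n : V → ℝ} {s : ℝ} (h : n ∈ T.nodes g s) :
    (∃ v, g v = s ∧ n = Pi.single v 1) ∨
      ∃ w u, T.graph.Adj w u ∧ g w < s ∧ s < g u ∧ n = edgePoint g w u s := by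
  obtain ⟨w, u, hadj, hwu, hw, hu, rfl⟩ := h
  rcases hw.eq_or_lt with rfl | hw
  · exact Or.inl ⟨w, rfl, edgePoint_self_left g w u⟩
  rcases hu.eq_or_lt with rfl | hu
  · exact Or.inl ⟨u, rfl, edgePoint_self_right hwu.ne⟩
  exact Or.inr ⟨w, u, hadj, hw, hu, rfl⟩

lemma FaceAhead.exists_eq {a b e : V} (h : T.tri a b e) {n n' : V → ℝ}
    (hn : T.FaceAhead g {a, b, e} n n') : ∃ m : ℝ, 0 < m ∧ n' = n + m • dir g a b e := by
  obtain ⟨a', b', e', m, h', hf, hm, rfl⟩ := hn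
  refine ⟨m, hm, ?_⟩
  rcases tri_rotation_of_face_eq h h' hf.symm with ⟨rfl, rfl, rfl⟩ | ⟨rfl, rfl, rfl⟩ |
    ⟨rfl, rfl, rfl⟩
  · rfl
  · rw [dir_rotate]
  · rw [dir_rotate, dir_rotate]

lemma FaceAhead.ne (hT : ∀ {a b e : V}, T.tri a b e → ¬ (g a = g b ∧ g b = g e))
    {f : Finset V} {n n' : V → ℝ} (h : T.FaceAhead g f n n') : n ≠ n' := by
  obtain ⟨a, b, e, m, h, -, hm, rfl⟩ := h
  intro heq
  have hz : m • dir g a b e = 0 := by simpa using heq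
  have hz : dir g a b e = 0 := (smul_eq_zero.1 hz).resolve_left hm.ne'
  have h1 := congrFun hz e
  have h2 := congrFun hz a
  rw [dir_trd h] at h1
  rw [dir_fst h] at h2
  simp only [Pi.zero_apply] at h1 h2
  exact hT h ⟨by linarith, by linarith⟩

lemma FaceAhead.trans {f : Finset V} {n n' n'' : V → ℝ} (h : T.FaceAhead g f n n')
    (h' : T.FaceAhead g f n' n'') : T.FaceAhead g f n n'' := by
  obtain ⟨a, b, e, m, ht, rfl, hm, rfl⟩ := h
  obtain ⟨m', hm', rfl⟩ := h'.exists_eq ht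
  exact ⟨a, b, e, m + m', ht, rfl, add_pos hm hm', by rw [add_smul, add_assoc]⟩

lemma FaceAhead.level_eq {f : Finset V} {n n' : V → ℝ} (h : T.FaceAhead g f n n') :
    level g n' = level g n := by
  obtain ⟨a, b, e, m, h, -, hm, rfl⟩ := h
  have h0 : ∑ v, dir g a b e v * g v = 0 := by
    rw [sum_face h]
    · rw [dir_fst h, dir_snd h, dir_trd h]; ring
    · intro v hv
      simp only [Finset.mem_insert, Finset.mem_singleton, not_or] at hv
      simp [dir, hv]
  simp only [level, Pi.add_apply, Pi.smul_apply, smul_eq_mul, add_mul, Finset.sum_add_distrib,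
    mul_assoc, ← Finset.mul_sum, h0, mul_zero, add_zero]

end Points

end OrientedTriangulation

namespace OrientedTriangulation

/-! ### Cells of the refined decomposition -/

section Cells

variable {V : Type*} [Fintype V] [DecidableEq V] {T : OrientedTriangulation V} {g : V → ℝ}

/-- `t₀ < t₁` are consecutive values of `g`. -/
structure Consecutive (g : V → ℝ) (t₀ t₁ : ℝ) : Prop where
  lt : t₀ < t₁
  gap : ∀ v, ¬ (t₀ < g v ∧ g v < t₁)
  mem₀ : t₀ ∈ Set.range g
  mem₁ : t₁ ∈ Set.range g

variable (T) in
/-- The levels between the consecutive values `t₀ < t₁` cut a cell out of the triangle `a, b, e`,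
and `a` is the vertex that lies alone on its side of this cell: the cell is bounded by the sides
`a b` and `a e`. -/
structure Cell (g : V → ℝ) (a b e : V) (t₀ t₁ : ℝ) : Prop extends Consecutive g t₀ t₁ where
  tri : T.tri a b e
  sep : (g a ≤ t₀ ∧ t₁ ≤ g b ∧ t₁ ≤ g e) ∨ (t₁ ≤ g a ∧ g b ≤ t₀ ∧ g e ≤ t₀)

lemma Consecutive.le_or_ge {t₀ t₁ : ℝ} (h : Consecutive g t₀ t₁) (v : V) :
    g v ≤ t₀ ∨ t₁ ≤ g v := by
  by_contra! hcon
  exact h.gap v hcon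

lemma Consecutive.eq {t₀ t₁ t₀' : ℝ} (h : Consecutive g t₀ t₁) (h' : Consecutive g t₀' t₁) :
    t₀ = t₀' := by
  obtain ⟨v, rfl⟩ := h.mem₀
  obtain ⟨w, rfl⟩ := h'.mem₀
  exact le_antisymm ((h'.le_or_ge v).resolve_right h.lt.not_ge)
    ((h.le_or_ge w).resolve_right h'.lt.not_ge)

lemma exists_next_value {s : ℝ} {v : V} (hs : s < g v) :
    ∃ t, t ∈ Set.range g ∧ s < t ∧ t ≤ g v ∧ ∀ w, ¬ (s < g w ∧ g w < t) := by
  obtain ⟨m, hm, hmin⟩ := Finset.exists_min_image (Finset.univ.filter fun w => s < g w) g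
    ⟨v, by simpa using hs⟩
  simp only [Finset.mem_filter, Finset.mem_univ, true_and] at hm hmin
  exact ⟨g m, ⟨m, rfl⟩, hm, hmin v hs, fun w hw => (hmin w hw.1).not_gt hw.2⟩

lemma exists_prev_value {s : ℝ} {v : V} (hs : g v < s) :
    ∃ t, t ∈ Set.range g ∧ t < s ∧ g v ≤ t ∧ ∀ w, ¬ (t < g w ∧ g w < s) := by
  obtain ⟨t, ⟨m, hm⟩, h1, h2, h3⟩ := exists_next_value (g := -g) (s := -s) (v := v)
    (by simpa using hs)
  refine ⟨-t, ⟨m, by rw [← hm]; simp⟩, by linarith, by simp at h2; linarith, fun w hw => h3 w ?_⟩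
  simp only [Pi.neg_apply]
  exact ⟨by linarith, by linarith⟩

lemma exists_consecutive {s : ℝ} {u v : V} (hu : g u ≤ s) (hv : s ≤ g v) (huv : g u < g v) :
    ∃ t₀ t₁, Consecutive g t₀ t₁ ∧ t₀ ≤ s ∧ s ≤ t₁ ∧ g u ≤ t₀ ∧ t₁ ≤ g v := by
  rcases hv.eq_or_lt with rfl | hv
  · obtain ⟨t, ht, h1, h2, h3⟩ := exists_prev_value huv
    exact ⟨t, g v, ⟨h1, h3, ht, ⟨v, rfl⟩⟩, h1.le, le_rfl, h2, le_rfl⟩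
  · obtain ⟨t₁, ht₁, h1, h2, h3⟩ := exists_next_value hv
    obtain ⟨t₀, ht₀, h1', h2', h3'⟩ := exists_prev_value (hu.trans_lt h1)
    obtain ⟨w, rfl⟩ := ht₀
    have hw : g w ≤ s := not_lt.1 fun h => h3 w ⟨h, h1'⟩
    exact ⟨g w, t₁, ⟨h1', h3', ⟨w, rfl⟩, ht₁⟩, hw, h1.le, h2', h2⟩

namespace Cell

variable {a b e : V} {t₀ t₁ : ℝ}

lemma ne_left (C : T.Cell g a b e t₀ t₁) : g a ≠ g b := by
  intro h
  have := C.lt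
  rcases C.sep with ⟨h1, h2, h3⟩ | ⟨h1, h2, h3⟩ <;> linarith

lemma ne_right (C : T.Cell g a b e t₀ t₁) : g a ≠ g e := by
  intro h
  have := C.lt
  rcases C.sep with ⟨h1, h2, h3⟩ | ⟨h1, h2, h3⟩ <;> linarith

lemma between_left (C : T.Cell g a b e t₀ t₁) {s : ℝ} (h0 : t₀ ≤ s) (h1 : s ≤ t₁) :
    (g a ≤ s ∧ s ≤ g b) ∨ (g b ≤ s ∧ s ≤ g a) :=
  C.sep.imp (fun h => ⟨h.1.trans h0, h1.trans h.2.1⟩) fun h => ⟨h.2.1.trans h0, h1.trans h.1⟩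

lemma between_right (C : T.Cell g a b e t₀ t₁) {s : ℝ} (h0 : t₀ ≤ s) (h1 : s ≤ t₁) :
    (g a ≤ s ∧ s ≤ g e) ∨ (g e ≤ s ∧ s ≤ g a) :=
  C.sep.imp (fun h => ⟨h.1.trans h0, h1.trans h.2.2⟩) fun h => ⟨h.2.2.trans h0, h1.trans h.1⟩

lemma left_mem (C : T.Cell g a b e t₀ t₁) {s : ℝ} (h0 : t₀ ≤ s) (h1 : s ≤ t₁) :
    T.Mem {a, b, e} (edgePoint g a b s) :=
  mem_edgePoint (face_mem C.tri) (by simp) (by simp) C.ne_left (C.between_left h0 h1)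

lemma right_mem (C : T.Cell g a b e t₀ t₁) {s : ℝ} (h0 : t₀ ≤ s) (h1 : s ≤ t₁) :
    T.Mem {a, b, e} (edgePoint g a e s) :=
  mem_edgePoint (face_mem C.tri) (by simp) (by simp) C.ne_right (C.between_right h0 h1)

lemma left_mem_nodes (C : T.Cell g a b e t₀ t₁) {s : ℝ} (h0 : t₀ ≤ s) (h1 : s ≤ t₁) :
    edgePoint g a b s ∈ T.nodes g s :=
  edgePoint_mem_nodes (adj_of_tri C.tri) C.ne_left (C.between_left h0 h1)

lemma right_mem_nodes (C : T.Cell g a b e t₀ t₁) {s : ℝ} (h0 : t₀ ≤ s) (h1 : s ≤ t₁) :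
    edgePoint g a e s ∈ T.nodes g s :=
  edgePoint_mem_nodes (adj_of_tri' C.tri) C.ne_right (C.between_right h0 h1)

/-- If the isolated vertex of a cell is its lowest vertex, then the counter-clockwise level
segments run from the first to the second side. -/
lemma ahead_low (C : T.Cell g a b e t₀ t₁) (hlow : g a ≤ t₀) {s : ℝ} (ha : g a ≠ s)
    (h0 : t₀ ≤ s) (h1 : s ≤ t₁) :
    T.FaceAhead g {a, b, e} (edgePoint g a b s) (edgePoint g a e s) := by
  rcases C.sep with h | h
  · exact faceAhead_low C.tri (lt_of_le_of_ne (h.1.trans h0) ha) (h1.trans h.2.1) (h1.trans h.2.2)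
  · exact absurd (h.1.trans hlow) C.lt.not_ge

lemma ahead_high (C : T.Cell g a b e t₀ t₁) (hhigh : t₁ ≤ g a) {s : ℝ} (ha : g a ≠ s)
    (h0 : t₀ ≤ s) (h1 : s ≤ t₁) :
    T.FaceAhead g {a, b, e} (edgePoint g a e s) (edgePoint g a b s) := by
  rcases C.sep with h | h
  · exact absurd (hhigh.trans h.1) C.lt.not_ge
  · exact faceAhead_high C.tri (lt_of_le_of_ne (h1.trans h.1) ha.symm) (h.2.1.trans h0)
      (h.2.2.trans h0)

lemma eq_of_level_apex (_ : T.Cell g a b e t₀ t₁) {s : ℝ} (ha : g a = s) :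
    edgePoint g a b s = edgePoint g a e s := by
  subst ha; rw [edgePoint_self_left, edgePoint_self_left]

/-- The sides of a cell contain all nodes of the triangle at the levels of the cell. -/
lemma eq_of_mem_nodes (C : T.Cell g a b e t₀ t₁) {s : ℝ} (h0 : t₀ ≤ s) (h1 : s ≤ t₁)
    {n : V → ℝ} (hn : n ∈ T.nodes g s) (hm : T.Mem {a, b, e} n) :
    n = edgePoint g a b s ∨ n = edgePoint g a e s := by
  have hlev := level_of_mem_nodes hn
  have hsupp : ∀ v, v ≠ a → v ≠ b → v ≠ e → n v = 0 := fun v ha hb he =>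
    hm.2.2 v (by simp [ha, hb, he])
  by_cases hb : n b = 0
  · right
    rw [← hlev]
    refine eq_edgePoint hm.2.1 C.ne_right fun v ha he => ?_
    by_cases hvb : v = b
    · rwa [hvb]
    · exact hsupp v ha hvb he
  by_cases he : n e = 0
  · left
    rw [← hlev]
    refine eq_edgePoint hm.2.1 C.ne_left fun v ha hb => ?_
    by_cases hve : v = e
    · rwa [hve]
    · exact hsupp v ha hb hve
  exfalso
  have hsum := hm.sum_eq C.tri
  have hl := hm.level_eq (g := g) C.tri
  rw [hlev] at hl
  have hb' := lt_of_le_of_ne (hm.nonneg b) (Ne.symm hb)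
  have he' := lt_of_le_of_ne (hm.nonneg e) (Ne.symm he)
  obtain ⟨w, u, -, hwu, -, -, rfl⟩ := hn
  have hin : ∀ v, edgePoint g w u s v ≠ 0 → v = w ∨ v = u := fun v hv => by
    by_contra! hcon
    exact hv (edgePoint_of_ne hcon.1 hcon.2 s)
  have hbe := tri_ne_snd C.tri
  have hbe' : g b ≠ g e := by
    rcases hin b hb with h | h <;> rcases hin e he with h' | h'
    · exact absurd (h.trans h'.symm) hbe
    · rw [h, h']; exact hwu.ne
    · rw [h, h']; exact hwu.ne'
    · exact absurd (h.trans h'.symm) hbe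
  have ha : edgePoint g w u s a = 0 := by
    by_contra hcon
    have h1 := T.ne C.tri
    have h2 := tri_ne_trd C.tri
    rcases hin b hb with h | h <;> rcases hin e he with h' | h' <;>
      rcases hin a hcon with h'' | h'' <;>
      first
        | exact hbe (h.trans h'.symm)
        | exact h1 (h''.trans h.symm)
        | exact h2 (h'.trans h''.symm)
  rw [ha] at hsum hl
  have key : edgePoint g w u s b * (g b - s) + edgePoint g w u s e * (g e - s) = 0 := by
    linear_combination -hl - s * hsum
  rcases C.sep with h | h
  · have p1 : 0 ≤ g b - s := by linarith [h.2.1]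
    have p2 : 0 ≤ g e - s := by linarith [h.2.2]
    have q1 := mul_nonneg hb'.le p1
    have q2 := mul_nonneg he'.le p2
    have z1 := (mul_eq_zero.1 (le_antisymm (by linarith) q1)).resolve_left hb'.ne'
    have z2 := (mul_eq_zero.1 (le_antisymm (by linarith) q2)).resolve_left he'.ne'
    exact hbe' (by linarith)
  · have p1 : 0 ≤ s - g b := by linarith [h.2.1]
    have p2 : 0 ≤ s - g e := by linarith [h.2.2]
    have q1 := mul_nonneg hb'.le p1
    have q2 := mul_nonneg he'.le p2
    have z1 := (mul_eq_zero.1 (le_antisymm (by linarith) q1)).resolve_left hb'.ne'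
    have z2 := (mul_eq_zero.1 (le_antisymm (by linarith) q2)).resolve_left he'.ne'
    exact hbe' (by linarith)

end Cell

lemma level_neg (g n : V → ℝ) : level (-g) n = - level g n := by
  simp [level]

lemma exists_combo_low {a b e : V} (h : T.tri a b e) (hb : g a < g b) (he : g a < g e)
    {n : V → ℝ} (hn : T.Mem {a, b, e} n) :
    ∃ r : ℝ, 0 ≤ r ∧ r ≤ 1 ∧
      n = (1 - r) • edgePoint g a b (level g n) + r • edgePoint g a e (level g n) := by
  have hsum := hn.sum_eq h
  have hl := hn.level_eq (g := g) h
  have hb0 := hn.nonneg b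
  have he0 := hn.nonneg e
  have hb1 : 0 < g b - g a := sub_pos.2 hb
  have he1 : 0 < g e - g a := sub_pos.2 he
  set s := level g n with hs
  have hkey : s - g a = n b * (g b - g a) + n e * (g e - g a) := by
    rw [hl]; linear_combination g a * hsum
  have p1 := mul_nonneg hb0 hb1.le
  have p2 := mul_nonneg he0 he1.le
  rcases (add_nonneg p1 p2).eq_or_lt with h0 | h0
  · have hb2 : n b = 0 := by
      rcases mul_eq_zero.1 (le_antisymm (by linarith) p1) with h | h
      · exact h
      · exact absurd h hb1.ne'
    have he2 : n e = 0 := by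
      rcases mul_eq_zero.1 (le_antisymm (by linarith) p2) with h | h
      · exact h
      · exact absurd h he1.ne'
    refine ⟨0, le_rfl, zero_le_one, ?_⟩
    have hsa : s = g a := by linarith
    rw [hsa, edgePoint_self_left, eq_single hn.2.1 (v := a) (by linarith)]
    simp
  · rw [← hkey] at h0
    refine ⟨n e * (g e - g a) / (s - g a), div_nonneg p2 h0.le,
      (div_le_one h0).2 (by linarith), ?_⟩
    have hr : 1 - n e * (g e - g a) / (s - g a) = n b * (g b - g a) / (s - g a) := by
      rw [eq_div_iff h0.ne', sub_mul, div_mul_cancel₀ _ h0.ne']; linarith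
    rw [hr]
    ext v
    simp only [Pi.add_apply, Pi.smul_apply, smul_eq_mul]
    by_cases hva : v = a
    · subst hva
      rw [edgePoint_fst (T.ne h), edgePoint_fst (tri_ne_trd h).symm]
      have : n v = 1 - n b - n e := by linarith
      rw [this]
      field_simp
      linear_combination hkey
    by_cases hvb : v = b
    · subst hvb
      rw [edgePoint_snd (T.ne h), edgePoint_of_ne hva (tri_ne_snd h)]
      field_simp; ring
    by_cases hve : v = e
    · subst hve
      rw [edgePoint_of_ne hva hvb, edgePoint_snd (tri_ne_trd h).symm]
      field_simp; ring
    · rw [edgePoint_of_ne hva hvb, edgePoint_of_ne hva hve, hn.2.2 v (by simp [hva, hvb, hve])]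
      simp

lemma Cell.exists_combo {a b e : V} {t₀ t₁ : ℝ} (C : T.Cell g a b e t₀ t₁) {n : V → ℝ}
    (hn : T.Mem {a, b, e} n) : ∃ r : ℝ, 0 ≤ r ∧ r ≤ 1 ∧
      n = (1 - r) • edgePoint g a b (level g n) + r • edgePoint g a e (level g n) := by
  have hlt := C.lt
  rcases C.sep with h | h
  · exact exists_combo_low C.tri (by linarith) (by linarith) hn
  · obtain ⟨r, hr0, hr1, hr⟩ := exists_combo_low (g := -g) C.tri (by simp only [Pi.neg_apply]; linarith)
      (by simp only [Pi.neg_apply]; linarith) hn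
    rw [level_neg, edgePoint_neg, edgePoint_neg] at hr
    exact ⟨r, hr0, hr1, hr⟩

lemma exists_cell_of_span {f : Finset V} (hf : f ∈ T.faces) {t₀ t₁ : ℝ}
    (ht : Consecutive g t₀ t₁) {u v : V} (hu : u ∈ f) (hv : v ∈ f) (hu' : g u ≤ t₀)
    (hv' : t₁ ≤ g v) : ∃ a b e, f = {a, b, e} ∧ T.Cell g a b e t₀ t₁ := by
  obtain ⟨a, b, e, h, rfl⟩ := hf
  have hlt := ht.lt
  have r1 : ({a, b, e} : Finset V) = {b, e, a} := by ext; simp; tauto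
  have r2 : ({a, b, e} : Finset V) = {e, a, b} := by ext; simp; tauto
  simp only [Finset.mem_insert, Finset.mem_singleton] at hu hv
  rcases ht.le_or_ge a with ha | ha <;> rcases ht.le_or_ge b with hb | hb <;>
    rcases ht.le_or_ge e with he | he
  · rcases hv with rfl | rfl | rfl <;> linarith
  · exact ⟨e, a, b, r2, ht, T.rotate (T.rotate h), Or.inr ⟨he, ha, hb⟩⟩
  · exact ⟨b, e, a, r1, ht, T.rotate h, Or.inr ⟨hb, he, ha⟩⟩
  · exact ⟨a, b, e, rfl, ht, h, Or.inl ⟨ha, hb, he⟩⟩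
  · exact ⟨a, b, e, rfl, ht, h, Or.inr ⟨ha, hb, he⟩⟩
  · exact ⟨b, e, a, r1, ht, T.rotate h, Or.inl ⟨hb, he, ha⟩⟩
  · exact ⟨e, a, b, r2, ht, T.rotate (T.rotate h), Or.inl ⟨he, ha, hb⟩⟩
  · rcases hu with rfl | rfl | rfl <;> linarith

lemma exists_cell (hT : ∀ {a b e : V}, T.tri a b e → ¬ (g a = g b ∧ g b = g e))
    {f : Finset V} {n : V → ℝ} (hn : T.Mem f n) : ∃ a b e t₀ t₁, f = {a, b, e} ∧
      T.Cell g a b e t₀ t₁ ∧ t₀ ≤ level g n ∧ level g n ≤ t₁ := by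
  obtain ⟨a, b, e, h, rfl⟩ := hn.1
  obtain ⟨u, hu, humin⟩ := Finset.exists_min_image ({a, b, e} : Finset V) g ⟨a, by simp⟩
  obtain ⟨v, hv, hvmax⟩ := Finset.exists_max_image ({a, b, e} : Finset V) g ⟨a, by simp⟩
  have ma := humin a (by simp)
  have mb := humin b (by simp)
  have me := humin e (by simp)
  have Ma := hvmax a (by simp)
  have Mb := hvmax b (by simp)
  have Me := hvmax e (by simp)
  have hsum := hn.sum_eq h
  have hl := hn.level_eq (g := g) h
  have hna := hn.nonneg a
  have hnb := hn.nonneg b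
  have hne := hn.nonneg e
  have huv : g u < g v := by
    by_contra hcon
    exact hT h ⟨by linarith, by linarith⟩
  obtain ⟨t₀, t₁, ht, h0, h1, hu0, hv1⟩ := exists_consecutive (s := level g n) (u := u) (v := v)
    (by
      have hu1 : n a * g u + n b * g u + n e * g u = g u := by
        linear_combination g u * hsum
      rw [hl]
      nlinarith [mul_nonneg hna (sub_nonneg.2 ma), mul_nonneg hnb (sub_nonneg.2 mb),
          mul_nonneg hne (sub_nonneg.2 me)])
    (by
      have hv1 : n a * g v + n b * g v + n e * g v = g v := by
        linear_combination g v * hsum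
      rw [hl]
      nlinarith [mul_nonneg hna (sub_nonneg.2 Ma), mul_nonneg hnb (sub_nonneg.2 Mb),
          mul_nonneg hne (sub_nonneg.2 Me)]) huv
  obtain ⟨a', b', e', hf, C⟩ := exists_cell_of_span hn.1 ht hu hv hu0 hv1
  exact ⟨a', b', e', t₀, t₁, hf, C, h0, h1⟩

end Cells

end OrientedTriangulation

namespace OrientedTriangulation

/-! ### The successor of a node on its level curve -/

section Succ

variable {V : Type*} [Fintype V] [DecidableEq V] {T : OrientedTriangulation V} {g : V → ℝ}

variable (T) in
/-- The node `n'` follows the node `n`, inside a common triangle, on the level curve of `g`. -/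
def Next (g : V → ℝ) (s : ℝ) (n n' : V → ℝ) : Prop :=
  n ∈ T.nodes g s ∧ n' ∈ T.nodes g s ∧ ∃ f, T.Mem f n ∧ T.Mem f n' ∧ T.FaceAhead g f n n'

lemma Next.neg {s : ℝ} {n n' : V → ℝ} (h : T.Next g s n n') : T.Next (-g) (-s) n' n := by
  obtain ⟨h1, h2, f, h3, h4, h5⟩ := h
  exact ⟨by rwa [nodes_neg], by rwa [nodes_neg], f, h4, h3, h5.neg⟩

lemma Mem.exists_corner {f : Finset V} {v : V} (h : T.Mem f (Pi.single v 1)) :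
    ∃ a b, T.tri v a b ∧ f = {v, a, b} := by
  have hvf : v ∈ f := by
    by_contra hcon
    simpa using h.2.2 v hcon
  obtain ⟨p, q, r, hpqr, rfl⟩ := h.1
  obtain ⟨a, b, hab, hfe⟩ := exists_tri_of_mem hpqr hvf
  exact ⟨a, b, hab, hfe.symm⟩

lemma Mem.exists_side {f : Finset V} {w u : V} {s : ℝ} (hw : g w < s) (hu : s < g u)
    (h : T.Mem f (edgePoint g w u s)) :
    (∃ e, T.tri w u e ∧ f = {w, u, e}) ∨ ∃ e, T.tri u w e ∧ f = {u, w, e} := by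
  have hwu := hw.trans hu
  have hne : w ≠ u := fun h => hwu.ne (h ▸ rfl)
  have hwf : w ∈ f := by
    by_contra hcon
    have := h.2.2 w hcon
    rw [edgePoint_fst hne, sub_eq_zero, eq_div_iff (sub_pos.2 hwu).ne'] at this
    linarith
  have huf : u ∈ f := by
    by_contra hcon
    have := h.2.2 u hcon
    rw [edgePoint_snd hne, div_eq_zero_iff] at this
    rcases this with h | h <;> linarith
  obtain ⟨p, q, r, hpqr, rfl⟩ := h.1
  obtain ⟨a, b, hab, hfe⟩ := exists_tri_of_mem hpqr hwf
  rw [← hfe] at huf ⊢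
  simp only [Finset.mem_insert, Finset.mem_singleton] at huf
  rcases huf with rfl | rfl | rfl
  · exact absurd rfl hne
  · exact Or.inl ⟨b, hab, rfl⟩
  · exact Or.inr ⟨a, T.rotate (T.rotate hab), by ext; simp; tauto⟩

/-- A level curve leaves a vertex through its out-going corner. -/
lemma FaceAhead.corner {v : V} {f : Finset V} {n' : V → ℝ}
    (h : T.FaceAhead g f (Pi.single v 1) n') (h0 : T.Mem f (Pi.single v 1)) (h1 : T.Mem f n') :
    ∃ a b, T.tri v a b ∧ f = {v, a, b} ∧ g b ≤ g v ∧ g v ≤ g a := by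
  obtain ⟨a, b, hab, rfl⟩ := h0.exists_corner
  obtain ⟨m, hm, rfl⟩ := h.exists_eq hab
  have ha := h1.nonneg a
  have hb := h1.nonneg b
  simp only [Pi.add_apply, Pi.smul_apply, smul_eq_mul, dir_snd hab, dir_trd hab,
    Pi.single_eq_of_ne (T.ne hab).symm, Pi.single_eq_of_ne (tri_ne_trd hab), zero_add] at ha hb
  exact ⟨a, b, hab, rfl, by nlinarith, by nlinarith⟩

lemma FaceAhead.corner_in {v : V} {f : Finset V} {n' : V → ℝ}
    (h : T.FaceAhead g f n' (Pi.single v 1)) (h0 : T.Mem f (Pi.single v 1)) (h1 : T.Mem f n') :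
    ∃ a b, T.tri v a b ∧ f = {v, a, b} ∧ g a ≤ g v ∧ g v ≤ g b := by
  obtain ⟨a, b, h1, h2, h3, h4⟩ := h.neg.corner h0 h1
  exact ⟨a, b, h1, h2, neg_le_neg_iff.1 h4, neg_le_neg_iff.1 h3⟩

/-- A level curve leaves an edge into the triangle on its left, if the edge is directed upwards. -/
lemma FaceAhead.tri_of_edge {w u : V} {s : ℝ} {f : Finset V} {n' : V → ℝ}
    (h : T.FaceAhead g f (edgePoint g w u s) n') (hw : g w < s) (hu : s < g u)
    (h0 : T.Mem f (edgePoint g w u s)) (h1 : T.Mem f n') : ∃ e, T.tri w u e ∧ f = {w, u, e} := by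
  refine (h0.exists_side hw hu).resolve_right ?_
  rintro ⟨e, he, rfl⟩
  obtain ⟨m, hm, rfl⟩ := h.exists_eq he
  have ha := h1.nonneg e
  simp only [Pi.add_apply, Pi.smul_apply, smul_eq_mul, dir_trd he,
    edgePoint_of_ne (tri_ne_snd he).symm (tri_ne_trd he), zero_add] at ha
  nlinarith

lemma FaceAhead.tri_of_edge_in {w u : V} {s : ℝ} {f : Finset V} {n' : V → ℝ}
    (h : T.FaceAhead g f n' (edgePoint g w u s)) (hw : g w < s) (hu : s < g u)
    (h0 : T.Mem f (edgePoint g w u s)) (h1 : T.Mem f n') : ∃ e, T.tri u w e ∧ f = {u, w, e} := by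
  have he : edgePoint g w u s = edgePoint (-g) u w (-s) := by
    rw [edgePoint_neg, edgePoint_comm (hw.trans hu).ne]
  rw [he] at h h0
  exact h.neg.tri_of_edge (neg_lt_neg hu) (neg_lt_neg hw) h0 h1

namespace Regular

lemma exists_tri (R : T.Regular g) {a b : V} (h : T.graph.Adj a b) (hab : g a ≠ g b) :
    ∃ e, T.tri a b e := by
  rcases h with h | ⟨e, h⟩
  · exact h
  · exact R.opp h hab.symm

lemma exists_next (R : T.Regular g) {s : ℝ} {n : V → ℝ} (hn : n ∈ T.nodes g s) :
    ∃ n', T.Next g s n n' := by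
  rcases nodes_cases hn with ⟨v, rfl, rfl⟩ | ⟨w, u, hadj, hw, hu, rfl⟩
  · obtain ⟨a, b, h, hb, ha⟩ := R.exists_out v
    rcases hb.eq_or_lt with hb | hb
    · have ha : g v < g a := lt_of_le_of_ne ha fun h' => R.not_const h ⟨h', by linarith⟩
      have h1 := faceAhead_high (T.rotate h) ha hb.le le_rfl
      have e1 : edgePoint g a v (g v) = Pi.single v 1 := edgePoint_self_right ha.ne'
      rw [e1] at h1
      have hab : g a ≠ g b := by rw [hb]; exact ha.ne'
      exact ⟨_, hn, edgePoint_mem_nodes (adj_of_tri (T.rotate h)) hab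
        (Or.inr ⟨hb.le, ha.le⟩), _, mem_single (face_mem (T.rotate h)) (by simp),
        mem_edgePoint (face_mem (T.rotate h)) (by simp) (by simp) hab
          (Or.inr ⟨hb.le, ha.le⟩), h1⟩
    · have h1 := faceAhead_low (T.rotate (T.rotate h)) hb le_rfl ha
      have e1 : edgePoint g b v (g v) = Pi.single v 1 := edgePoint_self_right hb.ne
      rw [e1] at h1
      have hba : g b ≠ g a := (hb.trans_le ha).ne
      have ht := T.rotate (T.rotate h)
      exact ⟨_, hn, edgePoint_mem_nodes (adj_of_tri' ht) hba
        (Or.inl ⟨hb.le, ha⟩), _, mem_single (face_mem ht) (by simp),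
        mem_edgePoint (face_mem ht) (by simp) (by simp) hba (Or.inl ⟨hb.le, ha⟩), h1⟩
  · have hwu := hw.trans hu
    obtain ⟨e, h⟩ := R.exists_tri hadj hwu.ne
    rcases le_or_gt s (g e) with he | he
    · have hwe : g w ≠ g e := (hw.trans_le he).ne
      exact ⟨_, hn, edgePoint_mem_nodes (adj_of_tri' h) hwe (Or.inl ⟨hw.le, he⟩), _,
        mem_edgePoint (face_mem h) (by simp) (by simp) hwu.ne (Or.inl ⟨hw.le, hu.le⟩),
        mem_edgePoint (face_mem h) (by simp) (by simp) hwe (Or.inl ⟨hw.le, he⟩),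
        faceAhead_low h hw hu.le he⟩
    · have hue : g u ≠ g e := (he.trans hu).ne'
      have h' := T.rotate h
      have h1 := faceAhead_high h' hu he.le hw.le
      rw [edgePoint_comm hwu.ne] at hn ⊢
      exact ⟨_, hn, edgePoint_mem_nodes (adj_of_tri h') hue (Or.inr ⟨he.le, hu.le⟩), _,
        mem_edgePoint (face_mem h') (by simp) (by simp) hwu.ne' (Or.inr ⟨hw.le, hu.le⟩),
        mem_edgePoint (face_mem h') (by simp) (by simp) hue (Or.inr ⟨he.le, hu.le⟩), h1⟩

/-- The triangle into which the level curve leaves a node is unique. -/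
lemma out_face_unique (R : T.Regular g) {s : ℝ} {n n' n'' : V → ℝ} {f f' : Finset V}
    (hn : n ∈ T.nodes g s) (hf : T.Mem f n) (hf1 : T.Mem f n') (h : T.FaceAhead g f n n')
    (hf' : T.Mem f' n) (hf2 : T.Mem f' n'') (h' : T.FaceAhead g f' n n'') : f = f' := by
  rcases nodes_cases hn with ⟨v, rfl, rfl⟩ | ⟨w, u, hadj, hw, hu, rfl⟩
  · obtain ⟨a, b, h1, rfl, h2, h3⟩ := h.corner hf hf1
    obtain ⟨a', b', h1', rfl, h2', h3'⟩ := h'.corner hf' hf2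
    obtain ⟨rfl, rfl⟩ := R.out_unique h1 h2 h3 h1' h2' h3'
    rfl
  · obtain ⟨e, h1, rfl⟩ := h.tri_of_edge hw hu hf hf1
    obtain ⟨e', h1', rfl⟩ := h'.tri_of_edge hw hu hf' hf2
    rw [T.unique h1 h1']

lemma node_unique_of_faceAhead (R : T.Regular g) {s : ℝ} {n n' n'' : V → ℝ} {f : Finset V}
    (hn : n ∈ T.nodes g s) (hn' : n' ∈ T.nodes g s) (hn'' : n'' ∈ T.nodes g s)
    (h0 : T.Mem f n) (h1 : T.Mem f n') (h2 : T.Mem f n'')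
    (h : n ≠ n') (h' : n ≠ n'') : n' = n'' := by
  obtain ⟨a, b, e, t₀, t₁, rfl, C, c0, c1⟩ := exists_cell R.not_const h0
  rw [level_of_mem_nodes hn] at c0 c1
  rcases C.eq_of_mem_nodes c0 c1 hn h0 with e0 | e0 <;>
    rcases C.eq_of_mem_nodes c0 c1 hn' h1 with e1 | e1 <;>
    rcases C.eq_of_mem_nodes c0 c1 hn'' h2 with e2 | e2 <;>
    first
      | exact e1.trans e2.symm
      | exact absurd (e0.trans e1.symm) h
      | exact absurd (e0.trans e2.symm) h'

lemma next_unique (R : T.Regular g) {s : ℝ} {n n' n'' : V → ℝ} (h : T.Next g s n n')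
    (h' : T.Next g s n n'') : n' = n'' := by
  obtain ⟨h1, h2, f, h3, h4, h5⟩ := h
  obtain ⟨-, h2', f', h3', h4', h5'⟩ := h'
  obtain rfl := R.out_face_unique h1 h3 h4 h5 h3' h4' h5'
  exact R.node_unique_of_faceAhead h1 h2 h2' h3 h4 h4' (h5.ne R.not_const) (h5'.ne R.not_const)

lemma prev_unique (R : T.Regular g) {s : ℝ} {n n' n'' : V → ℝ} (h : T.Next g s n' n)
    (h' : T.Next g s n'' n) : n' = n'' :=
  R.neg.next_unique h.neg h'.neg

end Regular

end Succ

/-! ### Level curves are connected -/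

namespace DirichletData

variable {V : Type*} [Fintype V] [DecidableEq V] {T : OrientedTriangulation V}
  {E₁ E₂ : Finset V} {c : V → V → ℝ} {k : ℝ} {g : V → ℝ}

lemma level_of_adj_eq (D : T.DirichletData E₁ E₂ c k g) {a b : V} (h : T.graph.Adj a b)
    (hab : g a = g b) : g a = k ∨ g a = 0 := by
  rcases D.boundary_adj (D.ne_of_adj a b h hab) with h | h
  · exact Or.inl (D.sol.outer a h.1)
  · exact Or.inr (D.sol.inner a h.1)

/-- The lower part of a link is connected, as it can be left only through the in-coming corner. -/
lemma lower_link_connected (D : T.DirichletData E₁ E₂ c k g) {v p q : V}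
    (hp : T.graph.Adj v p) (hq : T.graph.Adj v q) (hgp : g p < g v) (hgq : g q < g v) :
    Relation.EqvGen (fun p q => T.tri v p q ∧ g p < g v ∧ g q < g v) p q := by
  have R := D.regular
  obtain ⟨a, b, hab, ha, hb⟩ := R.exists_in v
  obtain ⟨a', b', hab', hb', ha'⟩ := R.exists_out v
  have key : ∀ p, T.graph.Adj v p → g p < g v →
      Relation.EqvGen (fun p q => T.tri v p q ∧ g p < g v ∧ g q < g v) p a := by
    intro p hp hgp
    obtain ⟨r, t, hrt, hr, ht⟩ := exists_exit (D.annulus.link_connected v)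
      (S := {r | T.graph.Adj v r ∧ g r < g v ∧
        Relation.EqvGen (fun p q => T.tri v p q ∧ g p < g v ∧ g q < g v) p r})
      (a := p) (b := a') (Set.toFinite _) ⟨hp, hgp, Relation.EqvGen.refl p⟩ hp (adj_of_tri hab')
      (fun h => h.2.1.not_ge ha') fun r hr => (D.exists_tri_of_adj hr.1 hr.2.1.ne').1
    have hgt : g v ≤ g t := not_lt.1 fun h => ht ⟨adj_of_tri' hrt, h,
      hr.2.2.trans _ _ _ (Relation.EqvGen.rel _ _ ⟨hrt, hr.2.1, h⟩)⟩
    rw [(R.in_unique hab ha hb hrt hr.2.1.le hgt).1]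
    exact hr.2.2
  exact (key p hp hgp).trans _ _ _ ((key q hq hgq).symm _ _)

lemma eqvGen_map {α β : Type*} {r : α → α → Prop} {r' : β → β → Prop} (φ : α → β)
    (h : ∀ x y, r x y → Relation.EqvGen r' (φ x) (φ y)) {x y : α}
    (hxy : Relation.EqvGen r x y) : Relation.EqvGen r' (φ x) (φ y) := by
  induction hxy with
  | rel _ _ hr => exact h _ _ hr
  | refl _ => exact Relation.EqvGen.refl _
  | symm _ _ _ ih => exact ih.symm _ _
  | trans _ _ _ _ _ ih ih' => exact ih.trans _ _ _ ih'

variable (T) in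
/-- Any two nodes at level `s` are joined by the level curve. -/
def NodesConnected (g : V → ℝ) (s : ℝ) : Prop :=
  ∀ n ∈ T.nodes g s, ∀ n' ∈ T.nodes g s, Relation.EqvGen (T.Next g s) n n'

lemma nodesConnected_outer (D : T.DirichletData E₁ E₂ c k g) : NodesConnected T g k := by
  have hstep : ∀ {v w e : V}, T.tri v w e → g v = k → g w = k →
      T.Next g k (Pi.single v 1) (Pi.single w 1) := by
    intro v w e h hv hw
    have he : g e < k := lt_of_le_of_ne (D.le_outer e) fun he =>
      D.not_const h ⟨hv.trans hw.symm, hw.trans he.symm⟩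
    have h' := T.rotate (T.rotate h)
    have e1 : edgePoint g e v k = Pi.single v 1 := by
      rw [← hv]; exact edgePoint_self_right (hv ▸ he).ne
    have e2 : edgePoint g e w k = Pi.single w 1 := by
      rw [← hw]; exact edgePoint_self_right (hw ▸ he).ne
    have hev : g e ≠ g v := (hv ▸ he).ne
    have hew : g e ≠ g w := (hw ▸ he).ne
    rw [← e1, ← e2]
    exact ⟨edgePoint_mem_nodes (adj_of_tri h') hev (Or.inl ⟨he.le, hv.ge⟩),
      edgePoint_mem_nodes (adj_of_tri' h') hew (Or.inl ⟨he.le, hw.ge⟩), _,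
      mem_edgePoint (face_mem h') (by simp) (by simp) hev (Or.inl ⟨he.le, hv.ge⟩),
      mem_edgePoint (face_mem h') (by simp) (by simp) hew (Or.inl ⟨he.le, hw.ge⟩),
      faceAhead_low h' he hv.ge hw.ge⟩
  have hreach : ∀ v w, T.boundaryGraph.Reachable v w → g v = k →
      Relation.EqvGen (T.Next g k) (Pi.single v 1) (Pi.single w 1) := by
    rintro v w ⟨q⟩
    induction q with
    | nil => exact fun _ => Relation.EqvGen.refl _
    | cons hadj _ ih =>
      intro hv
      have hw := (D.eq_of_boundary_adj hadj).symm.trans hv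
      refine Relation.EqvGen.trans _ _ _ ?_ (ih hw)
      rcases hadj with ⟨⟨e, he⟩, -⟩ | ⟨⟨e, he⟩, -⟩
      · exact Relation.EqvGen.rel _ _ (hstep he hv hw)
      · exact Relation.EqvGen.symm _ _ (Relation.EqvGen.rel _ _ (hstep he hw hv))
  have hnode : ∀ n ∈ T.nodes g k, ∃ v, g v = k ∧ n = Pi.single v 1 := by
    intro n hn
    rcases nodes_cases hn with h | ⟨w, u, -, -, hu, -⟩
    · exact h
    · exact absurd (D.le_outer u) hu.not_ge
  intro n hn n' hn'
  obtain ⟨v, hv, rfl⟩ := hnode n hn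
  obtain ⟨w, hw, rfl⟩ := hnode n' hn'
  exact hreach v w ((D.annulus.component₁ v (D.mem_outer_iff.2 hv) w).2 (D.mem_outer_iff.2 hw)) hv

/-- The two sides of a cell are joined at every level of the cell. -/
lemma eqvGen_cell {a b e : V} {t₀ t₁ s : ℝ} (C : T.Cell g a b e t₀ t₁) (h0 : t₀ ≤ s)
    (h1 : s ≤ t₁) :
    Relation.EqvGen (T.Next g s) (edgePoint g a b s) (edgePoint g a e s) := by
  by_cases ha : g a = s
  · rw [C.eq_of_level_apex ha]; exact Relation.EqvGen.refl _
  · rcases C.sep with h | h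
    · exact Relation.EqvGen.rel _ _ ⟨C.left_mem_nodes h0 h1, C.right_mem_nodes h0 h1, _,
        C.left_mem h0 h1, C.right_mem h0 h1, C.ahead_low h.1 ha h0 h1⟩
    · exact Relation.EqvGen.symm _ _ (Relation.EqvGen.rel _ _ ⟨C.right_mem_nodes h0 h1,
        C.left_mem_nodes h0 h1, _, C.right_mem h0 h1, C.left_mem h0 h1,
        C.ahead_high h.1 ha h0 h1⟩)

lemma exists_cell_strict (D : T.DirichletData E₁ E₂ c k g) {t₀ t₁ s : ℝ}
    (ht : Consecutive g t₀ t₁) (h0 : t₀ < s) (h1 : s < t₁) {f : Finset V} {n : V → ℝ}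
    (hn : T.Mem f n) (hs : level g n = s) : ∃ a b e, f = {a, b, e} ∧ T.Cell g a b e t₀ t₁ := by
  obtain ⟨a, b, e, t₀', t₁', rfl, C, c0, c1⟩ := exists_cell D.not_const hn
  rw [hs] at c0 c1
  have e0 : t₀' = t₀ := by
    obtain ⟨v, hv⟩ := ht.mem₀
    obtain ⟨w, hw⟩ := C.mem₀
    rcases C.le_or_ge v with h | h
    · rcases ht.le_or_ge w with h' | h' <;> linarith
    · linarith
  have e1 : t₁' = t₁ := by
    obtain ⟨v, hv⟩ := ht.mem₁
    obtain ⟨w, hw⟩ := C.mem₁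
    rcases C.le_or_ge v with h | h
    · linarith
    · rcases ht.le_or_ge w with h' | h' <;> linarith
  subst e0 e1
  exact ⟨a, b, e, rfl, C⟩

lemma edge_unique_of_strict {w u w' u' : V} {s : ℝ} (hw : g w < s) (hu : s < g u)
    (hw' : g w' < s) (hu' : s < g u') (h : edgePoint g w u s = edgePoint g w' u' s) :
    w = w' ∧ u = u' := by
  have hne : w ≠ u := fun h => by rw [h] at hw; linarith
  have h1 : edgePoint g w' u' s w ≠ 0 := by
    rw [← h, edgePoint_fst hne]
    intro h0
    rw [sub_eq_zero, eq_div_iff (by linarith)] at h0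
    linarith
  have h2 : edgePoint g w' u' s u ≠ 0 := by
    rw [← h, edgePoint_snd hne]
    exact div_ne_zero (by linarith) (by linarith)
  constructor
  · by_contra hcon
    refine h1 (edgePoint_of_ne hcon (fun h => ?_) s)
    rw [h] at hw; linarith
  · by_contra hcon
    refine h2 (edgePoint_of_ne (fun h => ?_) hcon s)
    rw [h] at hu; linarith

/-- Pushing the level curve at an intermediate level `s` down to the next value `t₀`. -/
lemma nodesConnected_down (D : T.DirichletData E₁ E₂ c k g) {t₀ t₁ s : ℝ}
    (ht : Consecutive g t₀ t₁) (h0 : t₀ < s) (h1 : s < t₁) (hs : NodesConnected T g s) :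
    NodesConnected T g t₀ := by
  classical
  obtain ⟨φ, hφ⟩ : ∃ φ : (V → ℝ) → (V → ℝ), ∀ w u, g w < s → s < g u →
      φ (edgePoint g w u s) = edgePoint g w u t₀ := by
    refine ⟨fun n => if h : ∃ q : V × V, g q.1 < s ∧ s < g q.2 ∧ n = edgePoint g q.1 q.2 s then
      edgePoint g h.choose.1 h.choose.2 t₀ else 0, fun w u hw hu => ?_⟩
    have hex : ∃ q : V × V, g q.1 < s ∧ s < g q.2 ∧
      edgePoint g w u s = edgePoint g q.1 q.2 s := ⟨(w, u), hw, hu, rfl⟩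
    simp only [dif_pos hex]
    obtain ⟨hw', hu', he⟩ := hex.choose_spec
    obtain ⟨e1, e2⟩ := edge_unique_of_strict hw hu hw' hu' he
    rw [← e1, ← e2]
  have hφ' : ∀ {a b e : V}, T.Cell g a b e t₀ t₁ →
      φ (edgePoint g a b s) = edgePoint g a b t₀ ∧ φ (edgePoint g a e s) = edgePoint g a e t₀ := by
    intro a b e C
    rcases C.sep with h | h
    · exact ⟨hφ _ _ (by linarith) (by linarith), hφ _ _ (by linarith) (by linarith)⟩
    · rw [edgePoint_comm C.ne_left, edgePoint_comm C.ne_right, edgePoint_comm C.ne_left,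
        edgePoint_comm C.ne_right]
      exact ⟨hφ _ _ (by linarith) (by linarith), hφ _ _ (by linarith) (by linarith)⟩
  have hstep : ∀ n n', T.Next g s n n' → Relation.EqvGen (T.Next g t₀) (φ n) (φ n') := by
    rintro n n' ⟨hn, hn', f, hf, hf', hA⟩
    obtain ⟨a, b, e, rfl, C⟩ := D.exists_cell_strict ht h0 h1 hf (level_of_mem_nodes hn)
    have hE := eqvGen_cell C le_rfl C.lt.le
    rcases C.eq_of_mem_nodes h0.le h1.le hn hf with rfl | rfl <;>
      rcases C.eq_of_mem_nodes h0.le h1.le hn' hf' with rfl | rfl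
    · exact Relation.EqvGen.refl _
    · rwa [(hφ' C).1, (hφ' C).2]
    · rw [(hφ' C).1, (hφ' C).2]; exact hE.symm _ _
    · exact Relation.EqvGen.refl _
  have hlift : ∀ n ∈ T.nodes g t₀, ∃ m ∈ T.nodes g s, φ m = n := by
    intro n hn
    obtain ⟨w, u, hadj, hw, hu, rfl⟩ : ∃ w u, T.graph.Adj w u ∧ g w ≤ t₀ ∧ t₁ ≤ g u ∧
        n = edgePoint g w u t₀ := by
      have hlt := ht.lt
      rcases nodes_cases hn with ⟨v, hv, rfl⟩ | ⟨w, u, hadj, hw, hu, rfl⟩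
      · obtain ⟨u, hadj, hu⟩ := D.exists_upper (v := v) fun hv' => by
          obtain ⟨x, hx⟩ := ht.mem₁
          have := D.le_outer x
          have := D.sol.outer v hv'
          linarith
        exact ⟨v, u, hadj, hv.le, (ht.le_or_ge u).resolve_left (by linarith),
          by rw [← hv, edgePoint_self_left]⟩
      · exact ⟨w, u, hadj, hw.le, (ht.le_or_ge u).resolve_left (by linarith), rfl⟩
    exact ⟨_, ⟨w, u, hadj, by linarith, by linarith, by linarith, rfl⟩,
      hφ w u (by linarith) (by linarith)⟩
  intro n hn n' hn'
  obtain ⟨m, hm, rfl⟩ := hlift n hn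
  obtain ⟨m', hm', rfl⟩ := hlift n' hn'
  exact eqvGen_map φ hstep (hs m hm m' hm')

/-- A level segment at level `t₁ > 0` also bounds the cell below it. -/
lemma exists_cell_below (D : T.DirichletData E₁ E₂ c k g) {t₀ t₁ : ℝ}
    (ht : Consecutive g t₀ t₁) {n n' : V → ℝ} (h : T.Next g t₁ n n') :
    ∃ a b e, T.Cell g a b e t₀ t₁ ∧
      ((n = edgePoint g a b t₁ ∧ n' = edgePoint g a e t₁) ∨
        (n = edgePoint g a e t₁ ∧ n' = edgePoint g a b t₁)) := by
  obtain ⟨hn, hn', f, hf, hf', hA⟩ := h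
  have hne := hA.ne D.not_const
  obtain ⟨a, b, e, C⟩ : ∃ a b e, f = {a, b, e} ∧ T.Cell g a b e t₀ t₁ := by
    obtain ⟨a, b, e, t₀', t₁', rfl, C, c0, c1⟩ := exists_cell D.not_const hf
    rw [level_of_mem_nodes hn] at c0 c1
    have c0' := C.lt
    rcases c1.eq_or_lt with rfl | c1'
    · rw [ht.eq C.toConsecutive]; exact ⟨a, b, e, rfl, C⟩
    have e0 : t₀' = t₁ := by
      obtain ⟨v, hv⟩ := ht.mem₁
      rcases C.le_or_ge v with h | h <;> linarith
    subst e0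
    obtain ⟨x, hx⟩ := C.mem₁
    obtain ⟨y, hy⟩ := ht.mem₀
    have hk := D.le_outer x
    have h0 := D.inner_le y
    have hlt := ht.lt
    have hbelow : ∀ v, g v ≤ t₀' → g v ≠ t₀' → g v ≤ t₀ := fun v h h' =>
      (ht.le_or_ge v).resolve_right fun h'' => h' (le_antisymm h h'')
    rcases C.sep with ⟨h1, h2, h3⟩ | ⟨h1, h2, h3⟩
    · by_cases ha : g a = t₀'
      · exfalso
        have := C.eq_of_level_apex ha
        rcases C.eq_of_mem_nodes c0 c1 hn hf with e0 | e0 <;>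
          rcases C.eq_of_mem_nodes c0 c1 hn' hf' with e1 | e1 <;>
          exact hne (by rw [e0, e1]; try simp only [this])
      · exact exists_cell_of_span hf.1 ht (u := a) (v := b) (by simp) (by simp)
          (hbelow a h1 ha) (by linarith)
    · by_cases hb : g b = t₀'
      · by_cases he : g e = t₀'
        · exfalso
          rcases D.level_of_adj_eq (adj_of_tri (T.rotate C.tri)) (hb.trans he.symm) with h | h <;>
            linarith
        · exact exists_cell_of_span hf.1 ht (u := e) (v := a) (by simp) (by simp)
            (hbelow e h3 he) (by linarith)
      · exact exists_cell_of_span hf.1 ht (u := b) (v := a) (by simp) (by simp)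
          (hbelow b h2 hb) (by linarith)
  obtain ⟨rfl, C⟩ := C
  refine ⟨a, b, e, C, ?_⟩
  rcases C.eq_of_mem_nodes ht.lt.le le_rfl hn hf with e0 | e0 <;>
    rcases C.eq_of_mem_nodes ht.lt.le le_rfl hn' hf' with e1 | e1
  · exact absurd (e0.trans e1.symm) hne
  · exact Or.inl ⟨e0, e1⟩
  · exact Or.inr ⟨e0, e1⟩
  · exact absurd (e0.trans e1.symm) hne

/-- Pushing the level curve at the value `t₁` down to an intermediate level `s`: each vertex at
level `t₁` is replaced by the edges that descend from it. -/
lemma nodesConnected_between (D : T.DirichletData E₁ E₂ c k g) {t₀ t₁ s : ℝ}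
    (ht : Consecutive g t₀ t₁) (h0 : t₀ < s) (h1 : s < t₁) (hs : NodesConnected T g t₁) :
    NodesConnected T g s := by
  classical
  have hlt := ht.lt
  -- all points at level `s` below the same node at level `t₁` are joined
  have hfiber : ∀ w u w' u', T.graph.Adj w u → T.graph.Adj w' u' → g w ≤ t₀ → t₁ ≤ g u →
      g w' ≤ t₀ → t₁ ≤ g u' → edgePoint g w u t₁ = edgePoint g w' u' t₁ →
      Relation.EqvGen (T.Next g s) (edgePoint g w u s) (edgePoint g w' u' s) := by
    intro w u w' u' hadj hadj' hw hu hw' hu' he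
    have hwu : g w ≠ g u := by linarith
    have hwu' : g w' ≠ g u' := by linarith
    have hcoord : ∀ v, g v = t₁ → edgePoint g w u t₁ = Pi.single v 1 → u = v := by
      intro v hv h
      by_contra hcon
      have h2 : edgePoint g w u t₁ u = 0 := by rw [h]; simp [hcon]
      rw [edgePoint_snd hadj.ne] at h2
      exact div_ne_zero (by linarith : t₁ - g w ≠ 0) (by linarith : g u - g w ≠ 0) h2
    have hcoord' : ∀ v, g v = t₁ → edgePoint g w' u' t₁ = Pi.single v 1 → u' = v := by
      intro v hv h
      by_contra hcon
      have h2 : edgePoint g w' u' t₁ u' = 0 := by rw [h]; simp [hcon]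
      rw [edgePoint_snd hadj'.ne] at h2
      exact div_ne_zero (by linarith : t₁ - g w' ≠ 0) (by linarith : g u' - g w' ≠ 0) h2
    have hvert : ∀ v, g v = t₁ → u = v → u' = v →
        Relation.EqvGen (T.Next g s) (edgePoint g w u s) (edgePoint g w' u' s) := by
      rintro v hv rfl rfl
      rw [edgePoint_comm hwu, edgePoint_comm hwu']
      refine eqvGen_map (fun r => edgePoint g u' r s) ?_
        (D.lower_link_connected hadj.symm hadj'.symm (by linarith) (by linarith))
      rintro p q ⟨hpq, hp, hq⟩
      exact eqvGen_cell ⟨ht, hpq, Or.inr ⟨hv.ge, (ht.le_or_ge p).resolve_right (by linarith),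
        (ht.le_or_ge q).resolve_right (by linarith)⟩⟩ h0.le h1.le
    rcases hu.eq_or_lt with hu1 | hu1
    · have hsingle : edgePoint g w u t₁ = Pi.single u 1 := by
        rw [hu1]; exact edgePoint_self_right hwu
      exact hvert u hu1.symm rfl (hcoord' u hu1.symm (he ▸ hsingle))
    rcases hu'.eq_or_lt with hu1' | hu1'
    · have hsingle : edgePoint g w' u' t₁ = Pi.single u' 1 := by
        rw [hu1']; exact edgePoint_self_right hwu'
      exact hvert u' hu1'.symm (hcoord u' hu1'.symm (he ▸ hsingle)) rfl
    obtain ⟨rfl, rfl⟩ := edge_unique_of_strict (by linarith) hu1 (by linarith) hu1' he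
    exact Relation.EqvGen.refl _
  have hlift : ∀ n ∈ T.nodes g t₁, ∃ q : V × V, T.graph.Adj q.1 q.2 ∧ g q.1 ≤ t₀ ∧ t₁ ≤ g q.2 ∧
      n = edgePoint g q.1 q.2 t₁ := by
    intro n hn
    rcases nodes_cases hn with ⟨v, hv, rfl⟩ | ⟨w, u, hadj, hw, hu, rfl⟩
    · obtain ⟨w, hadj, hw⟩ := D.exists_lower (v := v) fun hv' => by
        obtain ⟨x, hx⟩ := ht.mem₀
        have := D.inner_le x
        have := D.sol.inner v hv'
        linarith
      refine ⟨(w, v), hadj.symm, (ht.le_or_ge w).resolve_right (by linarith), hv.ge, ?_⟩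
      rw [← hv]; exact (edgePoint_self_right hw.ne).symm
    · exact ⟨(w, u), hadj, (ht.le_or_ge w).resolve_right (by linarith), hu.le, rfl⟩
  obtain ⟨v₀, -⟩ := ht.mem₀
  have : Nonempty (V × V) := ⟨(v₀, v₀)⟩
  choose! q hq1 hq2 hq3 hq4 using hlift
  have hmap := fun n n' => eqvGen_map (r := T.Next g t₁) (r' := T.Next g s) (x := n) (y := n')
    (fun n => edgePoint g (q n).1 (q n).2 s) (by
    intro n n' h
    have hn := h.1
    have hn' := h.2.1
    obtain ⟨a, b, e, C, hC⟩ := D.exists_cell_below ht h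
    have hE := eqvGen_cell C h0.le h1.le
    obtain ⟨b1, b2, b3, b4, b5⟩ : ∃ w u w' u', (T.graph.Adj w u ∧ T.graph.Adj w' u' ∧
        g w ≤ t₀ ∧ t₁ ≤ g u ∧ g w' ≤ t₀ ∧ t₁ ≤ g u') ∧
        n = edgePoint g w u t₁ ∧ n' = edgePoint g w' u' t₁ ∧
        Relation.EqvGen (T.Next g s) (edgePoint g w u s) (edgePoint g w' u' s) := by
      have adj1 := adj_of_tri C.tri
      have adj2 := adj_of_tri' C.tri
      rcases C.sep with ⟨s1, s2, s3⟩ | ⟨s1, s2, s3⟩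
      · rcases hC with ⟨e1, e2⟩ | ⟨e1, e2⟩
        · exact ⟨a, b, a, e, ⟨adj1, adj2, s1, s2, s1, s3⟩, e1, e2, hE⟩
        · exact ⟨a, e, a, b, ⟨adj2, adj1, s1, s3, s1, s2⟩, e1, e2, hE.symm _ _⟩
      · rw [edgePoint_comm C.ne_left, edgePoint_comm C.ne_right] at hC hE
        rcases hC with ⟨e1, e2⟩ | ⟨e1, e2⟩
        · exact ⟨b, a, e, a, ⟨adj1.symm, adj2.symm, s2, s1, s3, s1⟩, e1, e2, hE⟩
        · exact ⟨e, a, b, a, ⟨adj2.symm, adj1.symm, s3, s1, s2, s1⟩, e1, e2, hE.symm _ _⟩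
    obtain ⟨⟨c1, c2, c3, c4, c5, c6⟩, d1, d2, d3⟩ := b5
    exact (hfiber _ _ _ _ (hq1 n hn) c1 (hq2 n hn) (hq3 n hn) c3 c4
      ((hq4 n hn).symm.trans d1)).trans _ _ _ (d3.trans _ _ _
      (hfiber _ _ _ _ c2 (hq1 n' hn') c5 c6 (hq2 n' hn') (hq3 n' hn')
        (d2.symm.trans (hq4 n' hn')))))
  have hup : ∀ m ∈ T.nodes g s, ∃ n ∈ T.nodes g t₁,
      Relation.EqvGen (T.Next g s) m (edgePoint g (q n).1 (q n).2 s) := by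
    rintro m ⟨w, u, hadj, hwu, hw, hu, rfl⟩
    have hw' := (ht.le_or_ge w).resolve_right (by linarith)
    have hu' := (ht.le_or_ge u).resolve_left (by linarith)
    have hn : edgePoint g w u t₁ ∈ T.nodes g t₁ := ⟨w, u, hadj, hwu, by linarith, hu', rfl⟩
    exact ⟨_, hn, hfiber _ _ _ _ hadj (hq1 _ hn) hw' hu' (hq2 _ hn) (hq3 _ hn) (hq4 _ hn)⟩
  intro m hm m' hm'
  obtain ⟨n, hn, h⟩ := hup m hm
  obtain ⟨n', hn', h'⟩ := hup m' hm'
  exact h.trans _ _ _ ((hmap n n' (hs n hn n' hn')).trans _ _ _ (h'.symm _ _))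

/-- All level curves are connected: this holds at the outer boundary, and propagates to lower
levels, as there are no singular vertices. -/
lemma nodesConnected (D : T.DirichletData E₁ E₂ c k g) {s : ℝ} (h0 : 0 ≤ s) (hk : s ≤ k) :
    NodesConnected T g s := by
  classical
  obtain ⟨x, hx⟩ := D.annulus.nonempty₁
  obtain ⟨y, hy⟩ := D.annulus.nonempty₂
  have hxk := D.sol.outer x hx
  have hy0 := D.sol.inner y hy
  have hval : ∀ v, NodesConnected T g (g v) := by
    by_contra! hcon
    obtain ⟨v₀, hv₀⟩ := hcon
    obtain ⟨v, hv, hmax⟩ := Finset.exists_max_image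
      (Finset.univ.filter fun v => ¬ NodesConnected T g (g v)) g ⟨v₀, by simpa using hv₀⟩
    simp only [Finset.mem_filter, Finset.mem_univ, true_and] at hv hmax
    have hvk : g v < g x := by
      refine lt_of_le_of_ne (by rw [hxk]; exact D.le_outer v) fun h => hv ?_
      rw [h, hxk]
      exact D.nodesConnected_outer
    obtain ⟨t, ⟨w, rfl⟩, h1, -, h3⟩ := exists_next_value hvk
    have ht : Consecutive g (g v) (g w) := ⟨h1, h3, ⟨v, rfl⟩, ⟨w, rfl⟩⟩
    have hw : NodesConnected T g (g w) := by
      by_contra hw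
      exact (hmax w hw).not_gt h1
    have hm0 : g v < (g v + g w) / 2 := by linarith
    have hm1 : (g v + g w) / 2 < g w := by linarith
    exact hv (D.nodesConnected_down ht hm0 hm1 (D.nodesConnected_between ht hm0 hm1 hw))
  by_cases hs : ∃ v, g v = s
  · obtain ⟨v, rfl⟩ := hs; exact hval v
  · obtain ⟨t₀, t₁, ht, h1, h2, -, -⟩ := exists_consecutive (g := g) (s := s) (u := y)
      (v := x)
      (by rwa [hy0]) (by rwa [hxk]) (by rw [hxk, hy0]; exact D.k_pos)
    obtain ⟨w, hw⟩ := ht.mem₁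
    obtain ⟨u, hu⟩ := ht.mem₀
    refine D.nodesConnected_between ht (lt_of_le_of_ne h1 fun h => hs ⟨u, hu.trans h⟩)
      (lt_of_le_of_ne h2 fun h => hs ⟨w, hw.trans h.symm⟩) ?_
    rw [← hw]; exact hval w

end DirichletData

end OrientedTriangulation

/-! ### Cyclic positions -/

/-- The positions on a finite cycle, counted from the point `x₀`. The cycle is given by a
successor relation `R` which is functional, injective and connected on the finite set `S`. -/
lemma exists_cyclic_position {α : Type*} {S : Set α} (hS : S.Finite) {R : α → α → Prop}
    (htot : ∀ x ∈ S, ∃ y ∈ S, R x y) (hfun : ∀ x y y', R x y → R x y' → y = y')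
    (hinj : ∀ x x' y, R x y → R x' y → x = x')
    (hconn : ∀ x ∈ S, ∀ y ∈ S, Relation.EqvGen R x y) {x₀ : α} (hx₀ : x₀ ∈ S) :
    ∃ pos : α → ℕ, pos x₀ = 0 ∧ Set.InjOn pos S ∧ (∀ x ∈ S, pos x < S.ncard) ∧
      (∀ x ∈ S, ∀ y, R x y → y ≠ x₀ → pos y = pos x + 1) ∧
      (∀ x ∈ S, R x x₀ → pos x + 1 = S.ncard) := by
  classical
  choose! τ hτS hτR using htot
  have horbS : ∀ i, τ^[i] x₀ ∈ S := fun i => by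
    induction i with
    | zero => exact hx₀
    | succ i ih => rw [Function.iterate_succ_apply']; exact hτS _ ih
  have horb : ∀ x ∈ S, ∃ i, τ^[i] x₀ = x := by
    set O : Set α := Set.range fun i => τ^[i] x₀ with hO
    have hOS : O ⊆ S := by rintro _ ⟨i, rfl⟩; exact horbS i
    have hclosed : ∀ x y, R x y → (x ∈ O ↔ y ∈ O) := fun x y hxy =>
      ⟨by
        rintro ⟨i, rfl⟩
        refine ⟨i + 1, ?_⟩
        simp only [Function.iterate_succ_apply']
        exact hfun _ _ _ (hτR _ (horbS i)) hxy,
      fun hy => OrientedTriangulation.closed_pred_of_closed_succ hinj (hS.subset hOS)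
        (by
          rintro _ ⟨i, rfl⟩
          exact ⟨τ (τ^[i] x₀), ⟨i + 1, Function.iterate_succ_apply' _ _ _⟩,
            hτR _ (horbS i)⟩) hy hxy⟩
    have : ∀ x y, Relation.EqvGen R x y → (x ∈ O ↔ y ∈ O) := by
      intro x y h
      induction h with
      | rel _ _ h => exact hclosed _ _ h
      | refl => rfl
      | symm _ _ _ ih => exact ih.symm
      | trans _ _ _ _ _ ih ih' => exact ih.trans ih'
    exact fun x hx => (this x₀ x (hconn x₀ hx₀ x hx)).1 ⟨0, rfl⟩
  obtain ⟨z, hz, hzx⟩ : ∃ z ∈ S, τ z = x₀ := by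
    have hinjOn : Set.InjOn τ S := fun a ha b hb hab => hinj a b (τ b) (hab ▸ hτR a ha) (hτR b hb)
    have himg : τ '' S = S := Set.eq_of_subset_of_ncard_le (Set.image_subset_iff.2 hτS)
      hinjOn.ncard_image.ge hS
    rwa [← himg] at hx₀
  obtain ⟨j, rfl⟩ := horb z hz
  have hper : x₀ ∈ Function.periodicPts τ :=
    ⟨j + 1, Nat.succ_pos j, by
      rw [Function.IsPeriodicPt, Function.IsFixedPt, Function.iterate_succ_apply']; exact hzx⟩
  set m := Function.minimalPeriod τ x₀ with hm
  have hmpos : 0 < m := Function.minimalPeriod_pos_of_mem_periodicPts hper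
  have hlt : ∀ x ∈ S, ∃ i, i < m ∧ τ^[i] x₀ = x := fun x hx => by
    obtain ⟨i, hi⟩ := horb x hx
    exact ⟨i % m, Nat.mod_lt _ hmpos, by rw [Function.iterate_mod_minimalPeriod_eq, hi]⟩
  have hiter : ∀ i i', i < m → i' < m → τ^[i] x₀ = τ^[i'] x₀ → i = i' := fun i i' hi hi' h =>
    Function.iterate_injOn_Iio_minimalPeriod hi hi' h
  choose! pos hposlt hpos using hlt
  have hcard : S.ncard = m := by
    have : S = (fun i => τ^[i] x₀) '' Set.Iio m := by
      ext x
      exact ⟨fun hx => ⟨pos x, hposlt x hx, hpos x hx⟩, by rintro ⟨i, -, rfl⟩; exact horbS i⟩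
    have hI : Set.InjOn (fun i => τ^[i] x₀) (Set.Iio m) := fun i hi i' hi' h =>
      hiter i i' hi hi' h
    rw [this, hI.ncard_image, ← Finset.coe_Iio, Set.ncard_coe_finset, Nat.card_Iio]
  have hstep : ∀ x ∈ S, ∀ y, R x y → τ^[pos x + 1] x₀ = y := fun x hx y hxy => by
    rw [Function.iterate_succ_apply', hpos x hx]
    exact hfun _ _ _ (hτR x hx) hxy
  have hperiod : τ^[m] x₀ = x₀ := Function.iterate_minimalPeriod
  refine ⟨pos, hiter _ _ (hposlt x₀ hx₀) hmpos (hpos x₀ hx₀), fun x hx y hy h => ?_,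
    fun x hx => hcard ▸ hposlt x hx, fun x hx y hxy hy => ?_, fun x hx hxx => ?_⟩
  · rw [← hpos x hx, ← hpos y hy, h]
  · have h := hstep x hx y hxy
    have hyS : y ∈ S := h ▸ horbS _
    rcases Nat.lt_or_ge (pos x + 1) m with hl | hl
    · exact hiter _ _ (hposlt y hyS) hl ((hpos y hyS).trans h.symm)
    · have : pos x + 1 = m := le_antisymm (hposlt x hx) hl
      rw [this, hperiod] at h
      exact absurd h.symm hy
  · have h := hstep x hx x₀ hxx
    rw [hcard]
    rcases Nat.lt_or_ge (pos x + 1) m with hl | hl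
    · exact absurd (hiter _ _ hl hmpos h) (Nat.succ_ne_zero _)
    · exact le_antisymm (hposlt x hx) hl

namespace OrientedTriangulation

/-! ### The slit -/

section Slit

variable {V : Type*} {G : SimpleGraph V} {g : V → ℝ}

lemma Walk.dart_fst_le {x y : V} (p : G.Walk x y) (hp : ∀ d ∈ p.darts, g d.snd < g d.fst) :
    ∀ d ∈ p.darts, d.fst = x ∨ g d.fst < g x := by
  induction p with
  | nil => simp
  | cons h p ih =>
    intro d hd
    simp only [SimpleGraph.Walk.darts_cons, List.mem_cons] at hd hp
    rcases hd with rfl | hd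
    · exact Or.inl rfl
    · have h1 := hp _ (Or.inl rfl)
      right
      rcases ih (fun d hd => hp d (Or.inr hd)) d hd with h2 | h2
      · rw [h2]; exact h1
      · exact h2.trans h1

/-- Two steps of a decreasing path are equal, or one of them comes after the other. -/
lemma Walk.dart_trichotomy {x y : V} (p : G.Walk x y) (hp : ∀ d ∈ p.darts, g d.snd < g d.fst) :
    ∀ d ∈ p.darts, ∀ d' ∈ p.darts, d = d' ∨ (d'.fst = d.snd ∨ g d'.fst < g d.snd) ∨
      (d.fst = d'.snd ∨ g d.fst < g d'.snd) := by
  induction p with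
  | nil => simp
  | cons h p ih =>
    intro d hd d' hd'
    simp only [SimpleGraph.Walk.darts_cons, List.mem_cons] at hd hd' hp
    have hp' := fun d hd => hp d (Or.inr hd)
    rcases hd with rfl | hd <;> rcases hd' with rfl | hd'
    · exact Or.inl rfl
    · exact Or.inr (Or.inl (Walk.dart_fst_le p hp' d' hd'))
    · exact Or.inr (Or.inr (Walk.dart_fst_le p hp' d hd))
    · exact ih hp' d hd d' hd'

lemma Walk.exists_dart_lt {x y : V} (p : G.Walk x y) {s : ℝ} (hy : g y < s) (hx : s ≤ g x) :
    ∃ d ∈ p.darts, g d.snd < s ∧ s ≤ g d.fst := by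
  induction p with
  | nil => exact absurd hx hy.not_ge
  | @cons u v w h p ih =>
    by_cases hv : s ≤ g v
    · obtain ⟨d, hd, h⟩ := ih hy hv
      exact ⟨d, by simp [hd], h⟩
    · exact ⟨⟨(u, v), h⟩, by simp, not_le.1 hv, hx⟩

lemma Walk.exists_dart_le {x y : V} (p : G.Walk x y) {s : ℝ} (hy : g y ≤ s) (hx : s < g x) :
    ∃ d ∈ p.darts, g d.snd ≤ s ∧ s < g d.fst := by
  induction p with
  | nil => exact absurd hx hy.not_gt
  | @cons u v w h p ih =>
    by_cases hv : s < g v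
    · obtain ⟨d, hd, h⟩ := ih hy hv
      exact ⟨d, by simp [hd], h⟩
    · exact ⟨⟨(u, v), h⟩, by simp, not_lt.1 hv, hx⟩

lemma Walk.snd_eq_or {x y : V} (p : G.Walk x y) :
    ∀ d ∈ p.darts, d.snd = y ∨ ∃ d' ∈ p.darts, d'.fst = d.snd := by
  induction p with
  | nil => simp
  | cons h p ih =>
    intro d hd
    simp only [SimpleGraph.Walk.darts_cons, List.mem_cons] at hd
    rcases hd with rfl | hd
    · cases p with
      | nil => exact Or.inl rfl
      | cons h' p' => exact Or.inr ⟨⟨(_, _), h'⟩, List.mem_cons_of_mem _ List.mem_cons_self, rfl⟩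
    · rcases ih d hd with h1 | ⟨d', hd', h1⟩
      · exact Or.inl h1
      · exact Or.inr ⟨d', by simp [hd'], h1⟩

lemma Walk.fst_eq_or {x y : V} (p : G.Walk x y) :
    ∀ d ∈ p.darts, d.fst = x ∨ ∃ d' ∈ p.darts, d'.snd = d.fst := by
  induction p with
  | nil => simp
  | cons h p ih =>
    intro d hd
    simp only [SimpleGraph.Walk.darts_cons, List.mem_cons] at hd
    rcases hd with rfl | hd
    · exact Or.inl rfl
    · right
      rcases ih d hd with h1 | ⟨d', hd', h1⟩
      · exact ⟨⟨(_, _), h⟩, List.mem_cons_self, h1.symm⟩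
      · exact ⟨d', by simp [hd'], h1⟩

lemma Walk.mem_edges_iff {x y : V} (p : G.Walk x y) {a b : V} : s(a, b) ∈ p.edges ↔
    ∃ d ∈ p.darts, (d.fst = a ∧ d.snd = b) ∨ (d.fst = b ∧ d.snd = a) := by
  simp only [SimpleGraph.Walk.edges, List.mem_map]
  constructor
  · rintro ⟨d, hd, h⟩
    refine ⟨d, hd, ?_⟩
    rwa [SimpleGraph.dart_edge_eq_mk'_iff'] at h
  · rintro ⟨d, hd, h⟩
    refine ⟨d, hd, ?_⟩
    rcases h with ⟨rfl, rfl⟩ | ⟨rfl, rfl⟩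
    · rfl
    · exact Sym2.eq_swap

end Slit

/-! ### Points of the slit annulus -/

section Pt

variable {V : Type*} [Fintype V] [DecidableEq V] {T : OrientedTriangulation V} {g : V → ℝ}
  {x y : V} (p : T.graph.Walk x y)

/-- The point of the slit annulus given by a point `n` of the triangle `f`. -/
def pt {f : Finset V} {n : V → ℝ} (h : T.Mem f n) : T.SlitAnnulus p :=
  Quot.mk _ ⟨f, h.1, n, h.2.1, h.2.2⟩

variable {p}

lemma mk_eq_pt (z : T.FacePoint) {f : Finset V} {n : V → ℝ} (h : T.Mem f n) (hf : z.face = f)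
    (hn : z.wt = n) : (Quot.mk _ z : T.SlitAnnulus p) = pt p h := by
  subst hf hn; rfl

lemma exists_pt (q : T.SlitAnnulus p) : ∃ (f : Finset V) (n : V → ℝ) (h : T.Mem f n),
    q = pt p h := by
  obtain ⟨z, rfl⟩ := Quot.exists_rep q
  exact ⟨_, _, ⟨z.face_mem, z.wt_mem, z.wt_support⟩, rfl⟩

lemma bary_pt {f : Finset V} {n : V → ℝ} (h : T.Mem f n) : T.bary p (pt p h) = n := rfl

lemma extend_pt {f : Finset V} {n : V → ℝ} (h : T.Mem f n) :
    T.extend p g (pt p h) = level g n := rfl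

lemma pt_congr {f f' : Finset V} {n n' : V → ℝ} (h : T.Mem f n) (h' : T.Mem f' n')
    (hf : f = f') (hn : n = n') : pt p h = pt p h' := by
  subst hf hn; rfl

lemma pt_glue {a b e e' : V} {f f' : Finset V} {n : V → ℝ} (h : T.tri a b e) (h' : T.tri b a e')
    (hf : f = {a, b, e}) (hf' : f' = {b, a, e'}) (hs : s(a, b) ∉ p.edges) (hn : T.Mem f n)
    (hn' : T.Mem f' n) : pt p hn = pt p hn' := by
  subst hf hf'
  refine Quot.sound ⟨rfl, a, b, T.ne h, ?_, hs⟩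
  have hee : e ≠ e' := fun hee => T.not_swap h (hee ▸ h')
  ext v
  simp only [Finset.mem_inter, Finset.mem_insert, Finset.mem_singleton]
  constructor
  · rintro ⟨rfl | rfl | rfl, h2⟩
    · exact Or.inl rfl
    · exact Or.inr rfl
    · exact absurd h2 (by simp [hee, (tri_ne_snd h).symm, tri_ne_trd h])
  · rintro (rfl | rfl) <;> simp

lemma Glue.exists_tri {z z' : T.FacePoint} (h : T.Glue p z z') : ∃ a b e e', T.tri a b e ∧
    T.tri b a e' ∧ z.face = {a, b, e} ∧ z'.face = {b, a, e'} ∧ s(a, b) ∉ p.edges ∧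
    z.wt = z'.wt ∧ ∀ v, v ≠ a → v ≠ b → z.wt v = 0 := by
  obtain ⟨hwt, a, b, hab, hinter, hs⟩ := h
  have hsupp : ∀ v, v ≠ a → v ≠ b → z.wt v = 0 := by
    intro v ha hb
    by_cases hv : v ∈ z.face
    · rw [hwt]
      refine z'.wt_support v fun hv' => ?_
      have : v ∈ ({a, b} : Finset V) := hinter ▸ Finset.mem_inter.2 ⟨hv, hv'⟩
      simp [ha, hb] at this
    · exact z.wt_support v hv
  have hma : a ∈ z.face ∩ z'.face := by rw [hinter]; simp
  have hmb : b ∈ z.face ∩ z'.face := by rw [hinter]; simp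
  rw [Finset.mem_inter] at hma hmb
  have key : ∀ f ∈ T.faces, a ∈ f → b ∈ f →
      (∃ e, T.tri a b e ∧ f = {a, b, e}) ∨ ∃ e, T.tri b a e ∧ f = {b, a, e} := by
    rintro _ ⟨r, s, t, h, rfl⟩ ha hb
    obtain ⟨u, w, h', hf⟩ := exists_tri_of_mem h ha
    rw [← hf] at hb ⊢
    simp only [Finset.mem_insert, Finset.mem_singleton] at hb
    rcases hb with rfl | rfl | rfl
    · exact absurd rfl hab
    · exact Or.inl ⟨w, h', rfl⟩
    · exact Or.inr ⟨u, T.rotate (T.rotate h'), by ext; simp; tauto⟩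
  have hcontra : ∀ {e e'}, z.face = {a, b, e} → z'.face = {a, b, e'} → e = e' → e ≠ a → e ≠ b →
      False := by
    intro e e' h1 h2 h3 ha hb
    rw [h1, h2, h3, Finset.inter_self] at hinter
    have : e' ∈ ({a, b} : Finset V) := by rw [← hinter]; simp
    simp [← h3, ha, hb] at this
  have hswap : ∀ e, ({b, a, e} : Finset V) = {a, b, e} := fun e => Finset.insert_comm _ _ _
  rcases key z.face z.face_mem hma.1 hmb.1 with ⟨e, he, hf⟩ | ⟨e, he, hf⟩ <;>
    rcases key z'.face z'.face_mem hma.2 hmb.2 with ⟨e', he', hf'⟩ | ⟨e', he', hf'⟩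
  · exact (hcontra hf hf' (T.unique he he') (tri_ne_trd he) (tri_ne_snd he).symm).elim
  · exact ⟨a, b, e, e', he, he', hf, hf', hs, hwt, hsupp⟩
  · exact ⟨b, a, e, e', he, he', hf, hf', by rwa [Sym2.eq_swap], hwt,
      fun v hb ha => hsupp v ha hb⟩
  · rw [hswap] at hf hf'
    exact (hcontra hf hf' (T.unique he he') (tri_ne_snd he).symm (tri_ne_trd he)).elim

end Pt

end OrientedTriangulation

namespace OrientedTriangulation

/-! ### The link of a vertex in the slit annulus -/

section Link

variable {V : Type*} (T : OrientedTriangulation V)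

/-- The counter-clockwise rotation around `v`. For a vertex on the boundary, the region outside
the annulus is represented by `none`. -/
def LinkNext (v : V) : Option V → Option V → Prop
  | some a, some b => T.tri v a b
  | some a, none => T.graph.Adj v a ∧ ¬ ∃ b, T.tri v a b
  | none, some a => T.graph.Adj v a ∧ ¬ ∃ b, T.tri v b a
  | none, none => False

/-- The neighbours of `v`, and `none` if `v` is on the boundary. -/
def linkSet (v : V) : Set (Option V) :=
  {o | (∃ a, o = some a ∧ T.graph.Adj v a) ∨ (o = none ∧ ∃ w, T.boundaryGraph.Adj v w)}

end Link

namespace DirichletData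

variable {V : Type*} [Fintype V] [DecidableEq V] {T : OrientedTriangulation V}
  {E₁ E₂ : Finset V} {c : V → V → ℝ} {k : ℝ} {g : V → ℝ} {x y : V} {p : T.graph.Walk x y}

lemma boundary_of_no_succ {v a : V} (h : T.graph.Adj v a) (hn : ¬ ∃ b, T.tri v a b) :
    T.boundaryGraph.Adj v a := Or.inr ⟨h.resolve_left hn, hn⟩

lemma boundary_of_no_pred {v a : V} (h : T.graph.Adj v a) (hn : ¬ ∃ b, T.tri v b a) :
    T.boundaryGraph.Adj v a := by
  have hn' : ¬ ∃ b, T.tri a v b := fun ⟨b, hb⟩ => hn ⟨b, T.rotate hb⟩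
  exact Or.inl ⟨h.resolve_right hn', hn'⟩

/-- At a vertex of the outer (inner) boundary, the boundary edge without predecessor starts the
out-going (in-coming) corner. -/
lemma start_iff (D : T.DirichletData E₁ E₂ c k g) {v a : V} :
    (T.graph.Adj v a ∧ ¬ ∃ b, T.tri v b a) ↔ (∃ b, T.tri v a b) ∧ g a = g v := by
  constructor
  · rintro ⟨h, hn⟩
    have hb := boundary_of_no_pred h hn
    refine ⟨h.resolve_right fun ⟨b, hb⟩ => hn ⟨b, T.rotate hb⟩, (D.eq_of_boundary_adj hb).symm⟩
  · rintro ⟨⟨b, hb⟩, h⟩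
    exact ⟨adj_of_tri hb, fun ⟨d, hd⟩ => D.no_opp hb h.symm (T.rotate (T.rotate hd))⟩

lemma end_iff (D : T.DirichletData E₁ E₂ c k g) {v a : V} :
    (T.graph.Adj v a ∧ ¬ ∃ b, T.tri v a b) ↔ (∃ b, T.tri v b a) ∧ g a = g v := by
  constructor
  · rintro ⟨h, hn⟩
    have hb := boundary_of_no_succ h hn
    obtain ⟨b, hb'⟩ := h.resolve_left hn
    exact ⟨⟨b, T.rotate hb'⟩, (D.eq_of_boundary_adj hb).symm⟩
  · rintro ⟨⟨b, hb⟩, h⟩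
    exact ⟨adj_of_tri' hb, fun ⟨d, hd⟩ => D.no_opp hd h.symm (T.rotate (T.rotate hb))⟩

lemma value_cases (D : T.DirichletData E₁ E₂ c k g) {v a : V} (h : T.graph.Adj v a)
    (ha : g a = g v) : (∀ w, g w ≤ g v) ∨ ∀ w, g v ≤ g w := by
  rcases D.level_of_adj_eq h ha.symm with h | h
  · exact Or.inl fun w => h ▸ D.le_outer w
  · exact Or.inr fun w => h ▸ D.inner_le w

lemma start_unique (D : T.DirichletData E₁ E₂ c k g) {v a a' : V}
    (h : (∃ b, T.tri v a b) ∧ g a = g v) (h' : (∃ b, T.tri v a' b) ∧ g a' = g v) : a = a' := by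
  obtain ⟨⟨b, hb⟩, ha⟩ := h
  obtain ⟨⟨b', hb'⟩, ha'⟩ := h'
  rcases D.value_cases (adj_of_tri hb) ha with hv | hv
  · exact (D.regular.out_unique hb (hv b) ha.ge hb' (hv b') ha'.ge).1
  · exact (D.regular.in_unique hb ha.le (hv b) hb' ha'.le (hv b')).1

lemma end_unique (D : T.DirichletData E₁ E₂ c k g) {v a a' : V}
    (h : (∃ b, T.tri v b a) ∧ g a = g v) (h' : (∃ b, T.tri v b a') ∧ g a' = g v) : a = a' := by
  obtain ⟨⟨b, hb⟩, ha⟩ := h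
  obtain ⟨⟨b', hb'⟩, ha'⟩ := h'
  rcases D.value_cases (adj_of_tri' hb) ha with hv | hv
  · exact (D.regular.in_unique hb (hv b) ha.ge hb' (hv b') ha'.ge).2
  · exact (D.regular.out_unique hb ha.le (hv b) hb' ha'.le (hv b')).2

lemma exists_start (D : T.DirichletData E₁ E₂ c k g) {v w : V} (h : T.boundaryGraph.Adj v w) :
    ∃ a b, T.tri v a b ∧ g a = g v := by
  rcases D.boundary_adj h with ⟨h, -⟩ | ⟨h, -⟩
  · obtain ⟨a, b, hab, -, ha⟩ := D.regular.exists_out v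
    refine ⟨a, b, hab, le_antisymm ?_ ha⟩
    rw [D.sol.outer v h]; exact D.le_outer a
  · obtain ⟨a, b, hab, ha, -⟩ := D.regular.exists_in v
    refine ⟨a, b, hab, le_antisymm ha ?_⟩
    rw [D.sol.inner v h]; exact D.inner_le a

/-- The positions of the neighbours of a vertex, in counter-clockwise order from `o₀`. -/
lemma exists_link_position (D : T.DirichletData E₁ E₂ c k g) (v : V) {o₀ : Option V}
    (ho₀ : o₀ ∈ T.linkSet v) : ∃ pos : Option V → ℕ, pos o₀ = 0 ∧ Set.InjOn pos (T.linkSet v) ∧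
      (∀ o ∈ T.linkSet v, pos o < (T.linkSet v).ncard) ∧
      (∀ o ∈ T.linkSet v, ∀ o', T.LinkNext v o o' → o' ≠ o₀ → pos o' = pos o + 1) ∧
      (∀ o ∈ T.linkSet v, T.LinkNext v o o₀ → pos o + 1 = (T.linkSet v).ncard) := by
  have hsome : ∀ a b, T.graph.Adj v a → T.graph.Adj v b →
      Relation.EqvGen (T.LinkNext v) (some a) (some b) := fun a b ha hb =>
    eqvGen_map (r' := T.LinkNext v) some (fun p q h => Relation.EqvGen.rel _ _ h)
      (D.annulus.link_connected v a b ha hb)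
  have hnone : (∃ w, T.boundaryGraph.Adj v w) → ∀ b, T.graph.Adj v b →
      Relation.EqvGen (T.LinkNext v) none (some b) := by
    rintro ⟨w, hw⟩ b hb
    obtain ⟨a, e, hae, ha⟩ := D.exists_start hw
    have : T.LinkNext v none (some a) := D.start_iff.2 ⟨⟨e, hae⟩, ha⟩
    exact (Relation.EqvGen.rel _ _ this).trans _ _ _ (hsome a b (adj_of_tri hae) hb)
  refine exists_cyclic_position (Set.toFinite _) ?_ ?_ ?_ ?_ ho₀
  · rintro o (⟨a, rfl, ha⟩ | ⟨rfl, w, hw⟩)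
    · by_cases h : ∃ b, T.tri v a b
      · obtain ⟨b, hb⟩ := h
        exact ⟨some b, Or.inl ⟨b, rfl, adj_of_tri' hb⟩, hb⟩
      · exact ⟨none, Or.inr ⟨rfl, a, boundary_of_no_succ ha h⟩, ha, h⟩
    · obtain ⟨a, e, hae, ha⟩ := D.exists_start hw
      exact ⟨some a, Or.inl ⟨a, rfl, adj_of_tri hae⟩, D.start_iff.2 ⟨⟨e, hae⟩, ha⟩⟩
  · rintro (_ | a) (_ | b) (_ | b') h h'
    · exact h.elim
    · exact h.elim
    · exact h'.elim
    · exact congrArg some (D.start_unique (D.start_iff.1 h) (D.start_iff.1 h'))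
    · rfl
    · exact absurd ⟨b', h'⟩ h.2
    · exact absurd ⟨b, h⟩ h'.2
    · exact congrArg some (T.unique h h')
  · rintro (_ | a) (_ | a') (_ | b) h h'
    · rfl
    · rfl
    · exact h.elim
    · exact absurd ⟨a', h'⟩ h.2
    · exact h'.elim
    · exact absurd ⟨a, h⟩ h'.2
    · exact congrArg some (D.end_unique (D.end_iff.1 h) (D.end_iff.1 h'))
    · exact congrArg some (tri_unique_snd h h')
  · rintro o (⟨a, rfl, ha⟩ | ⟨rfl, hw⟩) o' (⟨a', rfl, ha'⟩ | ⟨rfl, hw'⟩)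
    · exact hsome a a' ha ha'
    · exact (hnone hw' a ha).symm _ _
    · exact hnone hw a' ha'
    · exact Relation.EqvGen.refl _

/-- Corners at `v` between two positions are glued if no slit edge and no boundary lies between
them. -/
lemma corner_range (_ : T.DirichletData E₁ E₂ c k g) {v : V} {o₀ : Option V}
    {pos : Option V → ℕ} (hinj : Set.InjOn pos (T.linkSet v))
    (hlt : ∀ o ∈ T.linkSet v, pos o < (T.linkSet v).ncard)
    (hstep : ∀ o ∈ T.linkSet v, ∀ o', T.LinkNext v o o' → o' ≠ o₀ → pos o' = pos o + 1)
    (hlast : ∀ o ∈ T.linkSet v, T.LinkNext v o o₀ → pos o + 1 = (T.linkSet v).ncard)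
    {β : Type*} {φ : V → V → β} (hφ : ∀ a b b', T.tri v a b → T.tri v b b' →
      s(v, b) ∉ p.edges → φ a b = φ b b') {a b a' b' : V} (h : T.tri v a b) (h' : T.tri v a' b')
    (hle : pos (some a) ≤ pos (some a'))
    (hcut : ∀ o ∈ T.linkSet v, pos (some a) < pos o → pos o ≤ pos (some a') →
      ∃ w, o = some w ∧ s(v, w) ∉ p.edges) : φ a b = φ a' b' := by
  have hmem : ∀ {a b : V}, T.tri v a b → some a ∈ T.linkSet v := fun h =>
    Or.inl ⟨_, rfl, adj_of_tri h⟩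
  have hmem' : ∀ {a b : V}, T.tri v a b → some b ∈ T.linkSet v := fun h =>
    Or.inl ⟨_, rfl, adj_of_tri' h⟩
  induction hj : pos (some a') - pos (some a) generalizing a b with
  | zero =>
    have := hinj (hmem h) (hmem h') (by omega)
    simp only [Option.some.injEq] at this
    subst this
    rw [T.unique h h']
  | succ j ih =>
    have hb : pos (some b) = pos (some a) + 1 := by
      refine hstep _ (hmem h) _ h fun hb => ?_
      have := hlast _ (hmem h) (hb ▸ h)
      have := hlt _ (hmem h')
      omega
    obtain ⟨w, hw, hs⟩ := hcut _ (hmem' h) (by omega) (by omega)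
    simp only [Option.some.injEq] at hw
    subst hw
    by_cases hba : pos (some b) = pos (some a')
    · have := hinj (hmem' h) (hmem h') hba
      simp only [Option.some.injEq] at this
      subst this
      exact hφ _ _ _ h h' hs
    · obtain ⟨o, ho, hbo⟩ : ∃ o, o ∈ T.linkSet v ∧ T.LinkNext v (some b) o := by
        by_cases h : ∃ d, T.tri v b d
        · obtain ⟨d, hd⟩ := h
          exact ⟨some d, hmem' hd, hd⟩
        · exact ⟨none, Or.inr ⟨rfl, b, boundary_of_no_succ (adj_of_tri' ‹_›) h⟩,
            adj_of_tri' ‹_›, h⟩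
      have hpo : pos o = pos (some b) + 1 := by
        refine hstep _ (hmem' h) _ hbo fun ho => ?_
        have := hlast _ (hmem' h) (ho ▸ hbo)
        have := hlt _ (hmem h')
        omega
      obtain ⟨d, rfl, -⟩ := hcut o ho (by omega) (by omega)
      rw [hφ _ _ _ h hbo hs]
      exact ih hbo (by omega) (fun o ho h1 h2 => hcut o ho (by omega) h2) (by omega)

/-- All corners at a vertex outside the slit are glued. -/
lemma corner_of_not_slit (D : T.DirichletData E₁ E₂ c k g) {v : V}
    (hv : ∀ w, s(v, w) ∉ p.edges)
    {β : Type*} {φ : V → V → β} (hφ : ∀ a b b', T.tri v a b → T.tri v b b' →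
      s(v, b) ∉ p.edges → φ a b = φ b b') {a b a' b' : V} (h : T.tri v a b)
    (h' : T.tri v a' b') : φ a b = φ a' b' := by
  obtain ⟨o₀, ho₀, hnone⟩ : ∃ o₀ ∈ T.linkSet v, none ∈ T.linkSet v → o₀ = none := by
    by_cases hn : none ∈ T.linkSet v
    · exact ⟨none, hn, fun _ => rfl⟩
    · exact ⟨some a, Or.inl ⟨a, rfl, adj_of_tri h⟩, fun h => absurd h hn⟩
  obtain ⟨pos, h0, hinj, hlt, hstep, hlast⟩ := D.exists_link_position v ho₀
  have key : ∀ {a b a' b' : V}, T.tri v a b → T.tri v a' b' → pos (some a) ≤ pos (some a') →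
      φ a b = φ a' b' := fun h h' hle =>
    D.corner_range hinj hlt hstep hlast hφ h h' hle fun o ho h1 _ => by
      rcases ho with ⟨w, rfl, -⟩ | ⟨rfl, hb⟩
      · exact ⟨w, rfl, hv w⟩
      · rw [← hnone (Or.inr ⟨rfl, hb⟩), h0] at h1
        exact absurd h1 (Nat.not_lt_zero _)
  rcases le_total (pos (some a)) (pos (some a')) with hle | hle
  · exact key h h' hle
  · exact (key h' h hle).symm

/-- The corners at a vertex `v` of the slit fall into two classes, those glued to the base and
those glued to the top. The out-going corner belongs to the base, the in-coming corner to the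
top. -/
lemma exists_corner_side (D : T.DirichletData E₁ E₂ c k g) (hp : T.IsSlit E₁ E₂ g p) {v : V}
    (hv : ∃ d ∈ p.darts, d.fst = v ∨ d.snd = v) : ∃ side : V → V → Prop,
      (∀ a b b', T.tri v a b → T.tri v b b' → s(v, b) ∉ p.edges → (side a b ↔ side b b')) ∧
      (∀ a b, T.tri v a b → g b ≤ g v → g v ≤ g a → side a b) ∧
      (∀ a b, T.tri v a b → g a ≤ g v → g v ≤ g b → ¬ side a b) ∧
      (∀ d ∈ p.darts, d.snd = v → ∀ e, T.tri v d.fst e → side d.fst e) ∧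
      (∀ d ∈ p.darts, d.fst = v → ∀ e, T.tri v e d.snd → side e d.snd) ∧
      (∀ d ∈ p.darts, d.snd = v → ∀ e, T.tri v e d.fst → ¬ side e d.fst) ∧
      (∀ d ∈ p.darts, d.fst = v → ∀ e, T.tri v d.snd e → ¬ side d.snd e) ∧
      (∀ (β : Type _) (φ : V → V → β), (∀ a b b', T.tri v a b → T.tri v b b' →
        s(v, b) ∉ p.edges → φ a b = φ b b') → ∀ a b a' b', T.tri v a b → T.tri v a' b' →
        (side a b ↔ side a' b') → φ a b = φ a' b') := by
  classical
  have hdec := hp.decreasing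
  have hfst : ∀ d ∈ p.darts, ∀ d' ∈ p.darts, d.fst = d'.fst → d = d' := by
    intro d hd d' hd' h
    have h1 := hdec d hd
    have h2 := hdec d' hd'
    rcases Walk.dart_trichotomy p hdec d hd d' hd' with h3 | (h3 | h3) | (h3 | h3)
    · exact h3
    · rw [← h3, h] at h1; exact absurd h1 (lt_irrefl _)
    · rw [h] at h1; linarith
    · rw [← h3, h] at h2; exact absurd h2 (lt_irrefl _)
    · rw [h] at h3; linarith
  have hsnd : ∀ d ∈ p.darts, ∀ d' ∈ p.darts, d.snd = d'.snd → d = d' := by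
    intro d hd d' hd' h
    have h1 := hdec d hd
    have h2 := hdec d' hd'
    rcases Walk.dart_trichotomy p hdec d hd d' hd' with h3 | (h3 | h3) | (h3 | h3)
    · exact h3
    · rw [h3, h] at h2; exact absurd h2 (lt_irrefl _)
    · rw [h] at h3; linarith
    · rw [h3, h] at h1; exact absurd h1 (lt_irrefl _)
    · rw [← h] at h3; linarith
  have hnotE : ∀ d ∈ p.darts, d.snd ∉ E₁ ∧ d.fst ∉ E₂ := fun d hd => by
    have h1 := hdec d hd
    have h2 := D.le_outer d.fst
    have h3 := D.inner_le d.snd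
    exact ⟨fun h => by have := D.sol.outer _ h; linarith,
      fun h => by have := D.sol.inner _ h; linarith⟩
  have hbdry : (∃ w, T.boundaryGraph.Adj v w) ↔ v ∈ E₁ ∨ v ∈ E₂ := (D.annulus.boundary v).symm
  -- the edge of the slit that arrives at `v`, or the outside
  obtain ⟨o₀, ho₀, ho₀s⟩ : ∃ o₀ : Option V, (∀ d ∈ p.darts, d.snd = v → o₀ = some d.fst) ∧
      ((o₀ = none ∧ v ∈ E₁) ∨ ∃ d ∈ p.darts, d.snd = v ∧ o₀ = some d.fst) := by
    by_cases h : ∃ d ∈ p.darts, d.snd = v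
    · obtain ⟨d, hd, hdv⟩ := h
      exact ⟨some d.fst, fun d' hd' h' => by rw [hsnd d hd d' hd' (hdv.trans h'.symm)],
        Or.inr ⟨d, hd, hdv, rfl⟩⟩
    · refine ⟨none, fun d hd hdv => absurd ⟨d, hd, hdv⟩ h, Or.inl ⟨rfl, ?_⟩⟩
      obtain ⟨d, hd, rfl | hdv⟩ := hv
      · rcases Walk.fst_eq_or p d hd with h1 | h1
        · rw [h1]; exact hp.start_mem
        · exact absurd h1 h
      · exact absurd ⟨d, hd, hdv⟩ h
  -- the edge of the slit that leaves `v`, or the outside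
  obtain ⟨o₁, ho₁, ho₁s⟩ : ∃ o₁ : Option V, (∀ d ∈ p.darts, d.fst = v → o₁ = some d.snd) ∧
      ((o₁ = none ∧ v ∈ E₂) ∨ ∃ d ∈ p.darts, d.fst = v ∧ o₁ = some d.snd) := by
    by_cases h : ∃ d ∈ p.darts, d.fst = v
    · obtain ⟨d, hd, hdv⟩ := h
      exact ⟨some d.snd, fun d' hd' h' => by rw [hfst d hd d' hd' (hdv.trans h'.symm)],
        Or.inr ⟨d, hd, hdv, rfl⟩⟩
    · refine ⟨none, fun d hd hdv => absurd ⟨d, hd, hdv⟩ h, Or.inl ⟨rfl, ?_⟩⟩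
      obtain ⟨d, hd, hdv | rfl⟩ := hv
      · exact absurd ⟨d, hd, hdv⟩ h
      · rcases Walk.snd_eq_or p d hd with h1 | h1
        · rw [h1]; exact hp.end_mem
        · exact absurd h1 h
  have hm₀ : o₀ ∈ T.linkSet v := by
    rcases ho₀s with ⟨rfl, h⟩ | ⟨d, hd, rfl, rfl⟩
    · exact Or.inr ⟨rfl, hbdry.2 (Or.inl h)⟩
    · exact Or.inl ⟨_, rfl, d.adj.symm⟩
  have hm₁ : o₁ ∈ T.linkSet v := by
    rcases ho₁s with ⟨rfl, h⟩ | ⟨d, hd, rfl, rfl⟩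
    · exact Or.inr ⟨rfl, hbdry.2 (Or.inr h)⟩
    · exact Or.inl ⟨_, rfl, d.adj⟩
  have hdisj : v ∈ E₁ → v ∈ E₂ → False := fun h h' =>
    Finset.disjoint_left.1 D.annulus.disjoint h h'
  have hslit : ∀ w, s(v, w) ∈ p.edges ↔ (some w = o₀ ∨ some w = o₁) := by
    intro w
    rw [Walk.mem_edges_iff]
    constructor
    · rintro ⟨d, hd, ⟨h1, h2⟩ | ⟨h1, h2⟩⟩
      · right; rw [ho₁ d hd h1, h2]
      · left; rw [ho₀ d hd h2, h1]
    · rintro (h | h)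
      · rcases ho₀s with ⟨h1, -⟩ | ⟨d, hd, h1, h2⟩
        · rw [h1] at h; simp at h
        · rw [h2] at h
          exact ⟨d, hd, Or.inr ⟨by simpa using h.symm, h1⟩⟩
      · rcases ho₁s with ⟨h1, -⟩ | ⟨d, hd, h1, h2⟩
        · rw [h1] at h; simp at h
        · rw [h2] at h
          exact ⟨d, hd, Or.inl ⟨h1, by simpa using h.symm⟩⟩
  have hnone : none ∈ T.linkSet v → none = o₀ ∨ none = o₁ := by
    rintro (⟨a, h, -⟩ | ⟨-, h⟩)
    · simp at h
    · rcases hbdry.1 h with h | h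
      · left
        rcases ho₀s with ⟨h1, -⟩ | ⟨d, hd, rfl, -⟩
        · exact h1.symm
        · exact absurd h (hnotE d hd).1
      · right
        rcases ho₁s with ⟨h1, -⟩ | ⟨d, hd, rfl, -⟩
        · exact h1.symm
        · exact absurd h (hnotE d hd).2
  obtain ⟨pos, h0, hinj, hlt, hstep, hlast⟩ := D.exists_link_position v hm₀
  have hmem : ∀ {a b : V}, T.tri v a b → some a ∈ T.linkSet v := fun h =>
    Or.inl ⟨_, rfl, adj_of_tri h⟩
  have hmem' : ∀ {a b : V}, T.tri v a b → some b ∈ T.linkSet v := fun h =>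
    Or.inl ⟨_, rfl, adj_of_tri' h⟩
  -- the upper part of the link, in which the vertices at the level of `v` and the outside are
  -- included at the outer boundary only
  let up : Option V → Prop := fun o => match o with
    | none => v ∈ E₁
    | some a => g v < g a ∨ (v ∉ E₂ ∧ g v = g a)
  have hup₀ : up o₀ := by
    rcases ho₀s with ⟨rfl, h⟩ | ⟨d, hd, rfl, rfl⟩
    · exact h
    · exact Or.inl (hdec d hd)
  have hup₁ : ¬ up o₁ := by
    rcases ho₁s with ⟨rfl, h⟩ | ⟨d, hd, rfl, rfl⟩
    · exact fun h' => hdisj h' h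
    · rintro (h | h)
      · exact absurd (hdec d hd) h.le.not_gt
      · exact absurd (hdec d hd) h.2.le.not_gt
  have hE : ∀ {a}, T.graph.Adj v a → g a = g v → v ∈ E₁ ∨ v ∈ E₂ := fun h ha =>
    hbdry.1 ⟨_, D.ne_of_adj _ _ h ha.symm⟩
  have hdown : ∀ o o', T.LinkNext v o o' → up o → ¬ up o' → ∃ a b, o = some a ∧ o' = some b ∧
      T.tri v a b ∧ g b ≤ g v ∧ g v ≤ g a := by
    rintro (_ | a) (_ | b) h hu hu'
    · exact h.elim
    · have := (D.start_iff.1 h).2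
      exact absurd (Or.inr ⟨fun h' => hdisj hu h', this.symm⟩) hu'
    · have := (D.end_iff.1 h).2
      refine absurd ((hE h.1 this).resolve_right ?_) hu'
      rcases hu with hu | hu
      · exact absurd this hu.ne'
      · exact hu.1
    · refine ⟨a, b, rfl, rfl, h, not_lt.1 fun h' => hu' (Or.inl h'), ?_⟩
      rcases hu with hu | hu
      · exact hu.le
      · exact hu.2.le
  have hrise : ∀ o o', T.LinkNext v o o' → ¬ up o → up o' → ∃ a b, o = some a ∧ o' = some b ∧
      T.tri v a b ∧ g a ≤ g v ∧ g v ≤ g b := by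
    rintro (_ | a) (_ | b) h hu hu'
    · exact h.elim
    · have := (D.start_iff.1 h).2
      refine absurd ((hE h.1 this).resolve_right ?_) hu
      rcases hu' with hu' | hu'
      · exact absurd this hu'.ne'
      · exact hu'.1
    · have := (D.end_iff.1 h).2
      exact absurd (Or.inr ⟨fun h' => hdisj hu' h', this.symm⟩) hu
    · refine ⟨a, b, rfl, rfl, h, not_lt.1 fun h' => hu (Or.inl h'), ?_⟩
      rcases hu' with hu' | hu'
      · exact hu'.le
      · exact hu'.2.le
  have hsucc : ∀ o ∈ T.linkSet v, ∃ o' ∈ T.linkSet v, T.LinkNext v o o' := by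
    rintro o (⟨a, rfl, ha⟩ | ⟨rfl, w, hw⟩)
    · by_cases h : ∃ b, T.tri v a b
      · obtain ⟨b, hb⟩ := h
        exact ⟨some b, hmem' hb, hb⟩
      · exact ⟨none, Or.inr ⟨rfl, a, boundary_of_no_succ ha h⟩, ha, h⟩
    · obtain ⟨a, e, hae, ha⟩ := D.exists_start hw
      exact ⟨some a, hmem hae, D.start_iff.2 ⟨⟨e, hae⟩, ha⟩⟩
  have hpos₁ : 0 < pos o₁ := by
    refine Nat.pos_of_ne_zero fun h => hup₁ ?_
    rw [hinj hm₁ hm₀ (h.trans h0.symm)]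
    exact hup₀
  -- walking from the arriving to the leaving slit edge, one passes the out-going corner
  have hout : ∀ a b, T.tri v a b → g b ≤ g v → g v ≤ g a → pos (some a) < pos o₁ := by
    intro a b hab hb ha
    by_contra! hcon
    have hall : ∀ j, j ≤ pos o₁ → ∃ o ∈ T.linkSet v, pos o = j ∧ up o := by
      intro j
      induction j with
      | zero => exact fun _ => ⟨o₀, hm₀, h0, hup₀⟩
      | succ j ih =>
        intro hj
        obtain ⟨o, ho, rfl, hu⟩ := ih (by omega)
        obtain ⟨o', ho', hoo'⟩ := hsucc o ho
        have hpo : pos o' = pos o + 1 := hstep o ho o' hoo' fun h => by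
          have := hlast o ho (h ▸ hoo')
          have := hlt o₁ hm₁
          omega
        refine ⟨o', ho', hpo, by_contra fun hu' => ?_⟩
        obtain ⟨a', b', rfl, rfl, hab', hb', ha'⟩ := hdown o o' hoo' hu hu'
        rw [(D.regular.out_unique hab hb ha hab' hb' ha').1] at hcon
        omega
    obtain ⟨o, ho, hpo, hu⟩ := hall _ le_rfl
    exact hup₁ (hinj ho hm₁ hpo ▸ hu)
  have hin : ∀ a b, T.tri v a b → g a ≤ g v → g v ≤ g b → pos o₁ ≤ pos (some a) := by
    intro a b hab ha hb
    by_contra! hcon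
    have hall : ∀ j, pos o₁ + j < (T.linkSet v).ncard →
        ∃ o ∈ T.linkSet v, pos o = pos o₁ + j ∧ ¬ up o := by
      intro j
      induction j with
      | zero => exact fun _ => ⟨o₁, hm₁, rfl, hup₁⟩
      | succ j ih =>
        intro hj
        obtain ⟨o, ho, hpo, hu⟩ := ih (by omega)
        obtain ⟨o', ho', hoo'⟩ := hsucc o ho
        have hpo' : pos o' = pos o + 1 := hstep o ho o' hoo' fun h => by
          have := hlast o ho (h ▸ hoo')
          omega
        refine ⟨o', ho', by omega, fun hu' => ?_⟩
        obtain ⟨a', b', rfl, rfl, hab', ha', hb'⟩ := hrise o o' hoo' hu hu'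
        rw [(D.regular.in_unique hab ha hb hab' ha' hb').1] at hcon
        omega
    have hlt₁ := hlt o₁ hm₁
    obtain ⟨o, ho, hpo, hu⟩ := hall ((T.linkSet v).ncard - 1 - pos o₁) (by omega)
    obtain ⟨o', ho', hoo'⟩ := hsucc o ho
    have heq : o' = o₀ := by
      by_contra h
      have := hstep o ho o' hoo' h
      have := hlt o' ho'
      omega
    obtain ⟨a', b', rfl, -, hab', ha', hb'⟩ := hrise o o' hoo' hu (heq ▸ hup₀)
    rw [(D.regular.in_unique hab ha hb hab' ha' hb').1] at hcon
    omega
  refine ⟨fun a _ => pos (some a) < pos o₁, ?_, hout, fun a b h ha hb => (hin a b h ha hb).not_gt,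
    ?_, ?_, ?_, ?_, ?_⟩
  · intro a b b' h h' hs
    rw [hslit, not_or] at hs
    have h1 := hstep _ (hmem h) (some b) h (fun hb => hs.1 hb)
    have h2 : pos (some b) ≠ pos o₁ := fun h3 => hs.2 (hinj (hmem' h) hm₁ h3)
    simp only
    omega
  · intro d hd hdv e h
    rw [← ho₀ d hd hdv, h0]
    exact hpos₁
  · intro d hd hdv e h
    have h1 := ho₁ d hd hdv
    rw [hstep _ (hmem h) o₁ (h1 ▸ h) fun h2 => by rw [h2, h0] at hpos₁; omega]
    omega
  · intro d hd hdv e h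
    have h1 := hlast _ (hmem h) (ho₀ d hd hdv ▸ h)
    have h2 := hlt o₁ hm₁
    simp only
    omega
  · intro d hd hdv e h
    simp only
    rw [ho₁ d hd hdv]
    exact lt_irrefl _
  · intro β φ hφ
    have key : ∀ a b a' b', T.tri v a b → T.tri v a' b' → pos (some a) ≤ pos (some a') →
        (pos (some a) < pos o₁ ↔ pos (some a') < pos o₁) → φ a b = φ a' b' := by
      intro a b a' b' h h' hle hside
      refine D.corner_range hinj hlt hstep hlast hφ h h' hle fun o ho h1 h2 => ?_
      have n₀ : o ≠ o₀ := fun h => by rw [h, h0] at h1; omega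
      have n₁ : o ≠ o₁ := fun h => by rw [h] at h1 h2; omega
      rcases ho with ⟨w, rfl, -⟩ | ⟨rfl, hb⟩
      · exact ⟨w, rfl, fun hs => ((hslit w).1 hs).elim n₀ n₁⟩
      · exact ((hnone (Or.inr ⟨rfl, hb⟩)).elim n₀ n₁).elim
    intro a b a' b' h h' hside
    rcases le_total (pos (some a)) (pos (some a')) with hle | hle
    · exact key _ _ _ _ h h' hle hside
    · exact (key _ _ _ _ h' h hle hside.symm).symm

end DirichletData

end OrientedTriangulation

namespace OrientedTriangulation

/-! ### The two copies of the slit -/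

/-- `n` is the point at level `s` of an edge of the slit. -/
def IsSlitNode {V : Type*} [Fintype V] [DecidableEq V] {T : OrientedTriangulation V} {x y : V}
    (p : T.graph.Walk x y) (g : V → ℝ) (s : ℝ) (n : V → ℝ) : Prop :=
  ∃ d ∈ p.darts, g d.snd ≤ s ∧ s ≤ g d.fst ∧ n = edgePoint g d.snd d.fst s

variable {V : Type*} [Fintype V] [DecidableEq V] {T : OrientedTriangulation V}
  {E₁ E₂ : Finset V} {c : V → V → ℝ} {k : ℝ} {g : V → ℝ} {x y : V} {p : T.graph.Walk x y}

lemma IsSlit.mem_nodes (hp : T.IsSlit E₁ E₂ g p) {s : ℝ} {n : V → ℝ}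
    (h : IsSlitNode p g s n) : n ∈ T.nodes g s := by
  obtain ⟨d, hd, h0, h1, h2⟩ := h
  exact ⟨d.snd, d.fst, d.adj.symm, hp.decreasing d hd, h0, h1, h2⟩

lemma IsSlit.slitNode_unique (hp : T.IsSlit E₁ E₂ g p) {s : ℝ} {n n' : V → ℝ}
    (h : IsSlitNode p g s n) (h' : IsSlitNode p g s n') : n = n' := by
  obtain ⟨d, hd, h0, h1, rfl⟩ := h
  obtain ⟨d', hd', h0', h1', rfl⟩ := h'
  have hdec := hp.decreasing
  rcases Walk.dart_trichotomy p hdec d hd d' hd' with h3 | (h3 | h3) | (h3 | h3)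
  · rw [h3]
  · have : g d.snd = s := le_antisymm h0 (h3 ▸ h1')
    have h4 : g d'.fst = s := by rw [h3, this]
    rw [← this, edgePoint_self_left, this, ← h4, edgePoint_self_right (hdec d' hd').ne, h3]
  · linarith
  · have : g d'.snd = s := le_antisymm h0' (h3 ▸ h1)
    have h4 : g d.fst = s := by rw [h3, this]
    rw [← this, edgePoint_self_left, this, ← h4, edgePoint_self_right (hdec d hd).ne, h3]
  · linarith

namespace DirichletData

lemma exists_slitNode (D : T.DirichletData E₁ E₂ c k g) (hp : T.IsSlit E₁ E₂ g p) {s : ℝ}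
    (h0 : 0 ≤ s) (hk : s ≤ k) : ∃ n, IsSlitNode p g s n := by
  have hx := D.sol.outer x hp.start_mem
  have hy := D.sol.inner y hp.end_mem
  rcases h0.eq_or_lt with rfl | h0
  · obtain ⟨d, hd, h1, h2⟩ := Walk.exists_dart_le p (g := g) (s := 0) hy.le (by
      rw [hx]; exact D.k_pos)
    exact ⟨_, d, hd, h1, h2.le, rfl⟩
  · obtain ⟨d, hd, h1, h2⟩ := Walk.exists_dart_lt p (g := g) (s := s) (hy ▸ h0) (hx ▸ hk)
    exact ⟨_, d, hd, h1.le, h2, rfl⟩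

/-- Outside the slit, nothing is cut. -/
lemma pt_eq_of_not_slitNode (D : T.DirichletData E₁ E₂ c k g) (hp : T.IsSlit E₁ E₂ g p) {s : ℝ}
    {n : V → ℝ} (hn : n ∈ T.nodes g s) (hs : ¬ IsSlitNode p g s n) {f f' : Finset V}
    (h : T.Mem f n) (h' : T.Mem f' n) : pt p h = pt p h' := by
  rcases nodes_cases hn with ⟨v, rfl, rfl⟩ | ⟨w, u, hadj, hw, hu, rfl⟩
  · have hv : ∀ w, s(v, w) ∉ p.edges := by
      intro w hw
      rw [Walk.mem_edges_iff] at hw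
      obtain ⟨d, hd, ⟨rfl, -⟩ | ⟨-, rfl⟩⟩ := hw
      · exact hs ⟨d, hd, (hp.decreasing d hd).le, le_rfl,
          (edgePoint_self_right (hp.decreasing d hd).ne).symm⟩
      · exact hs ⟨d, hd, le_rfl, (hp.decreasing d hd).le, (edgePoint_self_left _ _ _).symm⟩
    obtain ⟨a, b, hab, rfl⟩ := h.exists_corner
    obtain ⟨a', b', hab', rfl⟩ := h'.exists_corner
    have key := D.corner_of_not_slit (p := p) hv
      (φ := fun a b => {q | ∃ h : T.Mem {v, a, b} (Pi.single v 1), q = pt p h})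
      (fun a b b' h1 h2 h3 => by
        have m1 : T.Mem {v, a, b} (Pi.single v 1) := mem_single (face_mem h1) (by simp)
        have m2 : T.Mem {v, b, b'} (Pi.single v 1) := mem_single (face_mem h2) (by simp)
        have := pt_glue (p := p) h2 (T.rotate (T.rotate h1)) rfl
          (by ext; simp; tauto) h3 m2 m1
        ext q
        exact ⟨fun ⟨_, hq⟩ => ⟨m2, hq.trans this.symm⟩, fun ⟨_, hq⟩ => ⟨m1, hq.trans this⟩⟩)
      hab hab'
    have h1 : pt p h ∈ {q | ∃ h : T.Mem {v, a, b} (Pi.single v 1), q = pt p h} := ⟨h, rfl⟩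
    rw [key] at h1
    exact h1.2
  · have he : s(w, u) ∉ p.edges := by
      intro he
      rw [Walk.mem_edges_iff] at he
      obtain ⟨d, hd, ⟨rfl, rfl⟩ | ⟨rfl, rfl⟩⟩ := he
      · have := hp.decreasing d hd
        linarith
      · exact hs ⟨d, hd, hw.le, hu.le, rfl⟩
    rcases h.exists_side hw hu with ⟨e, h1, rfl⟩ | ⟨e, h1, rfl⟩ <;>
      rcases h'.exists_side hw hu with ⟨e', h1', rfl⟩ | ⟨e', h1', rfl⟩
    · obtain rfl := T.unique h1 h1'; rfl
    · exact pt_glue h1 h1' rfl rfl he h h'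
    · exact pt_glue h1 h1' rfl rfl (by rwa [Sym2.eq_swap]) h h'
    · obtain rfl := T.unique h1 h1'; rfl

/-- The triangles at a point `n` of the slit fall into those glued to the base, which satisfy
`side`, and those glued to the top. -/
structure IsFaceSide (p : T.graph.Walk x y) (g : V → ℝ) (n : V → ℝ) (side : Finset V → Prop) :
    Prop where
  glue : ∀ z z' : T.FacePoint, T.Glue p z z' → z.wt = n → (side z.face ↔ side z'.face)
  pt_eq : ∀ {f f' : Finset V} (h : T.Mem f n) (h' : T.Mem f' n), (side f ↔ side f') →
    pt p h = pt p h'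
  out : ∀ {f : Finset V} {n' : V → ℝ}, T.Mem f n → T.Mem f n' → T.FaceAhead g f n n' → side f
  inc : ∀ {f : Finset V} {n' : V → ℝ}, T.Mem f n → T.Mem f n' → T.FaceAhead g f n' n → ¬ side f
  base : ∀ d ∈ p.darts, ∀ e, T.tri d.snd d.fst e → T.Mem {d.snd, d.fst, e} n → n e = 0 →
    side {d.snd, d.fst, e}
  top : ∀ d ∈ p.darts, ∀ e, T.tri d.fst d.snd e → T.Mem {d.fst, d.snd, e} n → n e = 0 →
    ¬ side {d.fst, d.snd, e}

lemma exists_faceSide_vertex (D : T.DirichletData E₁ E₂ c k g) (hp : T.IsSlit E₁ E₂ g p) {v : V}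
    (hv : ∃ d ∈ p.darts, d.fst = v ∨ d.snd = v) :
    ∃ side, IsFaceSide p g (Pi.single v 1) side := by
  obtain ⟨side, hinv, hout, hin, hb1, hb2, ht1, ht2, hcl⟩ := D.exists_corner_side hp hv
  have hiff : ∀ {a b}, T.tri v a b →
      ((∃ a' b', T.tri v a' b' ∧ ({v, a, b} : Finset V) = {v, a', b'} ∧ side a' b') ↔
        side a b) := by
    intro a b hab
    refine ⟨?_, fun h => ⟨a, b, hab, rfl, h⟩⟩
    rintro ⟨a', b', h1, h2, h3⟩
    rcases tri_rotation_of_face_eq h1 hab h2 with ⟨-, rfl, rfl⟩ | ⟨h4, -, -⟩ | ⟨h4, -, -⟩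
    · exact h3
    · exact absurd h4 (T.ne h1)
    · exact absurd h4.symm (tri_ne_trd h1)
  have hcases : ∀ {a b : V}, (∀ u, u ≠ a → u ≠ b → (Pi.single v 1 : V → ℝ) u = 0) →
      v = a ∨ v = b := fun {a b} h => by
    by_contra! hcon
    simpa using h v hcon.1 hcon.2
  have hrot : ∀ a b e : V, ({a, b, e} : Finset V) = {b, e, a} := fun a b e => by
    ext; simp; tauto
  refine ⟨fun f => ∃ a b, T.tri v a b ∧ f = {v, a, b} ∧ side a b, ⟨?_, ?_, ?_, ?_, ?_, ?_⟩⟩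
  · intro z z' hg hz
    obtain ⟨a, b, e, e', h1, h2, hf, hf', hs, hwt, hsupp⟩ := hg.exists_tri
    rw [hf, hf']
    rw [hz] at hsupp
    rcases hcases hsupp with rfl | rfl
    · have h2' := T.rotate h2
      rw [hrot b, hiff h1, hiff h2']
      exact (hinv _ _ _ h2' h1 hs).symm
    · have h1' := T.rotate h1
      rw [hrot a, hiff h1', hiff h2]
      exact hinv _ _ _ h1' h2 (by rwa [Sym2.eq_swap])
  · intro f f' h h' hside
    obtain ⟨a, b, hab, rfl⟩ := h.exists_corner
    obtain ⟨a', b', hab', rfl⟩ := h'.exists_corner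
    rw [hiff hab, hiff hab'] at hside
    have key := hcl _ (fun a b => {q | ∃ h : T.Mem {v, a, b} (Pi.single v 1), q = pt p h})
      (fun a b b' h1 h2 h3 => by
        have m1 : T.Mem {v, a, b} (Pi.single v 1) := mem_single (face_mem h1) (by simp)
        have m2 : T.Mem {v, b, b'} (Pi.single v 1) := mem_single (face_mem h2) (by simp)
        have := pt_glue (p := p) h2 (T.rotate (T.rotate h1)) rfl
          (by ext; simp; tauto) h3 m2 m1
        ext q
        exact ⟨fun ⟨_, hq⟩ => ⟨m2, hq.trans this.symm⟩, fun ⟨_, hq⟩ => ⟨m1, hq.trans this⟩⟩)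
      _ _ _ _ hab hab' hside
    have h1 : pt p h ∈ {q | ∃ h : T.Mem {v, a, b} (Pi.single v 1), q = pt p h} := ⟨h, rfl⟩
    rw [key] at h1
    exact h1.2
  · intro f n' h h' hA
    obtain ⟨a, b, hab, rfl, h1, h2⟩ := hA.corner h h'
    exact (hiff hab).2 (hout a b hab h1 h2)
  · intro f n' h h' hA
    obtain ⟨a, b, hab, rfl, h1, h2⟩ := hA.corner_in h h'
    exact fun hs => hin a b hab h1 h2 ((hiff hab).1 hs)
  · intro d hd e h hm he
    rcases hcases (a := d.snd) (b := d.fst) (fun u h1 h2 => by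
      by_cases hu : u = e
      · rwa [hu]
      · exact hm.2.2 u (by simp [h1, h2, hu])) with rfl | rfl
    · exact (hiff h).2 (hb1 d hd rfl e h)
    · rw [hrot]
      exact (hiff (T.rotate h)).2 (hb2 d hd rfl e (T.rotate h))
  · intro d hd e h hm he
    rcases hcases (a := d.fst) (b := d.snd) (fun u h1 h2 => by
      by_cases hu : u = e
      · rwa [hu]
      · exact hm.2.2 u (by simp [h1, h2, hu])) with rfl | rfl
    · rw [hiff h]
      exact ht2 d hd rfl e h
    · rw [hrot, hiff (T.rotate h)]
      exact ht1 d hd rfl e (T.rotate h)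

lemma faceSide_edge (hp : T.IsSlit E₁ E₂ g p) {d : T.graph.Dart} (hd : d ∈ p.darts)
    {s : ℝ} (hw : g d.snd < s) (hu : s < g d.fst) :
    IsFaceSide p g (edgePoint g d.snd d.fst s)
      (fun f => ∃ e, T.tri d.snd d.fst e ∧ f = {d.snd, d.fst, e}) := by
  have hdis : ∀ {e e'}, T.tri d.snd d.fst e → T.tri d.fst d.snd e' →
      ({d.fst, d.snd, e'} : Finset V) ≠ {d.snd, d.fst, e} := by
    intro e e' h h' hf
    rcases tri_rotation_of_face_eq h h' hf with ⟨h1, -, -⟩ | ⟨-, h1, h2⟩ | ⟨h1, h2, -⟩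
    · exact T.ne h h1.symm
    · exact tri_ne_trd h h1.symm
    · exact tri_ne_snd h h1
  have hsnd : edgePoint g d.snd d.fst s d.snd ≠ 0 := by
    rw [edgePoint_fst d.adj.symm.ne, sub_ne_zero]
    intro h
    rw [eq_comm, div_eq_iff (by linarith)] at h
    linarith
  have hfst : edgePoint g d.snd d.fst s d.fst ≠ 0 := by
    rw [edgePoint_snd d.adj.symm.ne]
    exact (div_pos (by linarith) (by linarith)).ne'
  refine ⟨?_, ?_, ?_, ?_, ?_, ?_⟩
  · intro z z' hg hz
    obtain ⟨a, b, e, e', h1, h2, hf, hf', hs, hwt, hsupp⟩ := hg.exists_tri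
    rw [hz] at hsupp
    refine absurd ((Walk.mem_edges_iff p).2 ⟨d, hd, ?_⟩) hs
    have h1 : d.fst = a ∨ d.fst = b := by
      by_contra! hcon
      exact hfst (hsupp _ hcon.1 hcon.2)
    have h2 : d.snd = a ∨ d.snd = b := by
      by_contra! hcon
      exact hsnd (hsupp _ hcon.1 hcon.2)
    have h3 := d.adj.ne
    rcases h1 with h1 | h1 <;> rcases h2 with h2 | h2
    · exact absurd (h1.trans h2.symm) h3
    · exact Or.inl ⟨h1, h2⟩
    · exact Or.inr ⟨h1, h2⟩
    · exact absurd (h1.trans h2.symm) h3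
  · intro f f' h h' hside
    rcases h.exists_side hw hu with ⟨e, h1, rfl⟩ | ⟨e, h1, rfl⟩ <;>
      rcases h'.exists_side hw hu with ⟨e', h1', rfl⟩ | ⟨e', h1', rfl⟩
    · obtain rfl := T.unique h1 h1'; rfl
    · obtain ⟨e'', h2, h3⟩ := hside.1 ⟨e, h1, rfl⟩
      exact absurd h3 (hdis h2 h1')
    · obtain ⟨e'', h2, h3⟩ := hside.2 ⟨e', h1', rfl⟩
      exact absurd h3 (hdis h2 h1)
    · obtain rfl := T.unique h1 h1'; rfl
  · intro f n' h h' hA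
    exact hA.tri_of_edge hw hu h h'
  · intro f n' h h' hA
    obtain ⟨e, h1, rfl⟩ := hA.tri_of_edge_in hw hu h h'
    rintro ⟨e', h2, h3⟩
    exact hdis h2 h1 h3
  · intro d' hd' e h hm he
    have hin : ∀ u, edgePoint g d.snd d.fst s u ≠ 0 → u = d'.snd ∨ u = d'.fst := by
      intro u hu
      by_contra! hcon
      by_cases hue : u = e
      · rw [hue] at hu; exact hu he
      · exact hu (hm.2.2 u (by simp [hcon, hue]))
    have h1 := hp.decreasing d hd
    have h2 := hp.decreasing d' hd'
    rcases hin _ hsnd with h3 | h3 <;> rcases hin _ hfst with h4 | h4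
    · rw [h3, h4] at h1; exact absurd h1 (lt_irrefl _)
    · rw [← h3, ← h4] at h ⊢
      exact ⟨e, h, rfl⟩
    · rw [h3, h4] at h1; linarith
    · rw [h3, h4] at h1; exact absurd h1 (lt_irrefl _)
  · intro d' hd' e h hm he
    have hin : ∀ u, edgePoint g d.snd d.fst s u ≠ 0 → u = d'.snd ∨ u = d'.fst := by
      intro u hu
      by_contra! hcon
      by_cases hue : u = e
      · rw [hue] at hu; exact hu he
      · exact hu (hm.2.2 u (by simp [hcon, hue]))
    have h1 := hp.decreasing d hd
    have h2 := hp.decreasing d' hd'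
    rintro ⟨e', h5, h6⟩
    rcases hin _ hsnd with h3 | h3 <;> rcases hin _ hfst with h4 | h4
    · rw [h3, h4] at h1; exact absurd h1 (lt_irrefl _)
    · rw [← h3, ← h4] at h h6
      exact hdis h5 h h6
    · rw [h3, h4] at h1; linarith
    · rw [h3, h4] at h1; exact absurd h1 (lt_irrefl _)

lemma exists_faceSide (D : T.DirichletData E₁ E₂ c k g) (hp : T.IsSlit E₁ E₂ g p) {s : ℝ}
    {n : V → ℝ} (hn : IsSlitNode p g s n) : ∃ side, IsFaceSide p g n side := by
  obtain ⟨d, hd, h0, h1, rfl⟩ := hn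
  rcases h0.eq_or_lt with rfl | h0
  · rw [edgePoint_self_left]
    exact D.exists_faceSide_vertex hp ⟨d, hd, Or.inr rfl⟩
  rcases h1.eq_or_lt with rfl | h1
  · rw [edgePoint_self_right (hp.decreasing d hd).ne]
    exact D.exists_faceSide_vertex hp ⟨d, hd, Or.inl rfl⟩
  exact ⟨_, faceSide_edge hp hd h0 h1⟩

/-- The two points over a point of the slit are different. -/
lemma IsFaceSide.pt_ne {n : V → ℝ} {side : Finset V → Prop} (S : IsFaceSide p g n side)
    {f f' : Finset V} (h : T.Mem f n) (h' : T.Mem f' n) (hf : side f) (hf' : ¬ side f') :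
    pt p h ≠ pt p h' := by
  intro heq
  have hlift : ∀ z z' : T.FacePoint, T.Glue p z z' →
      (z.wt = n ∧ side z.face) = (z'.wt = n ∧ side z'.face) := by
    intro z z' hg
    rw [eq_iff_iff, ← hg.1]
    exact and_congr_right fun hz => S.glue z z' hg hz
  have := congrArg (Quot.lift (fun z : T.FacePoint => z.wt = n ∧ side z.face) hlift) heq
  exact hf' (this.mp ⟨rfl, hf⟩).2

end DirichletData

end OrientedTriangulation

namespace OrientedTriangulation

/-! ### The level curves as chains of segments -/

variable {V : Type*} [Fintype V] [DecidableEq V] {T : OrientedTriangulation V}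
  {E₁ E₂ : Finset V} {c : V → V → ℝ} {k : ℝ} {g : V → ℝ} {x y : V} {p : T.graph.Walk x y}

/-- The level curve of `g` at level `s`, as a chain of `m` segments: the `j`-th segment joins the
nodes `N j` and `N (j + 1)` in the triangle `F j`. The first and the last node are the two copies
of the point of the slit at this level. -/
structure LevelChain (p : T.graph.Walk x y) (g : V → ℝ) (s : ℝ) (m : ℕ) (N : ℕ → V → ℝ)
    (F : ℕ → Finset V) : Prop where
  pos : 0 < m
  nodes : ∀ j, N j ∈ T.nodes g s
  mem_left : ∀ j < m, T.Mem (F j) (N j)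
  mem_right : ∀ j < m, T.Mem (F j) (N (j + 1))
  ahead : ∀ j < m, T.FaceAhead g (F j) (N j) (N (j + 1))
  slit : IsSlitNode p g s (N 0)
  last : N m = N 0
  inj : ∀ i < m, ∀ j < m, N i = N j → i = j
  surj : ∀ n ∈ T.nodes g s, ∃ j < m, N j = n

/-- `q` is the point with the parameter `r` of the `j`-th segment of a chain. -/
def OnSegment (p : T.graph.Walk x y) (m : ℕ) (N : ℕ → V → ℝ) (F : ℕ → Finset V) (j : ℕ) (r : ℝ)
    (q : T.SlitAnnulus p) : Prop :=
  j < m ∧ 0 ≤ r ∧ r ≤ 1 ∧ ∃ h : T.Mem (F j) ((1 - r) • N j + r • N (j + 1)), q = pt p h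

lemma DirichletData.exists_levelChain (D : T.DirichletData E₁ E₂ c k g)
    (hp : T.IsSlit E₁ E₂ g p) {s : ℝ} (h0 : 0 ≤ s) (hk : s ≤ k) :
    ∃ m N F, LevelChain p g s m N F := by
  have R := D.regular
  obtain ⟨n₀, hn₀⟩ := D.exists_slitNode hp h0 hk
  have hm₀ := hp.mem_nodes hn₀
  obtain ⟨pos, p0, pinj, plt, pstep, plast⟩ := exists_cyclic_position (finite_nodes (T := T) s)
    (R := T.Next g s) (fun n hn => (R.exists_next hn).imp fun n' h => ⟨h.2.1, h⟩)
    (fun _ _ _ => R.next_unique) (fun _ _ _ => R.prev_unique) (D.nodesConnected h0 hk) hm₀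
  choose! τ hτ using fun n (hn : n ∈ T.nodes g s) => R.exists_next hn
  set m := (T.nodes g s).ncard with hm
  have hmem : ∀ i, τ^[i] n₀ ∈ T.nodes g s := fun i => by
    induction i with
    | zero => exact hm₀
    | succ i ih => rw [Function.iterate_succ_apply']; exact (hτ _ ih).2.1
  have hnext : ∀ i, T.Next g s (τ^[i] n₀) (τ^[i + 1] n₀) := fun i => by
    rw [Function.iterate_succ_apply']; exact hτ _ (hmem i)
  have hpos : ∀ i < m, pos (τ^[i] n₀) = i := by
    intro i
    induction i with
    | zero => exact fun _ => p0
    | succ i ih =>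
      intro hi
      have h1 := ih (by omega)
      rw [pstep _ (hmem i) _ (hnext i) fun h => ?_, h1]
      have h2 := hnext i
      rw [h] at h2
      have := plast _ (hmem i) h2
      omega
  have hpm : 0 < m := p0 ▸ plt n₀ hm₀
  have hlast : τ^[m] n₀ = n₀ := by
    by_contra hcon
    obtain ⟨i, hi⟩ : ∃ i, m = i + 1 := ⟨m - 1, by omega⟩
    rw [hi] at hcon
    have h1 := pstep _ (hmem i) _ (hnext i) hcon
    rw [hpos i (by omega)] at h1
    have h2 := plt _ (hmem (i + 1))
    omega
  choose F hF using fun i => (hnext i).2.2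
  refine ⟨m, fun i => τ^[i] n₀, F, hpm, hmem, fun i _ => (hF i).1, fun i _ => (hF i).2.1,
    fun i _ => (hF i).2.2, hn₀, hlast, fun i hi j hj hij => ?_, fun n hn => ?_⟩
  · rw [← hpos i hi, ← hpos j hj]
    exact congrArg pos hij
  · exact ⟨pos n, plt n hn, pinj (hmem _) hn (hpos _ (plt n hn))⟩

lemma combo_injective {n n' : V → ℝ} (h : n ≠ n') {r r' : ℝ}
    (hr : (1 - r) • n + r • n' = (1 - r') • n + r' • n') : r = r' := by
  have h1 : (r - r') • (n' - n) = 0 := by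
    have := sub_eq_zero.2 hr
    rw [← this]
    module
  exact sub_eq_zero.1 ((smul_eq_zero.1 h1).resolve_right (sub_ne_zero.2 h.symm))

lemma Regular.single_mem_nodes (R : T.Regular g) {v a b : V} (h : T.tri v a b) :
    Pi.single v 1 ∈ T.nodes g (g v) := by
  by_cases ha : g v = g a
  · have hb : g v ≠ g b := fun hb => R.not_const h ⟨ha, ha.symm.trans hb⟩
    rw [← edgePoint_self_left g v b]
    exact edgePoint_mem_nodes (adj_of_tri' h) hb (by simpa using le_total (g v) (g b))
  · rw [← edgePoint_self_left g v a]
    exact edgePoint_mem_nodes (adj_of_tri h) ha (by simpa using le_total (g v) (g a))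

/-- Only nodes are common to several triangles. -/
lemma Regular.face_unique (R : T.Regular g) {n : V → ℝ} (hn : n ∉ T.nodes g (level g n))
    {f f' : Finset V} (h : T.Mem f n) (h' : T.Mem f' n) : f = f' := by
  have hfaces : ∀ {f}, f ∈ T.faces → f.card = 3 := by
    rintro _ ⟨a, b, e, h, rfl⟩
    rw [Finset.card_eq_three]
    exact ⟨a, b, e, T.ne h, (tri_ne_trd h).symm, tri_ne_snd h, rfl⟩
  have hmem : ∀ {f v}, T.Mem f n → n v ≠ 0 → v ∈ f := fun h hv => by
    by_contra hcon
    exact hv (h.2.2 _ hcon)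
  by_cases hall : ∀ v ∈ f, n v ≠ 0
  · exact Finset.eq_of_subset_of_card_le (fun v hv => hmem h' (hall v hv))
      (by rw [hfaces h.1, hfaces h'.1])
  · push Not at hall
    obtain ⟨e, he, hne⟩ := hall
    obtain ⟨u, v, w, ht, rfl⟩ := h.1
    obtain ⟨a, b, hab, hf⟩ := exists_tri_of_mem ht he
    rw [← hf] at h ⊢
    have hab' := T.rotate hab
    have hsupp : ∀ v, v ≠ a → v ≠ b → n v = 0 := fun v ha hb => by
      by_cases hv : v = e
      · rwa [hv]
      · exact h.2.2 v (by simp [ha, hb, hv])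
    have hsum := h.sum_eq hab
    rw [hne] at hsum
    have hgab : g a = g b := by
      by_contra hgab
      exact hn (mem_nodes_of_support h.2.1 (adj_of_tri hab') hgab hsupp)
    have hvert : ∀ {v q r}, T.tri v q r → n v ≠ 1 := fun {v q r} ht hv => by
      have h1 := eq_single h.2.1 hv
      refine hn ?_
      rw [h1, level_single]
      exact R.single_mem_nodes ht
    have hma := hmem (v := a) h' fun hz => hvert (T.rotate hab') (by linarith)
    have hmb := hmem (v := b) h' fun hz => hvert hab' (by linarith)
    obtain ⟨u', v', w', ht', rfl⟩ := h'.1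
    obtain ⟨q, r, hqr, hf'⟩ := exists_tri_of_mem ht' hma
    rw [← hf'] at hmb ⊢
    simp only [Finset.mem_insert, Finset.mem_singleton] at hmb
    rcases hmb with h1 | h1 | h1
    · exact absurd h1.symm (T.ne hab')
    · rw [← h1] at hqr ⊢
      rw [T.unique hqr hab']
      ext; simp; tauto
    · rw [← h1] at hqr
      exact absurd (T.rotate (T.rotate hqr)) (R.no_opp hab' hgab)

namespace LevelChain

variable {s : ℝ} {m : ℕ} {N : ℕ → V → ℝ} {F : ℕ → Finset V}

lemma ne (L : LevelChain p g s m N F) (R : T.Regular g) {j : ℕ} (hj : j < m) : N j ≠ N (j + 1) :=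
  (L.ahead j hj).ne R.not_const

lemma index_inj (L : LevelChain p g s m N F) {i j : ℕ} (hi : i ∈ Finset.Icc 1 m)
    (hj : j ∈ Finset.Icc 1 m) (h : N i = N j) : i = j := by
  rw [Finset.mem_Icc] at hi hj
  rcases hi.2.lt_or_eq with h1 | rfl <;> rcases hj.2.lt_or_eq with h2 | rfl
  · exact L.inj i h1 j h2 h
  · have := L.inj i h1 0 L.pos (h.trans L.last)
    omega
  · have := L.inj j h2 0 L.pos (h.symm.trans L.last)
    omega
  · rfl

lemma on_left (L : LevelChain p g s m N F) {j : ℕ} (hj : j < m) :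
    OnSegment p m N F j 0 (pt p (L.mem_left j hj)) :=
  ⟨hj, le_rfl, zero_le_one, by simpa using L.mem_left j hj, pt_congr _ _ rfl (by simp)⟩

lemma on_right (L : LevelChain p g s m N F) {j : ℕ} (hj : j < m) :
    OnSegment p m N F j 1 (pt p (L.mem_right j hj)) :=
  ⟨hj, zero_le_one, le_rfl, by simpa using L.mem_right j hj, pt_congr _ _ rfl (by simp)⟩

lemma eq_left (L : LevelChain p g s m N F) {j : ℕ} {q : T.SlitAnnulus p}
    (h : OnSegment p m N F j 0 q) : q = pt p (L.mem_left j h.1) := by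
  obtain ⟨hj, -, -, h, rfl⟩ := h
  exact pt_congr _ _ rfl (by simp)

lemma eq_right (L : LevelChain p g s m N F) {j : ℕ} {q : T.SlitAnnulus p}
    (h : OnSegment p m N F j 1 q) : q = pt p (L.mem_right j h.1) := by
  obtain ⟨hj, -, -, h, rfl⟩ := h
  exact pt_congr _ _ rfl (by simp)

lemma level_segment (L : LevelChain p g s m N F) (j : ℕ) (r : ℝ) :
    level g ((1 - r) • N j + r • N (j + 1)) = s := by
  rw [level_combo, level_of_mem_nodes (L.nodes j), level_of_mem_nodes (L.nodes (j + 1))]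
  ring

lemma extend_eq (L : LevelChain p g s m N F) {j : ℕ} {r : ℝ} {q : T.SlitAnnulus p}
    (h : OnSegment p m N F j r q) : T.extend p g q = s := by
  obtain ⟨-, -, -, h, rfl⟩ := h
  exact L.level_segment j r

lemma bary_eq {j : ℕ} {r : ℝ} {q : T.SlitAnnulus p} (h : OnSegment p m N F j r q) :
    T.bary p q = (1 - r) • N j + r • N (j + 1) := by
  obtain ⟨-, -, -, h, rfl⟩ := h
  rfl

/-- The segments of the chain are all segments at level `s`. -/
lemma exists_segment (L : LevelChain p g s m N F) (R : T.Regular g) {n n' : V → ℝ}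
    {f : Finset V} (hn : n ∈ T.nodes g s) (hn' : n' ∈ T.nodes g s) (h : T.Mem f n)
    (h' : T.Mem f n') (hA : T.FaceAhead g f n n') :
    ∃ j < m, f = F j ∧ n = N j ∧ n' = N (j + 1) := by
  obtain ⟨j, hj, rfl⟩ := L.surj n hn
  exact ⟨j, hj, R.out_face_unique hn h h' hA (L.mem_left j hj) (L.mem_right j hj) (L.ahead j hj),
    rfl, R.next_unique ⟨hn, hn', f, h, h', hA⟩
      ⟨hn, L.nodes _, F j, L.mem_left j hj, L.mem_right j hj, L.ahead j hj⟩⟩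

lemma exists_segment_of_cell (L : LevelChain p g s m N F) (R : T.Regular g) {a b e : V}
    {t₀ t₁ : ℝ} (C : T.Cell g a b e t₀ t₁) (h0 : t₀ ≤ s) (h1 : s ≤ t₁) (ha : g a ≠ s) :
    ∃ j < m, ({a, b, e} : Finset V) = F j ∧
      ((edgePoint g a b s = N j ∧ edgePoint g a e s = N (j + 1) ∧ g a ≤ t₀) ∨
        (edgePoint g a e s = N j ∧ edgePoint g a b s = N (j + 1) ∧ t₁ ≤ g a)) := by
  rcases C.le_or_ge a with h | h
  · obtain ⟨j, hj, e1, e2, e3⟩ := L.exists_segment R (C.left_mem_nodes h0 h1)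
      (C.right_mem_nodes h0 h1) (C.left_mem h0 h1) (C.right_mem h0 h1) (C.ahead_low h ha h0 h1)
    exact ⟨j, hj, e1, Or.inl ⟨e2, e3, h⟩⟩
  · obtain ⟨j, hj, e1, e2, e3⟩ := L.exists_segment R (C.right_mem_nodes h0 h1)
      (C.left_mem_nodes h0 h1) (C.right_mem h0 h1) (C.left_mem h0 h1) (C.ahead_high h ha h0 h1)
    exact ⟨j, hj, e1, Or.inr ⟨e2, e3, h⟩⟩

lemma eq_first_of_slitNode (L : LevelChain p g s m N F) (hp : T.IsSlit E₁ E₂ g p)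
    {n : V → ℝ} (hn : IsSlitNode p g s n) : n = N 0 := hp.slitNode_unique hn L.slit

lemma not_slitNode (L : LevelChain p g s m N F) (hp : T.IsSlit E₁ E₂ g p) {j : ℕ} (h0 : j ≠ 0)
    (hj : j < m) : ¬ IsSlitNode p g s (N j) := fun h =>
  h0 (L.inj j hj 0 L.pos (L.eq_first_of_slitNode hp h))

lemma exists_faceSide (L : LevelChain p g s m N F) (D : T.DirichletData E₁ E₂ c k g)
    (hp : T.IsSlit E₁ E₂ g p) : ∃ side, DirichletData.IsFaceSide p g (N 0) side ∧
      side (F 0) ∧ ¬ side (F (m - 1)) ∧ T.Mem (F (m - 1)) (N 0) := by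
  obtain ⟨side, S⟩ := D.exists_faceSide hp L.slit
  have hm : m - 1 < m := Nat.sub_lt L.pos one_pos
  have h1 := L.mem_right (m - 1) hm
  have h2 := L.ahead (m - 1) hm
  rw [Nat.sub_add_cancel L.pos, L.last] at h1 h2
  exact ⟨side, S, S.out (L.mem_left 0 L.pos) (L.mem_right 0 L.pos) (L.ahead 0 L.pos),
    S.inc h1 (L.mem_left _ hm) h2, h1⟩

lemma on_last (L : LevelChain p g s m N F) (h : T.Mem (F (m - 1)) (N 0)) :
    OnSegment p m N F (m - 1) 1 (pt p h) := by
  have hm : m - 1 < m := Nat.sub_lt L.pos one_pos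
  have := L.on_right hm
  rwa [pt_congr (L.mem_right (m - 1) hm) h rfl
    (by rw [Nat.sub_add_cancel L.pos, L.last])] at this

lemma eq_last (L : LevelChain p g s m N F) {j : ℕ} (hj : j + 1 = m) {q : T.SlitAnnulus p}
    (h : OnSegment p m N F j 1 q) (h' : T.Mem (F (m - 1)) (N 0)) : q = pt p h' := by
  rw [L.eq_right h]
  exact pt_congr _ _ (by rw [← hj, Nat.add_sub_cancel]) (by rw [hj, L.last])

lemma exists_onSegment_of_node (L : LevelChain p g s m N F) (D : T.DirichletData E₁ E₂ c k g)
    (hp : T.IsSlit E₁ E₂ g p) {f : Finset V} {n : V → ℝ} (hn : n ∈ T.nodes g s)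
    (h : T.Mem f n) : ∃ j r, OnSegment p m N F j r (pt p h) := by
  by_cases hs : IsSlitNode p g s n
  · obtain rfl := L.eq_first_of_slitNode hp hs
    obtain ⟨side, S, hF, hF', hm⟩ := L.exists_faceSide D hp
    by_cases hf : side f
    · refine ⟨0, 0, ?_⟩
      rw [S.pt_eq h (L.mem_left 0 L.pos) (iff_of_true hf hF)]
      exact L.on_left L.pos
    · refine ⟨m - 1, 1, ?_⟩
      rw [S.pt_eq h hm (iff_of_false hf hF')]
      exact L.on_last hm
  · obtain ⟨j, hj, rfl⟩ := L.surj n hn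
    refine ⟨j, 0, ?_⟩
    rw [D.pt_eq_of_not_slitNode hp hn hs h (L.mem_left j hj)]
    exact L.on_left hj

lemma onSegment_of_cell {a b e : V} {j : ℕ} (hj : j < m) (hf : ({a, b, e} : Finset V) = F j)
    {n : V → ℝ} (h : T.Mem {a, b, e} n) {r : ℝ} (h0 : 0 ≤ r) (h1 : r ≤ 1)
    (hn : n = (1 - r) • N j + r • N (j + 1)) : OnSegment p m N F j r (pt p h) := by
  subst hn
  refine ⟨hj, h0, h1, hf ▸ h, pt_congr _ _ hf rfl⟩

/-- The chain covers its level set. -/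
lemma exists_onSegment (L : LevelChain p g s m N F) (D : T.DirichletData E₁ E₂ c k g)
    (hp : T.IsSlit E₁ E₂ g p) {q : T.SlitAnnulus p} (hq : T.extend p g q = s) :
    ∃ j r, OnSegment p m N F j r q := by
  obtain ⟨f, n, h, rfl⟩ := exists_pt q
  rw [extend_pt] at hq
  by_cases hn : n ∈ T.nodes g s
  · exact L.exists_onSegment_of_node D hp hn h
  obtain ⟨a, b, e, t₀, t₁, rfl, C, h0, h1⟩ := exists_cell D.not_const h
  rw [hq] at h0 h1
  obtain ⟨r, hr0, hr1, hr⟩ := C.exists_combo h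
  rw [hq] at hr
  have ha : g a ≠ s := fun ha => hn (by
    have h2 := C.left_mem_nodes h0 h1
    rw [← C.eq_of_level_apex ha, ← add_smul, sub_add_cancel, one_smul] at hr
    rwa [hr])
  obtain ⟨j, hj, hf, ⟨e1, e2, -⟩ | ⟨e1, e2, -⟩⟩ := L.exists_segment_of_cell D.regular C h0 h1 ha
  · exact ⟨j, r, onSegment_of_cell hj hf h hr0 hr1 (by rw [hr, e1, e2])⟩
  · exact ⟨j, 1 - r, onSegment_of_cell hj hf h (by linarith) (by linarith)
      (by rw [hr, e1, e2, sub_sub_cancel, add_comm])⟩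

lemma node_cases (L : LevelChain p g s m N F) (R : T.Regular g) {j : ℕ} {r : ℝ}
    {q : T.SlitAnnulus p} (h : OnSegment p m N F j r q) (hq : T.bary p q ∈ T.nodes g s) :
    (r = 0 ∧ T.bary p q = N j) ∨ (r = 1 ∧ T.bary p q = N (j + 1)) := by
  obtain ⟨hj, h0, h1, hm, rfl⟩ := h
  rw [bary_pt] at hq ⊢
  by_cases hne : (1 - r) • N j + r • N (j + 1) = N j
  · exact Or.inl ⟨combo_injective (L.ne R hj) (by rw [hne]; simp), hne⟩
  · have := R.node_unique_of_faceAhead (L.nodes j) hq (L.nodes (j + 1)) (L.mem_left j hj) hm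
      (L.mem_right j hj) (Ne.symm hne) (L.ne R hj)
    exact Or.inr ⟨combo_injective (L.ne R hj) (by rw [this]; simp), this⟩

lemma node_index (L : LevelChain p g s m N F) (R : T.Regular g) {j : ℕ} {r : ℝ}
    {q : T.SlitAnnulus p} (h : OnSegment p m N F j r q) (hq : T.bary p q ∈ T.nodes g s) :
    ∃ i : ℕ, i ≤ m ∧ (j : ℝ) + r = i ∧ T.bary p q = N i ∧ (i = 0 → j = 0 ∧ r = 0) ∧
      (i = m → j + 1 = m ∧ r = 1) := by
  have hj := h.1
  rcases L.node_cases R h hq with ⟨rfl, h1⟩ | ⟨rfl, h1⟩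
  · exact ⟨j, hj.le, by simp, h1, fun h => ⟨h, rfl⟩, fun h => absurd h hj.ne⟩
  · exact ⟨j + 1, hj, by simp, h1, fun h => absurd h (Nat.succ_ne_zero j), fun h => ⟨h, rfl⟩⟩

/-- A level curve meets a triangle in one segment. -/
lemma index_of_face_eq (L : LevelChain p g s m N F) (R : T.Regular g) {i j : ℕ} (hi : i < m)
    (hj : j < m) (h : F i = F j) : i = j := by
  have hl := L.mem_left i hi
  have hr := L.mem_right i hi
  have hA := L.ahead i hi
  rw [h] at hl hr hA
  refine L.inj i hi j hj ?_
  by_contra hne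
  have h1 := R.node_unique_of_faceAhead (L.nodes j) (L.nodes i) (L.nodes (j + 1))
    (L.mem_left j hj) hl (L.mem_right j hj) (Ne.symm hne) (L.ne R hj)
  have h2 := R.node_unique_of_faceAhead (L.nodes (j + 1)) (L.nodes j) (L.nodes (i + 1))
    (L.mem_right j hj) (L.mem_left j hj) hr (L.ne R hj).symm (h1 ▸ L.ne R hi)
  rw [h1, ← h2] at hA
  exact ((L.ahead j hj).trans hA).ne R.not_const rfl

/-- A point has only one position on the chain. At the two ends this holds since the two copies
of the point of the slit are different. -/
lemma position_unique (L : LevelChain p g s m N F) (D : T.DirichletData E₁ E₂ c k g)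
    (hp : T.IsSlit E₁ E₂ g p) {j j' : ℕ} {r r' : ℝ} {q : T.SlitAnnulus p}
    (h : OnSegment p m N F j r q) (h' : OnSegment p m N F j' r' q) :
    (j : ℝ) + r = j' + r' := by
  have R := D.regular
  by_cases hq : T.bary p q ∈ T.nodes g s
  · obtain ⟨side, S, hF, hF', hm⟩ := L.exists_faceSide D hp
    have hends : ∀ {j j' : ℕ} {r r' : ℝ}, OnSegment p m N F j r q → OnSegment p m N F j' r' q →
        (j = 0 ∧ r = 0) → (j' + 1 = m ∧ r' = 1) → False := by
      rintro j j' r r' h h' ⟨rfl, rfl⟩ ⟨hj', rfl⟩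
      exact S.pt_ne (L.mem_left 0 L.pos) hm hF hF'
        ((L.eq_left h).symm.trans (L.eq_last hj' h' hm))
    obtain ⟨i, him, hi, hiN, hi0, hil⟩ := L.node_index R h hq
    obtain ⟨i', him', hi', hiN', hi0', hil'⟩ := L.node_index R h' hq
    rw [hi, hi']
    have heq : N i = N i' := hiN.symm.trans hiN'
    rcases him.lt_or_eq with h1 | rfl <;> rcases him'.lt_or_eq with h2 | rfl
    · rw [L.inj i h1 i' h2 heq]
    · rw [L.last] at heq
      exact (hends h h' (hi0 (L.inj i h1 0 L.pos heq)) (hil' rfl)).elim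
    · rw [L.last] at heq
      exact (hends h' h (hi0' (L.inj i' h2 0 L.pos heq.symm)) (hil rfl)).elim
    · rfl
  · have hs := L.extend_eq h
    have hb := bary_eq h
    have hb' := bary_eq h'
    obtain ⟨hj, -, -, hm, rfl⟩ := h
    obtain ⟨hj', -, -, hm', -⟩ := h'
    rw [bary_pt] at hb' hq
    rw [extend_pt] at hs
    rw [← hs] at hq
    rw [← hb'] at hm'
    obtain rfl := L.index_of_face_eq R hj hj' (R.face_unique hq hm hm')
    rw [combo_injective (L.ne R hj) hb']

/-- Consecutive segments are joined. -/
lemma joined (L : LevelChain p g s m N F) (D : T.DirichletData E₁ E₂ c k g)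
    (hp : T.IsSlit E₁ E₂ g p) {j : ℕ} {q q' : T.SlitAnnulus p} (h : OnSegment p m N F j 1 q)
    (h' : OnSegment p m N F (j + 1) 0 q') : q = q' := by
  rw [L.eq_right h, L.eq_left h']
  exact D.pt_eq_of_not_slitNode hp (L.nodes _) (L.not_slitNode hp (Nat.succ_ne_zero j) h'.1) _ _

lemma eq_of_position_eq (L : LevelChain p g s m N F) (D : T.DirichletData E₁ E₂ c k g)
    (hp : T.IsSlit E₁ E₂ g p) {j j' : ℕ} {r r' : ℝ} {q q' : T.SlitAnnulus p}
    (h : OnSegment p m N F j r q) (h' : OnSegment p m N F j' r' q')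
    (heq : (j : ℝ) + r = j' + r') : q = q' := by
  have key : ∀ {j j' : ℕ} {r r' : ℝ} {q q' : T.SlitAnnulus p}, OnSegment p m N F j r q →
      OnSegment p m N F j' r' q' → (j : ℝ) + r = j' + r' → j < j' → q = q' := by
    intro j j' r r' q q' h h' heq hlt
    have h1 : (j : ℝ) + 1 ≤ j' := by exact_mod_cast hlt
    have hr := h.2.2.1
    have hr' := h'.2.1
    have e1 : r = 1 := by linarith
    have e2 : r' = 0 := by linarith
    have e3 : j' = j + 1 := by
      have : (j' : ℝ) = (j + 1 : ℕ) := by push_cast; linarith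
      exact_mod_cast this
    subst e1 e2 e3
    exact L.joined D hp h h'
  rcases lt_trichotomy j j' with hlt | rfl | hlt
  · exact key h h' heq hlt
  · have : r = r' := by linarith
    subst this
    obtain ⟨_, _, _, _, rfl⟩ := h
    obtain ⟨_, _, _, _, rfl⟩ := h'
    rfl
  · exact (key h' h heq.symm hlt).symm

/-- The base point of the level curve. -/
lemma mem_base_iff (L : LevelChain p g s m N F) (D : T.DirichletData E₁ E₂ c k g)
    (hp : T.IsSlit E₁ E₂ g p) {q : T.SlitAnnulus p} :
    OnSegment p m N F 0 0 q ↔ q ∈ T.base p ∧ T.extend p g q = s := by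
  obtain ⟨side, S, hF, -, -⟩ := L.exists_faceSide D hp
  constructor
  · intro h
    refine ⟨?_, L.extend_eq h⟩
    obtain ⟨d, hd, h0, h1, hN⟩ := L.slit
    have hlt := hp.decreasing d hd
    obtain ⟨e, he⟩ := (D.exists_tri_of_adj d.adj.symm hlt.ne).1
    have hm : T.Mem {d.snd, d.fst, e} (N 0) := by
      rw [hN]
      exact mem_edgePoint (face_mem he) (by simp) (by simp) hlt.ne (Or.inl ⟨h0, h1⟩)
    have hz : N 0 e = 0 := by
      rw [hN]; exact edgePoint_of_ne (tri_ne_trd he) (tri_ne_snd he).symm s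
    refine ⟨d, hd, e, ⟨_, hm.1, _, hm.2.1, hm.2.2⟩, he, rfl, hz, ?_⟩
    rw [L.eq_left h, mk_eq_pt _ hm rfl rfl]
    exact S.pt_eq _ _ (iff_of_true hF (S.base d hd e he hm hz))
  · rintro ⟨⟨d, hd, e, z, he, hf, hz, rfl⟩, hs⟩
    have hs' : level g z.wt = s := hs
    have hlt := hp.decreasing d hd
    have hm : T.Mem {d.snd, d.fst, e} z.wt := ⟨hf ▸ z.face_mem, z.wt_mem, hf ▸ z.wt_support⟩
    have h2 := eq_edgePoint z.wt_mem hlt.ne fun v h1 h2 => by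
      by_cases hv : v = e
      · rwa [hv]
      · exact hm.2.2 v (by simp [h1, h2, hv])
    have hsum := hm.sum_eq he
    have hlev := hm.level_eq (g := g) he
    rw [hz] at hsum hlev
    have hN : z.wt = N 0 := by
      refine L.eq_first_of_slitNode hp ⟨d, hd, ?_, ?_, hs' ▸ h2⟩
      · have := mul_nonneg (hm.nonneg d.fst) (sub_nonneg.2 hlt.le)
        have h3 : z.wt d.snd = 1 - z.wt d.fst := by linarith
        rw [← hs', hlev, h3]; linarith
      · have := mul_nonneg (hm.nonneg d.snd) (sub_nonneg.2 hlt.le)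
        have h3 : z.wt d.fst = 1 - z.wt d.snd := by linarith
        rw [← hs', hlev, h3]; linarith
    have hm' := hm
    rw [hN] at hm' hz
    have : (Quot.mk _ z : T.SlitAnnulus p) = pt p (L.mem_left 0 L.pos) := by
      rw [mk_eq_pt z hm' hf hN]
      exact S.pt_eq _ _ (iff_of_true (S.base d hd e he hm' hz) hF)
    rw [this]
    exact L.on_left L.pos

/-- The point over the slit in a triangle on its left is the last point of the level curve. -/
lemma on_last_of_top (L : LevelChain p g s m N F) (D : T.DirichletData E₁ E₂ c k g)
    (hp : T.IsSlit E₁ E₂ g p) {d : T.graph.Dart} (hd : d ∈ p.darts) {e : V}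
    (he : T.tri d.fst d.snd e) (h0 : g d.snd ≤ s) (h1 : s ≤ g d.fst)
    (h : T.Mem {d.fst, d.snd, e} (edgePoint g d.snd d.fst s)) :
    OnSegment p m N F (m - 1) 1 (pt p h) := by
  obtain ⟨side, S, -, hF, hm⟩ := L.exists_faceSide D hp
  have hN := L.eq_first_of_slitNode hp ⟨d, hd, h0, h1, rfl⟩
  have hz : N 0 e = 0 := by
    rw [← hN]; exact edgePoint_of_ne (tri_ne_snd he).symm (tri_ne_trd he) s
  have h' : T.Mem {d.fst, d.snd, e} (N 0) := hN ▸ h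
  rw [pt_congr h h' rfl hN, S.pt_eq h' hm (iff_of_false (S.top d hd e he h' hz) hF)]
  exact L.on_last hm

lemma ahead_position (L : LevelChain p g s m N F) (D : T.DirichletData E₁ E₂ c k g)
    {u q : T.SlitAnnulus p} (h : T.Ahead p g u q) (hu : T.extend p g u = s) :
    ∃ j r r', r < r' ∧ OnSegment p m N F j r u ∧ OnSegment p m N F j r' q := by
  obtain ⟨z, z', a, b, e, μ, rfl, rfl, ht, hf, hf', hμ, ha, hb, he⟩ := h
  have hu : level g z.wt = s := hu
  have hm : T.Mem {a, b, e} z.wt := ⟨hf ▸ z.face_mem, z.wt_mem, hf ▸ z.wt_support⟩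
  have hm' : T.Mem {a, b, e} z'.wt := ⟨hf' ▸ z'.face_mem, z'.wt_mem, hf' ▸ z'.wt_support⟩
  have hA : T.FaceAhead g {a, b, e} z.wt z'.wt := by
    refine ⟨a, b, e, μ, ht, rfl, hμ, ?_⟩
    ext v
    simp only [Pi.add_apply, Pi.smul_apply, smul_eq_mul]
    by_cases h1 : v = a
    · rw [h1, dir_fst ht]; linarith
    by_cases h2 : v = b
    · rw [h2, dir_snd ht]; linarith
    by_cases h3 : v = e
    · rw [h3, dir_trd ht]; linarith
    rw [hm.2.2 v (by simp [h1, h2, h3]), hm'.2.2 v (by simp [h1, h2, h3])]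
    simp [dir, h1, h2, h3]
  rw [mk_eq_pt z hm hf rfl, mk_eq_pt z' hm' hf' rfl]
  have hu' : level g z'.wt = s := by rw [hA.level_eq, hu]
  obtain ⟨a', b', e', t₀, t₁, hfe, C, h0, h1⟩ := exists_cell D.not_const hm
  rw [hu] at h0 h1
  rw [pt_congr hm (hfe ▸ hm) hfe rfl, pt_congr hm' (hfe ▸ hm') hfe rfl]
  rw [hfe] at hm hm' hA
  obtain ⟨r, hr0, hr1, hr⟩ := C.exists_combo hm
  obtain ⟨r', hr0', hr1', hr'⟩ := C.exists_combo hm'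
  rw [hu] at hr
  rw [hu'] at hr'
  have ha : g a' ≠ s := fun ha => hA.ne D.not_const (by
    rw [hr, hr', ← C.eq_of_level_apex ha, ← add_smul, ← add_smul]; simp)
  have key : ∀ {j : ℕ} {r r' : ℝ}, j < m → ({a', b', e'} : Finset V) = F j →
      z.wt = (1 - r) • N j + r • N (j + 1) → z'.wt = (1 - r') • N j + r' • N (j + 1) →
      r < r' := by
    intro j r r' hj hF h1 h2
    have hAj := L.ahead j hj
    rw [← hF] at hAj
    obtain ⟨μ₁, hμ₁, e1⟩ := hA.exists_eq C.tri
    obtain ⟨μ₂, hμ₂, e2⟩ := hAj.exists_eq C.tri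
    by_contra! hcon
    have h3 : (μ₁ + (r - r') * μ₂) • dir g a' b' e' = 0 := by
      have h4 : μ₁ • dir g a' b' e' = z'.wt - z.wt := by rw [e1]; module
      have h5 : μ₂ • dir g a' b' e' = N (j + 1) - N j := by rw [e2]; module
      rw [add_smul, mul_smul, h4, h5, h1, h2]
      module
    have hpos : 0 < μ₁ + (r - r') * μ₂ :=
      add_pos_of_pos_of_nonneg hμ₁ (mul_nonneg (sub_nonneg.2 hcon) hμ₂.le)
    have h4 := (smul_eq_zero.1 h3).resolve_left hpos.ne'
    rw [h4, smul_zero, add_zero] at e1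
    exact hA.ne D.not_const e1.symm
  obtain ⟨j, hj, hF, ⟨e1, e2, -⟩ | ⟨e1, e2, -⟩⟩ := L.exists_segment_of_cell D.regular C h0 h1 ha
  · rw [e1, e2] at hr hr'
    exact ⟨j, r, r', key hj hF hr hr', onSegment_of_cell hj hF _ hr0 hr1 hr,
      onSegment_of_cell hj hF _ hr0' hr1' hr'⟩
  · rw [e1, e2, add_comm] at hr hr'
    have hc : ∀ r : ℝ, r • N j + (1 - r) • N (j + 1) =
        (1 - (1 - r)) • N j + (1 - r) • N (j + 1) := fun r => by rw [sub_sub_cancel]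
    rw [hc] at hr hr'
    exact ⟨j, 1 - r, 1 - r', key hj hF hr hr',
      onSegment_of_cell hj hF _ (by linarith) (by linarith) hr,
      onSegment_of_cell hj hF _ (by linarith) (by linarith) hr'⟩

lemma position_le (L : LevelChain p g s m N F) (D : T.DirichletData E₁ E₂ c k g)
    (hp : T.IsSlit E₁ E₂ g p) {u q : T.SlitAnnulus p}
    (h : Relation.ReflTransGen (T.Ahead p g) u q) (hq : T.extend p g q = s) :
    T.extend p g u = s ∧ ∀ {j j' : ℕ} {r r' : ℝ}, OnSegment p m N F j r u →
      OnSegment p m N F j' r' q → (j : ℝ) + r ≤ j' + r' := by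
  induction h using Relation.ReflTransGen.head_induction_on with
  | refl => exact ⟨hq, fun h h' => (L.position_unique D hp h h').le⟩
  | head h hrest ih =>
    rename_i u v
    have hu : T.extend p g u = s := by
      rw [← ih.1]
      obtain ⟨z, z', a, b, e, μ, rfl, rfl, ht, hf, hf', hμ, ha, hb, he⟩ := h
      have hm : T.Mem {a, b, e} z.wt := ⟨hf ▸ z.face_mem, z.wt_mem, hf ▸ z.wt_support⟩
      have hm' : T.Mem {a, b, e} z'.wt := ⟨hf' ▸ z'.face_mem, z'.wt_mem, hf' ▸ z'.wt_support⟩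
      change level g z.wt = level g z'.wt
      rw [hm.level_eq ht, hm'.level_eq ht, show z'.wt a = z.wt a + μ * (g e - g b) by linarith,
        show z'.wt b = z.wt b + μ * (g a - g e) by linarith,
        show z'.wt e = z.wt e + μ * (g b - g a) by linarith]
      ring
    refine ⟨hu, fun h1 h2 => ?_⟩
    obtain ⟨i, ρ, ρ', hlt, hu1, hv1⟩ := L.ahead_position D h hu
    have := ih.2 hv1 h2
    have := L.position_unique D hp h1 hu1
    linarith

lemma ahead_segment (L : LevelChain p g s m N F) {j : ℕ} (hj : j < m) :
    T.Ahead p g (pt p (L.mem_left j hj)) (pt p (L.mem_right j hj)) := by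
  obtain ⟨a, b, e, μ, ht, hf, hμ, heq⟩ := L.ahead j hj
  refine ⟨⟨_, (L.mem_left j hj).1, _, (L.mem_left j hj).2.1, (L.mem_left j hj).2.2⟩,
    ⟨_, (L.mem_right j hj).1, _, (L.mem_right j hj).2.1, (L.mem_right j hj).2.2⟩,
    a, b, e, μ, rfl, rfl, ht, hf, hf, hμ, ?_, ?_, ?_⟩
  · simp [heq, dir_fst ht]
  · simp [heq, dir_snd ht]
  · simp [heq, dir_trd ht]

lemma reflTransGen_left (L : LevelChain p g s m N F) (D : T.DirichletData E₁ E₂ c k g)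
    (hp : T.IsSlit E₁ E₂ g p) {i j : ℕ} (hij : i ≤ j) (hj : j < m) :
    Relation.ReflTransGen (T.Ahead p g) (pt p (L.mem_left i (hij.trans_lt hj)))
      (pt p (L.mem_left j hj)) := by
  induction j, hij using Nat.le_induction with
  | base => exact Relation.ReflTransGen.refl
  | succ j hij ih =>
    have h1 := (ih (by omega)).tail (L.ahead_segment (by omega : j < m))
    rwa [L.joined D hp (L.on_right (by omega)) (L.on_left hj)] at h1

end LevelChain

end OrientedTriangulation

namespace OrientedTriangulation

/-! ### The flux through a level curve -/

variable {V : Type*} [Fintype V] [DecidableEq V] {T : OrientedTriangulation V}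
  {E₁ E₂ : Finset V} {c : V → V → ℝ} {k : ℝ} {g : V → ℝ} {x y : V} {p : T.graph.Walk x y}

/-- The vertices above the level `t`. At the level `0` of the inner boundary they are the vertices
strictly above it, and at all other levels the vertices at level `t` are included. -/
def Upper (g : V → ℝ) (t : ℝ) (u : V) : Prop := t ≤ g u ∧ 0 < g u

namespace DirichletData

lemma upper_lt {t : ℝ} {u w : V} (hu : Upper g t u) (hw : ¬ Upper g t w) : g w < g u := by
  by_contra! hcon
  exact hw ⟨hu.1.trans hcon, hu.2.trans_le hcon⟩

lemma not_upper_le {t : ℝ} (ht : 0 ≤ t) {w : V} (hw : ¬ Upper g t w) : g w ≤ t := by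
  by_contra! hcon
  exact hw ⟨hcon.le, ht.trans_lt hcon⟩

open Classical in
lemma flux_of_pos (D : T.DirichletData E₁ E₂ c k g) {t : ℝ} (ht : 0 < t) {n : V → ℝ}
    (hn : n ∈ T.nodes g t) : T.flux E₂ c g n =
      ∑ u, ∑ w, if T.graph.Adj u w ∧ Upper g t u ∧ ¬ Upper g t w ∧ n = edgePoint g w u t then
        c u w * (g u - g w) else 0 := by
  have hlev := level_of_mem_nodes hn
  have hsimp := mem_stdSimplex_of_mem_nodes hn
  have hE : ¬ ∃ v ∈ E₂, n v = 1 := by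
    rintro ⟨v, hv, h1⟩
    rw [eq_single hsimp h1, level_single, D.sol.inner v hv] at hlev
    exact ht.ne hlev
  have hup : ∀ u, Upper g t u ↔ t ≤ g u := fun u => ⟨fun h => h.1, fun h => ⟨h, ht.trans_le h⟩⟩
  rw [flux, if_neg hE, normalDerivative, hlev]
  refine Finset.sum_congr rfl fun u _ => Finset.sum_congr rfl fun w _ => ?_
  have hiff : (T.graph.Adj u w ∧ n u ≠ 0 ∧ (∀ v, v ≠ u → v ≠ w → n v = 0) ∧ g w ∈ Set.Iio t) ↔
      (T.graph.Adj u w ∧ Upper g t u ∧ ¬ Upper g t w ∧ n = edgePoint g w u t) := by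
    rw [hup, hup, not_le]
    refine and_congr_right fun hadj => ⟨?_, ?_⟩
    · rintro ⟨hnu, hsupp, hw : g w < t⟩
      have h1 := sum_of_support hadj.ne hsupp (fun _ => 1)
      have h2 := sum_of_support hadj.ne hsupp g
      simp only [mul_one] at h1
      rw [hsimp.2] at h1
      rw [← level, hlev] at h2
      have hnu' : 0 < n u := lt_of_le_of_ne (hsimp.1 u) (Ne.symm hnu)
      have hnw := hsimp.1 w
      have h3 : t - g w = n u * (g u - g w) := by
        rw [h2]; linear_combination -g w * h1
      have h4 : 0 < g u - g w := by
        by_contra! hcon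
        have := mul_nonpos_of_nonneg_of_nonpos hnu'.le hcon
        linarith
      have h5 : g u - t = n w * (g u - g w) := by
        rw [h2]; linear_combination g u * h1
      have h6 := mul_nonneg hnw h4.le
      refine ⟨by linarith, hw, ?_⟩
      have := eq_edgePoint hsimp (by linarith : g w < g u).ne fun v h1 h2 => hsupp v h2 h1
      rwa [hlev] at this
    · rintro ⟨hu, hw, rfl⟩
      refine ⟨?_, fun v h1 h2 => edgePoint_of_ne h2 h1 t, hw⟩
      rw [edgePoint_snd hadj.ne.symm]
      exact (div_pos (by linarith) (by linarith)).ne'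
  by_cases h : T.graph.Adj u w ∧ Upper g t u ∧ ¬ Upper g t w ∧ n = edgePoint g w u t
  · have hw : g w < t := not_le.1 fun h' => h.2.2.1 ((hup w).2 h')
    rw [if_pos (hiff.2 h), if_pos h, pieceConductance, div_mul_cancel₀ _ (sub_pos.2 hw).ne']
  · rw [if_neg fun h' => h (hiff.1 h'), if_neg h]

open Classical in
lemma flux_of_zero (D : T.DirichletData E₁ E₂ c k g) {n : V → ℝ}
    (hn : n ∈ T.nodes g 0) : T.flux E₂ c g n =
      ∑ u, ∑ w, if T.graph.Adj u w ∧ Upper g 0 u ∧ ¬ Upper g 0 w ∧ n = edgePoint g w u 0 then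
        c u w * (g u - g w) else 0 := by
  obtain ⟨v, hv, rfl⟩ : ∃ v, g v = 0 ∧ n = Pi.single v 1 := by
    rcases nodes_cases hn with h | ⟨w, u, -, hw, -⟩
    · exact h
    · exact absurd (D.inner_le w) hw.not_ge
  have hup : ∀ u, Upper g 0 u ↔ 0 < g u := fun u => ⟨fun h => h.2, fun h => ⟨h.le, h⟩⟩
  have hE : ∃ u ∈ E₂, (Pi.single v 1 : V → ℝ) u = 1 :=
    ⟨v, D.mem_inner_iff.2 hv, by simp⟩
  rw [flux, if_pos hE, normalDerivative, level_single, hv, Finset.sum_comm,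
    ← Finset.sum_neg_distrib]
  refine Finset.sum_congr rfl fun u _ => ?_
  rw [← Finset.sum_neg_distrib]
  refine Finset.sum_congr rfl fun w _ => ?_
  have hiff : (T.graph.Adj w u ∧ (Pi.single v 1 : V → ℝ) w ≠ 0 ∧
      (∀ v', v' ≠ w → v' ≠ u → (Pi.single v 1 : V → ℝ) v' = 0) ∧ g u ∈ Set.Ioi 0) ↔
      (T.graph.Adj u w ∧ Upper g 0 u ∧ ¬ Upper g 0 w ∧ Pi.single v 1 = edgePoint g w u 0) := by
    rw [hup, hup, not_lt, T.graph.adj_comm]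
    refine and_congr_right fun hadj => ⟨?_, ?_⟩
    · rintro ⟨hw, -, hu : 0 < g u⟩
      have hwv : w = v := by
        by_contra hcon
        exact hw (Pi.single_eq_of_ne hcon 1)
      subst hwv
      refine ⟨hu, hv.le, ?_⟩
      rw [← hv, edgePoint_self_left]
    · rintro ⟨hu, hw, heq⟩
      have hw0 : g w = 0 := le_antisymm hw (D.inner_le w)
      rw [← hw0, edgePoint_self_left] at heq
      have hwv : w = v := by
        by_contra hcon
        have := congrFun heq w
        rw [Pi.single_eq_of_ne hcon, Pi.single_eq_same] at this
        exact zero_ne_one this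
      subst hwv
      exact ⟨by simp, fun v' h1 _ => Pi.single_eq_of_ne h1 1, hu⟩
  by_cases h : T.graph.Adj u w ∧ Upper g 0 u ∧ ¬ Upper g 0 w ∧ Pi.single v 1 = edgePoint g w u 0
  · rw [if_pos (hiff.2 h), if_pos h, pieceConductance, div_mul_cancel₀ _ (by
      have := h.2.1.2; linarith), D.cond_symm w u]
    ring
  · rw [if_neg fun h' => h (hiff.1 h'), if_neg h, neg_zero]

open Classical in
/-- The flux through a node is the sum of the currents of the edges that rise through it. -/
lemma flux_eq (D : T.DirichletData E₁ E₂ c k g) {t : ℝ} (ht : 0 ≤ t) {n : V → ℝ}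
    (hn : n ∈ T.nodes g t) : T.flux E₂ c g n =
      ∑ u, ∑ w, if T.graph.Adj u w ∧ Upper g t u ∧ ¬ Upper g t w ∧ n = edgePoint g w u t then
        c u w * (g u - g w) else 0 := by
  rcases ht.eq_or_lt with rfl | ht
  · exact D.flux_of_zero hn
  · exact D.flux_of_pos ht hn

lemma flux_pos (D : T.DirichletData E₁ E₂ c k g) {t : ℝ} (ht : 0 ≤ t) {n : V → ℝ}
    (hn : n ∈ T.nodes g t) : 0 < T.flux E₂ c g n := by
  classical
  have hnonneg : ∀ u w, 0 ≤ if T.graph.Adj u w ∧ Upper g t u ∧ ¬ Upper g t w ∧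
      n = edgePoint g w u t then c u w * (g u - g w) else 0 := by
    intro u w
    split_ifs with h
    · exact mul_nonneg (D.cond_pos u w h.1).le (sub_nonneg.2 (upper_lt h.2.1 h.2.2.1).le)
    · exact le_rfl
  obtain ⟨u, w, h⟩ : ∃ u w, T.graph.Adj u w ∧ Upper g t u ∧ ¬ Upper g t w ∧
      n = edgePoint g w u t := by
    rcases nodes_cases hn with ⟨v, rfl, rfl⟩ | ⟨w, u, hadj, hw, hu, rfl⟩
    · rcases ht.eq_or_lt with h0 | h0
      · obtain ⟨u, hu, hlt⟩ := D.exists_upper (v := v)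
          (fun h => D.k_pos.ne (h0.trans (D.sol.outer v h)))
        exact ⟨u, v, hu.symm, ⟨hlt.le, h0.trans_lt hlt⟩, fun h => h.2.ne h0,
          (edgePoint_self_left g v u).symm⟩
      · obtain ⟨w, hw, hlt⟩ := D.exists_lower (v := v) (fun h => h0.ne' (D.sol.inner v h))
        exact ⟨v, w, hw, ⟨le_rfl, h0⟩, fun h => hlt.not_ge h.1,
          (edgePoint_self_right hlt.ne).symm⟩
    · exact ⟨u, w, hadj.symm, ⟨hu.le, ht.trans_lt hu⟩, fun h => hw.not_ge h.1, rfl⟩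
  rw [D.flux_eq ht hn]
  refine Finset.sum_pos' (fun u _ => Finset.sum_nonneg fun w _ => hnonneg u w)
    ⟨u, Finset.mem_univ u, Finset.sum_pos' (fun w _ => hnonneg u w) ⟨w, Finset.mem_univ w, ?_⟩⟩
  rw [if_pos h]
  exact mul_pos (D.cond_pos u w h.1) (sub_pos.2 (upper_lt h.2.1 h.2.2.1))

open Classical in
/-- The current through a cut that separates the boundary components is the total current out of
the outer boundary. -/
lemma sum_cut (D : T.DirichletData E₁ E₂ c k g) {t : ℝ} (hk : t ≤ k) :
    (∑ u, ∑ w, if T.graph.Adj u w ∧ Upper g t u ∧ ¬ Upper g t w then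
      c u w * (g u - g w) else 0) = ∑ v ∈ E₁, T.laplacian c g v := by
  have h1 : ∑ v ∈ E₁, T.laplacian c g v =
      ∑ v ∈ Finset.univ.filter (Upper g t), T.laplacian c g v := by
    refine Finset.sum_subset (fun v hv => ?_) fun v hv hv' => ?_
    · have := D.sol.outer v hv
      rw [Finset.mem_filter, Upper, this]
      exact ⟨Finset.mem_univ v, hk, D.k_pos⟩
    · rw [Finset.mem_filter] at hv
      exact D.sol.harmonic v hv' fun h => hv.2.2.ne' (D.sol.inner v h)
  have hanti : (∑ u, ∑ w, if T.graph.Adj u w ∧ Upper g t u ∧ Upper g t w then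
      c u w * (g u - g w) else 0) = 0 := by
    have h2 : (∑ u, ∑ w, if T.graph.Adj u w ∧ Upper g t u ∧ Upper g t w then
        c u w * (g u - g w) else 0) = - ∑ u, ∑ w, if T.graph.Adj u w ∧ Upper g t u ∧ Upper g t w
          then c u w * (g u - g w) else 0 := by
      conv_lhs => rw [Finset.sum_comm]
      rw [← Finset.sum_neg_distrib]
      refine Finset.sum_congr rfl fun u _ => ?_
      rw [← Finset.sum_neg_distrib]
      refine Finset.sum_congr rfl fun w _ => ?_
      rw [D.cond_symm w u]
      have hiff : (T.graph.Adj w u ∧ Upper g t w ∧ Upper g t u) ↔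
          (T.graph.Adj u w ∧ Upper g t u ∧ Upper g t w) := by
        rw [T.graph.adj_comm]; tauto
      by_cases h : T.graph.Adj u w ∧ Upper g t u ∧ Upper g t w
      · rw [if_pos (hiff.2 h), if_pos h]; ring
      · rw [if_neg fun h' => h (hiff.1 h'), if_neg h, neg_zero]
    linarith
  have hadd := congrArg ((∑ u, ∑ w, if T.graph.Adj u w ∧ Upper g t u ∧ ¬ Upper g t w then
    c u w * (g u - g w) else 0) + ·) hanti
  simp only [add_zero] at hadd
  rw [h1, Finset.sum_filter, ← hadd, ← Finset.sum_add_distrib]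
  refine Finset.sum_congr rfl fun u _ => ?_
  rw [← Finset.sum_add_distrib, laplacian, Finset.sum_filter]
  by_cases hu : Upper g t u
  · rw [if_pos hu]
    refine Finset.sum_congr rfl fun w _ => ?_
    by_cases hadj : T.graph.Adj u w <;> by_cases hw : Upper g t w <;> simp [hadj, hw, hu]
  · rw [if_neg hu]
    exact Finset.sum_eq_zero fun w _ => by simp [hu]

end DirichletData

/-- The fluxes through the nodes of a level curve add up to the total current. -/
lemma LevelChain.sum_flux {s : ℝ} {m : ℕ} {N : ℕ → V → ℝ} {F : ℕ → Finset V}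
    (L : LevelChain p g s m N F) (D : T.DirichletData E₁ E₂ c k g) (h0 : 0 ≤ s) (hk : s ≤ k) :
    ∑ i ∈ Finset.Icc 1 m, T.flux E₂ c g (N i) = ∑ v ∈ E₁, T.laplacian c g v := by
  classical
  rw [← D.sum_cut hk, Finset.sum_congr rfl fun i _ => D.flux_eq h0 (L.nodes i), Finset.sum_comm]
  refine Finset.sum_congr rfl fun u _ => ?_
  rw [Finset.sum_comm]
  refine Finset.sum_congr rfl fun w _ => ?_
  by_cases h : T.graph.Adj u w ∧ Upper g s u ∧ ¬ Upper g s w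
  · rw [if_pos h]
    have hlt := DirichletData.upper_lt h.2.1 h.2.2
    obtain ⟨i, hi, hN⟩ : ∃ i ∈ Finset.Icc 1 m, N i = edgePoint g w u s := by
      obtain ⟨j, hj, hN⟩ := L.surj _ (edgePoint_mem_nodes h.1.symm hlt.ne
        (Or.inl ⟨DirichletData.not_upper_le h0 h.2.2, h.2.1.1⟩))
      rcases Nat.eq_zero_or_pos j with rfl | hj0
      · exact ⟨m, Finset.mem_Icc.2 ⟨L.pos, le_rfl⟩, L.last.trans hN⟩
      · exact ⟨j, Finset.mem_Icc.2 ⟨hj0, hj.le⟩, hN⟩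
    rw [Finset.sum_eq_single i, if_pos ⟨h.1, h.2.1, h.2.2, hN.symm ▸ rfl⟩]
    · intro j hj hji
      refine if_neg fun h' => hji (L.index_inj hj hi (h'.2.2.2.trans hN.symm))
    · exact fun h' => absurd hi h'
  · rw [if_neg h]
    exact Finset.sum_eq_zero fun i _ => if_neg fun h' => h ⟨h'.1, h'.2.1, h'.2.2.1⟩

end OrientedTriangulation

namespace OrientedTriangulation

/-! ### The values of the conjugate function at the nodes -/

variable {V : Type*} [Fintype V] [DecidableEq V] {T : OrientedTriangulation V}
  {E₁ E₂ : Finset V} {c : V → V → ℝ} {k : ℝ} {g : V → ℝ} {x y : V} {p : T.graph.Walk x y}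

lemma bary_mem_stdSimplex (q : T.SlitAnnulus p) : T.bary p q ∈ stdSimplex ℝ V := by
  obtain ⟨f, n, h, rfl⟩ := exists_pt q
  exact h.2.1

lemma Regular.mem_nodes_of_isNode (R : T.Regular g) {q : T.SlitAnnulus p} (h : T.IsNode p g q) :
    T.bary p q ∈ T.nodes g (T.extend p g q) := by
  have hs := bary_mem_stdSimplex q
  change T.bary p q ∈ T.nodes g (level g (T.bary p q))
  rcases h with ⟨v, hv⟩ | ⟨u, w, hadj, hne, -, -, hsum, -⟩
  · obtain ⟨a, b, hab, -⟩ := R.exists_out v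
    rw [eq_single hs hv, level_single]
    exact R.single_mem_nodes hab
  · refine mem_nodes_of_support hs hadj hne fun v hu hw => ?_
    have h1 : T.bary p q u + T.bary p q w + T.bary p q v ≤ ∑ v, T.bary p q v := by
      have := Finset.sum_le_sum_of_subset_of_nonneg (Finset.subset_univ ({u, w, v} : Finset V))
        (f := T.bary p q) fun i _ _ => hs.1 i
      rw [Finset.sum_insert (by simp [hadj.ne, hu.symm]), Finset.sum_pair hw.symm] at this
      linarith
    rw [hs.2] at h1
    exact le_antisymm (by linarith) (hs.1 v)

lemma isNode_of_mem_nodes {q : T.SlitAnnulus p} {s : ℝ} (hs : s ∈ Set.range g)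
    (h : T.bary p q ∈ T.nodes g s) : T.IsNode p g q := by
  have hlev := level_of_mem_nodes h
  rcases nodes_cases h with ⟨v, -, hv⟩ | ⟨w, u, hadj, hw, hu, hq⟩
  · exact Or.inl ⟨v, by rw [hv]; simp⟩
  · have h1 : 0 < g u - g w := by linarith
    obtain ⟨v, hv⟩ := hs
    refine Or.inr ⟨w, u, hadj, (hw.trans hu).ne, ?_, ?_, ?_, v, by rw [hlev, hv]⟩
    · rw [hq, edgePoint_fst hadj.ne, sub_pos, div_lt_one h1]; linarith
    · rw [hq, edgePoint_snd hadj.ne]; exact div_pos (by linarith) h1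
    · rw [hq, edgePoint_fst hadj.ne, edgePoint_snd hadj.ne]; ring

namespace LevelChain

variable {s : ℝ} {m : ℕ} {N : ℕ → V → ℝ} {F : ℕ → Finset V}

/-- At the node with position `i`, the conjugate function is the flux through the nodes of its level
curve with the positions `1, …, i`. -/
lemma nodeValue_eq (L : LevelChain p g s m N F) (D : T.DirichletData E₁ E₂ c k g)
    (hp : T.IsSlit E₁ E₂ g p) (hs : s ∈ Set.range g) {j i : ℕ} {r : ℝ} {q : T.SlitAnnulus p}
    (hq : OnSegment p m N F j r q) (hi : (j : ℝ) + r = i) :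
    T.nodeValue p E₂ c g q = ∑ l ∈ Finset.Icc 1 i, T.flux E₂ c g (N l) := by
  classical
  have him : i ≤ m := by
    have h1 : (j : ℝ) + 1 ≤ m := by exact_mod_cast hq.1
    have h2 := hq.2.2.1
    exact_mod_cast (by linarith : (i : ℝ) ≤ m)
  have hne : Nonempty (T.SlitAnnulus p) := ⟨q⟩
  have hex : ∀ l ∈ Finset.Icc 1 m, ∃ u, OnSegment p m N F (l - 1) 1 u := fun l hl => by
    rw [Finset.mem_Icc] at hl
    exact ⟨_, L.on_right (by omega)⟩
  choose! P hP using hex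
  have hbary : ∀ l ∈ Finset.Icc 1 m, T.bary p (P l) = N l := fun l hl => by
    rw [bary_eq (hP l hl), Nat.sub_add_cancel (Finset.mem_Icc.1 hl).1]
    simp
  have hpos : ∀ l ∈ Finset.Icc 1 m, ((l - 1 : ℕ) : ℝ) + 1 = l := fun l hl => by
    have := (Finset.mem_Icc.1 hl).1
    push_cast [Nat.cast_sub this]
    ring
  have hsub : ∀ l ∈ Finset.Icc 1 i, l ∈ Finset.Icc 1 m := fun l hl => by
    rw [Finset.mem_Icc] at hl ⊢
    omega
  have hset : {u : T.SlitAnnulus p | T.IsNode p g u ∧ Relation.ReflTransGen (T.Ahead p g) u q ∧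
      u ∉ T.base p} = P '' (Finset.Icc 1 i : Finset ℕ) := by
    ext u
    constructor
    · rintro ⟨hu, hle, hb⟩
      obtain ⟨hus, hle⟩ := L.position_le D hp hle (L.extend_eq hq)
      obtain ⟨j', r', hon⟩ := L.exists_onSegment D hp hus
      have hun := D.regular.mem_nodes_of_isNode hu
      rw [hus] at hun
      obtain ⟨l, hlm, hl, -, hl0, -⟩ := L.node_index D.regular hon hun
      have h1 : 1 ≤ l := by
        by_contra! hcon
        obtain ⟨rfl, rfl⟩ := hl0 (by omega)
        exact hb ((L.mem_base_iff D hp).1 hon).1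
      have h2 : l ≤ i := by
        have := hle hon hq
        rw [hl, hi] at this
        exact_mod_cast this
      have hlI : l ∈ Finset.Icc 1 i := Finset.mem_Icc.2 ⟨h1, h2⟩
      exact ⟨l, hlI, L.eq_of_position_eq D hp (hP l (hsub l hlI)) hon
        (by rw [hl, hpos l (hsub l hlI)])⟩
    · rintro ⟨l, hl, rfl⟩
      have hl : l ∈ Finset.Icc 1 i := hl
      have hon := hP l (hsub l hl)
      refine ⟨isNode_of_mem_nodes hs (by rw [hbary l (hsub l hl)]; exact L.nodes l), ?_, fun hb => ?_⟩
      · have h1 := Finset.mem_Icc.1 hl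
        have hqr : q = pt p (L.mem_right (i - 1) (by omega)) :=
          L.eq_of_position_eq D hp hq (L.on_right (by omega))
            (by rw [hi, hpos i (Finset.mem_Icc.2 ⟨by omega, him⟩)])
        rcases h1.2.eq_or_lt with rfl | hlt
        · rw [hqr, ← L.eq_right hon]
        · have hPl : P l = pt p (L.mem_left l (by omega)) :=
            L.eq_of_position_eq D hp hon (L.on_left (by omega))
              (by rw [hpos l (hsub l hl), add_zero])
          rw [hPl, hqr]
          exact (L.reflTransGen_left D hp (by omega : l ≤ i - 1) (by omega)).tail
            (L.ahead_segment (by omega))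
      · have h0 := (L.mem_base_iff D hp).2 ⟨hb, L.extend_eq hon⟩
        have h1 := L.position_unique D hp hon h0
        rw [hpos l (hsub l hl)] at h1
        have h2 : (1 : ℝ) ≤ l := by exact_mod_cast (Finset.mem_Icc.1 hl).1
        norm_num at h1
        rw [h1] at h2
        norm_num at h2
  have hinj : Set.InjOn P (Finset.Icc 1 i : Finset ℕ) := fun l hl l' hl' h => by
    have hl : l ∈ Finset.Icc 1 i := hl
    have hl' : l' ∈ Finset.Icc 1 i := hl'
    exact L.index_inj (hsub l hl) (hsub l' hl')
      (by rw [← hbary l (hsub l hl), ← hbary l' (hsub l' hl'), h])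
  rw [nodeValue, hset, finsum_mem_image hinj, finsum_mem_coe_finset]
  exact Finset.sum_congr rfl fun l hl => by rw [hbary l (hsub l hl)]

end LevelChain

namespace DirichletData

lemma exists_levelChain_of_mem (D : T.DirichletData E₁ E₂ c k g) (hp : T.IsSlit E₁ E₂ g p)
    {t : ℝ} (ht : t ∈ Set.range g) : 0 ≤ t ∧ t ≤ k ∧ ∃ m N F, LevelChain p g t m N F := by
  obtain ⟨v, rfl⟩ := ht
  exact ⟨D.inner_le v, D.le_outer v, D.exists_levelChain hp (D.inner_le v) (D.le_outer v)⟩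

lemma nodeValue_base (D : T.DirichletData E₁ E₂ c k g) (hp : T.IsSlit E₁ E₂ g p)
    {q : T.SlitAnnulus p} (hq : q ∈ T.base p) (ht : T.extend p g q ∈ Set.range g) :
    T.nodeValue p E₂ c g q = 0 := by
  obtain ⟨h0, hk, m, N, F, L⟩ := D.exists_levelChain_of_mem hp ht
  rw [L.nodeValue_eq D hp ht ((L.mem_base_iff D hp).2 ⟨hq, rfl⟩) (i := 0) (by simp)]
  simp

lemma nodeValue_top (D : T.DirichletData E₁ E₂ c k g) (hp : T.IsSlit E₁ E₂ g p)
    {d : T.graph.Dart} (hd : d ∈ p.darts) {e : V} (he : T.tri d.fst d.snd e) {t : ℝ}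
    (ht : t ∈ Set.range g) (h0 : g d.snd ≤ t) (h1 : t ≤ g d.fst)
    (h : T.Mem {d.fst, d.snd, e} (edgePoint g d.snd d.fst t)) :
    T.nodeValue p E₂ c g (pt p h) = ∑ v ∈ E₁, T.laplacian c g v := by
  obtain ⟨ht0, htk, m, N, F, L⟩ := D.exists_levelChain_of_mem hp ht
  have hm := L.pos
  rw [L.nodeValue_eq D hp ht (L.on_last_of_top D hp hd he h0 h1 h) (i := m)
    (by push_cast [Nat.cast_sub hm]; ring), L.sum_flux D ht0 htk]

lemma nodeValue_lt (D : T.DirichletData E₁ E₂ c k g) (hp : T.IsSlit E₁ E₂ g p)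
    {t : ℝ} (ht : t ∈ Set.range g) {f : Finset V} {n n' : V → ℝ} (hn : n ∈ T.nodes g t)
    (hn' : n' ∈ T.nodes g t) (h : T.Mem f n) (h' : T.Mem f n') (hA : T.FaceAhead g f n n') :
    T.nodeValue p E₂ c g (pt p h) < T.nodeValue p E₂ c g (pt p h') := by
  obtain ⟨ht0, htk, m, N, F, L⟩ := D.exists_levelChain_of_mem hp ht
  obtain ⟨j, hj, rfl, rfl, rfl⟩ := L.exists_segment D.regular hn hn' h h' hA
  rw [L.nodeValue_eq D hp ht (L.on_left hj) (i := j) (by simp),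
    L.nodeValue_eq D hp ht (L.on_right hj) (i := j + 1) (by simp),
    Finset.sum_Icc_succ_top (by omega)]
  linarith [D.flux_pos (c := c) (E₂ := E₂) ht0 (L.nodes (j + 1))]

end DirichletData

end OrientedTriangulation

namespace OrientedTriangulation

/-! ### The conjugate function along a level curve -/

variable {V : Type*} [Fintype V] [DecidableEq V] {T : OrientedTriangulation V}
  {E₁ E₂ : Finset V} {c : V → V → ℝ} {k : ℝ} {g : V → ℝ} {x y : V} {p : T.graph.Walk x y}

open Classical in
/-- The value of the conjugate function at the point `n` of the triangle `f`, if this point is a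
vertex of the refined decomposition; the junk value `0` if `n` is not in `f`. -/
noncomputable def faceValue (p : T.graph.Walk x y) (E₂ : Finset V) (c : V → V → ℝ) (g : V → ℝ)
    (f : Finset V) (n : V → ℝ) : ℝ :=
  if h : T.Mem f n then T.nodeValue p E₂ c g (pt p h) else 0

/-- The affine interpolation, at level `s`, of the values of the conjugate function at the levels
`t₀` and `t₁` of the side `a b` of the triangle `f`. -/
noncomputable def sideValue (p : T.graph.Walk x y) (E₂ : Finset V) (c : V → V → ℝ) (g : V → ℝ)
    (f : Finset V) (t₀ t₁ : ℝ) (a b : V) (s : ℝ) : ℝ :=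
  (1 - (s - t₀) / (t₁ - t₀)) * faceValue p E₂ c g f (edgePoint g a b t₀) +
    (s - t₀) / (t₁ - t₀) * faceValue p E₂ c g f (edgePoint g a b t₁)

lemma faceValue_eq {f : Finset V} {n : V → ℝ} (h : T.Mem f n) :
    faceValue p E₂ c g f n = T.nodeValue p E₂ c g (pt p h) := dif_pos h

lemma sideValue_comm {f : Finset V} {a b : V} (h : g a ≠ g b) (t₀ t₁ s : ℝ) :
    sideValue p E₂ c g f t₀ t₁ a b s = sideValue p E₂ c g f t₀ t₁ b a s := by
  rw [sideValue, sideValue, edgePoint_comm h, edgePoint_comm h]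

lemma sideValue_of_eq {f : Finset V} {a b : V} {t₀ t₁ s : ℝ} (ht : t₀ < t₁)
    (hs : s = t₀ ∨ s = t₁) :
    sideValue p E₂ c g f t₀ t₁ a b s = faceValue p E₂ c g f (edgePoint g a b s) := by
  rcases hs with rfl | rfl
  · simp [sideValue]
  · simp [sideValue, div_self (sub_pos.2 ht).ne']

lemma Consecutive.eq_of_mem {t₀ t₁ s : ℝ} (h : Consecutive g t₀ t₁) (h0 : t₀ ≤ s) (h1 : s ≤ t₁)
    (hs : s ∈ Set.range g) : s = t₀ ∨ s = t₁ := by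
  obtain ⟨v, rfl⟩ := hs
  exact (h.le_or_ge v).imp (fun h => le_antisymm h h0) fun h => le_antisymm h1 h

/-- The sequence `ν` gives the values of the conjugate function at the nodes of the chain: they
increase from `0` to the total current, and they are the values that all cells of the refined
decomposition prescribe. -/
structure LevelValues (p : T.graph.Walk x y) (E₁ E₂ : Finset V) (c : V → V → ℝ) (g : V → ℝ)
    (s : ℝ) (m : ℕ) (N : ℕ → V → ℝ) (F : ℕ → Finset V) (ν : ℕ → ℝ) : Prop where
  zero : ν 0 = 0
  last : ν m = ∑ v ∈ E₁, T.laplacian c g v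
  lt : ∀ j < m, ν j < ν (j + 1)
  side : ∀ {a b e : V} {t₀ t₁ : ℝ}, T.Cell g a b e t₀ t₁ → t₀ ≤ s → s ≤ t₁ → ∀ j < m,
    ({a, b, e} : Finset V) = F j → ∀ w, (w = b ∨ w = e) →
    (edgePoint g a w s = N j → sideValue p E₂ c g (F j) t₀ t₁ a w s = ν j) ∧
    (edgePoint g a w s = N (j + 1) → sideValue p E₂ c g (F j) t₀ t₁ a w s = ν (j + 1))
  node : s ∈ Set.range g → ∀ {j : ℕ} {r : ℝ} {q : T.SlitAnnulus p}, OnSegment p m N F j r q →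
    T.bary p q ∈ T.nodes g s → T.nodeValue p E₂ c g q = (1 - r) * ν j + r * ν (j + 1)

namespace LevelChain

variable {s : ℝ} {m : ℕ} {N : ℕ → V → ℝ} {F : ℕ → Finset V}

lemma levelValues_of_mem (L : LevelChain p g s m N F) (D : T.DirichletData E₁ E₂ c k g)
    (hp : T.IsSlit E₁ E₂ g p) (hs : s ∈ Set.range g) :
    LevelValues p E₁ E₂ c g s m N F (fun i => ∑ l ∈ Finset.Icc 1 i, T.flux E₂ c g (N l)) := by
  obtain ⟨h0, hk, -⟩ := D.exists_levelChain_of_mem hp hs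
  refine ⟨by simp, L.sum_flux D h0 hk, fun j hj => ?_, ?_, ?_⟩
  · rw [Finset.sum_Icc_succ_top (by omega)]
    linarith [D.flux_pos (c := c) (E₂ := E₂) h0 (L.nodes (j + 1))]
  · intro a b e t₀ t₁ C c0 c1 j hj hF w _
    rw [sideValue_of_eq C.lt (C.eq_of_mem c0 c1 hs)]
    constructor <;> intro hN
    · rw [hN, faceValue_eq (L.mem_left j hj), L.nodeValue_eq D hp hs (L.on_left hj) (i := j)
        (by simp)]
    · rw [hN, faceValue_eq (L.mem_right j hj), L.nodeValue_eq D hp hs (L.on_right hj)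
        (i := j + 1) (by simp)]
  · intro _ j r q h hq
    rcases L.node_cases D.regular h hq with ⟨rfl, -⟩ | ⟨rfl, -⟩
    · rw [L.nodeValue_eq D hp hs h (i := j) (by simp)]; simp
    · rw [L.nodeValue_eq D hp hs h (i := j + 1) (by simp)]; simp

/-- Between two consecutive values of `g`, the nodes move along the edges of the triangulation,
and the values are interpolated from those at the two levels. -/
lemma exists_levelValues_of_not_mem (L : LevelChain p g s m N F)
    (D : T.DirichletData E₁ E₂ c k g) (hp : T.IsSlit E₁ E₂ g p) (hs : s ∉ Set.range g) :
    ∃ ν, LevelValues p E₁ E₂ c g s m N F ν := by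
  have hstrict : ∀ {t₀ t₁ : ℝ}, Consecutive g t₀ t₁ → t₀ ≤ s → s ≤ t₁ → t₀ < s ∧ s < t₁ :=
    fun {t₀ t₁} h h0 h1 => ⟨lt_of_le_of_ne h0 fun h' => hs (h' ▸ h.mem₀),
      lt_of_le_of_ne h1 fun h' => hs (h' ▸ h.mem₁)⟩
  obtain ⟨t₀, t₁, ht, h0, h1⟩ : ∃ t₀ t₁, Consecutive g t₀ t₁ ∧ t₀ < s ∧ s < t₁ := by
    obtain ⟨a, b, e, t₀, t₁, -, C, h0, h1⟩ := exists_cell D.not_const (L.mem_left 0 L.pos)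
    rw [level_of_mem_nodes (L.nodes 0)] at h0 h1
    exact ⟨t₀, t₁, C.toConsecutive, hstrict C.toConsecutive h0 h1⟩
  have huniq : ∀ {t₀' t₁' : ℝ}, Consecutive g t₀' t₁' → t₀' ≤ s → s ≤ t₁' →
      t₀' = t₀ ∧ t₁' = t₁ := by
    intro t₀' t₁' h h0' h1'
    obtain ⟨u, hu⟩ := ht.mem₀
    obtain ⟨v, hv⟩ := ht.mem₁
    obtain ⟨u', hu'⟩ := h.mem₀
    obtain ⟨v', hv'⟩ := h.mem₁
    have e1 := h.le_or_ge u
    have e2 := h.le_or_ge v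
    have e3 := ht.le_or_ge u'
    have e4 := ht.le_or_ge v'
    obtain ⟨s0, s1⟩ := hstrict h h0' h1'
    rw [hu] at e1
    rw [hv] at e2
    rw [hu'] at e3
    rw [hv'] at e4
    constructor
    · exact le_antisymm (e3.resolve_right (by linarith)) (e1.resolve_right (by linarith))
    · exact le_antisymm (e2.resolve_left (by linarith)) (e4.resolve_left (by linarith))
  have hedge : ∀ i, ∃ w u, T.graph.Adj w u ∧ g w ≤ t₀ ∧ t₁ ≤ g u ∧ N i = edgePoint g w u s := by
    intro i
    rcases nodes_cases (L.nodes i) with ⟨v, hv, -⟩ | ⟨w, u, hadj, hw, hu, h⟩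
    · exact absurd ⟨v, hv⟩ hs
    · exact ⟨w, u, hadj, (ht.le_or_ge w).resolve_right (by linarith),
        (ht.le_or_ge u).resolve_left (by linarith), h⟩
  choose W U hadj hW hU hN using hedge
  have hWs : ∀ i, g (W i) < s := fun i => (hW i).trans_lt h0
  have hUs : ∀ i, s < g (U i) := fun i => h1.trans_le (hU i)
  have hslit : ∃ d ∈ p.darts, W 0 = d.snd ∧ U 0 = d.fst := by
    obtain ⟨d, hd, d0, d1, hd0⟩ := L.slit
    have e1 : g d.snd ≠ s := fun h => hs ⟨_, h⟩
    have e2 : g d.fst ≠ s := fun h => hs ⟨_, h⟩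
    rw [hN 0] at hd0
    exact ⟨d, hd, DirichletData.edge_unique_of_strict (hWs 0) (hUs 0) (lt_of_le_of_ne d0 e1)
      (lt_of_le_of_ne d1 e2.symm) hd0⟩
  obtain ⟨d, hd, hd1, hd2⟩ := hslit
  have hm1 : m - 1 < m := Nat.sub_lt L.pos one_pos
  have hleft : ∀ j < m, ∃ e, T.tri (W j) (U j) e ∧ F j = {W j, U j, e} := fun j hj => by
    have hA := L.ahead j hj
    have hm := L.mem_left j hj
    rw [hN j] at hA hm
    exact hA.tri_of_edge (hWs j) (hUs j) hm (L.mem_right j hj)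
  have hright : ∀ j < m, ∃ e, T.tri (U (j + 1)) (W (j + 1)) e ∧
      F j = {U (j + 1), W (j + 1), e} := fun j hj => by
    have hA := L.ahead j hj
    have hm := L.mem_right j hj
    rw [hN (j + 1)] at hA hm
    exact hA.tri_of_edge_in (hWs _) (hUs _) hm (L.mem_left j hj)
  have hmem : ∀ {f : Finset V} {i : ℕ} {t : ℝ}, f ∈ T.faces → W i ∈ f → U i ∈ f → t₀ ≤ t →
      t ≤ t₁ → T.Mem f (edgePoint g (W i) (U i) t) := fun {f i t} hf hw hu e0 e1 =>
    mem_edgePoint hf hw hu ((hWs i).trans (hUs i)).ne (Or.inl ⟨(hW i).trans e0, e1.trans (hU i)⟩)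
  have hmatch : ∀ {a w : V} {f : Finset V} {i : ℕ}, ((g a ≤ t₀ ∧ t₁ ≤ g w) ∨
      (t₁ ≤ g a ∧ g w ≤ t₀)) → edgePoint g a w s = N i →
      sideValue p E₂ c g f t₀ t₁ a w s = sideValue p E₂ c g f t₀ t₁ (W i) (U i) s := by
    intro a w f i hsep h
    rw [hN i] at h
    rcases hsep with ⟨ha, hw⟩ | ⟨ha, hw⟩
    · obtain ⟨rfl, rfl⟩ := DirichletData.edge_unique_of_strict (ha.trans_lt h0) (h1.trans_le hw) (hWs i)
        (hUs i) h
      rfl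
    · have hne : g a ≠ g w := (by linarith [ht.lt] : g w < g a).ne'
      rw [edgePoint_comm hne] at h
      obtain ⟨rfl, rfl⟩ := DirichletData.edge_unique_of_strict (hw.trans_lt h0) (h1.trans_le ha) (hWs i)
        (hUs i) h
      exact sideValue_comm hne _ _ _
  have hsep : ∀ {a b e w : V}, T.Cell g a b e t₀ t₁ → (w = b ∨ w = e) →
      ((g a ≤ t₀ ∧ t₁ ≤ g w) ∨ (t₁ ≤ g a ∧ g w ≤ t₀)) := by
    rintro a b e w C (rfl | rfl)
    · exact C.sep.imp (fun h => ⟨h.1, h.2.1⟩) fun h => ⟨h.1, h.2.1⟩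
    · exact C.sep.imp (fun h => ⟨h.1, h.2.2⟩) fun h => ⟨h.1, h.2.2⟩
  set G : ℕ → Finset V := fun i => if i < m then F i else F (m - 1) with hG
  set ν : ℕ → ℝ := fun i => sideValue p E₂ c g (G i) t₀ t₁ (W i) (U i) s with hν
  have hνl : ∀ j < m, sideValue p E₂ c g (F j) t₀ t₁ (W j) (U j) s = ν j := fun j hj => by
    simp only [hν, hG, if_pos hj]
  -- the value at a node does not depend on which of the two triangles at this node is used
  have hνr : ∀ j < m, sideValue p E₂ c g (F j) t₀ t₁ (W (j + 1)) (U (j + 1)) s = ν (j + 1) := by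
    intro j hj
    rcases Nat.lt_or_ge (j + 1) m with hlt | hge
    · obtain ⟨e, he, hF⟩ := hright j hj
      obtain ⟨e', he', hF'⟩ := hleft (j + 1) hlt
      have hns : s(U (j + 1), W (j + 1)) ∉ p.edges := by
        intro hmem
        obtain ⟨d', hd', h | h⟩ := (Walk.mem_edges_iff p).1 hmem
        · refine L.not_slitNode hp (Nat.succ_ne_zero j) hlt ⟨d', hd', ?_, ?_, ?_⟩
          · rw [h.2]; exact (hWs _).le
          · rw [h.1]; exact (hUs _).le
          · rw [h.1, h.2]; exact hN _
        · have := hp.decreasing d' hd'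
          rw [h.1, h.2] at this
          have := hWs (j + 1)
          have := hUs (j + 1)
          linarith
      have key : ∀ t, t₀ ≤ t → t ≤ t₁ →
          faceValue p E₂ c g (F j) (edgePoint g (W (j + 1)) (U (j + 1)) t) =
            faceValue p E₂ c g (F (j + 1)) (edgePoint g (W (j + 1)) (U (j + 1)) t) := by
        intro t e0 e1
        have m1 : T.Mem (F j) (edgePoint g (W (j + 1)) (U (j + 1)) t) :=
          hmem (L.mem_left j hj).1 (by rw [hF]; simp) (by rw [hF]; simp) e0 e1
        have m2 : T.Mem (F (j + 1)) (edgePoint g (W (j + 1)) (U (j + 1)) t) :=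
          hmem (L.mem_left _ hlt).1 (by rw [hF']; simp) (by rw [hF']; simp) e0 e1
        rw [faceValue_eq m1, faceValue_eq m2, pt_glue he he' hF hF' hns m1 m2]
      simp only [hν, hG, if_pos hlt, sideValue]
      rw [key t₀ le_rfl ht.lt.le, key t₁ ht.lt.le le_rfl]
    · have : j = m - 1 := by omega
      simp only [hν, hG, if_neg hge.not_gt, ← this]
  have hσ0 : 0 < (s - t₀) / (t₁ - t₀) := div_pos (by linarith) (by linarith)
  have hσ1 : (s - t₀) / (t₁ - t₀) < 1 := (div_lt_one (by linarith)).2 (by linarith)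
  refine ⟨ν, ?_, ?_, ?_, ?_, fun h => absurd h hs⟩
  · obtain ⟨e, he, hF⟩ := hleft 0 L.pos
    have key : ∀ t ∈ Set.range g, t₀ ≤ t → t ≤ t₁ →
        faceValue p E₂ c g (F 0) (edgePoint g (W 0) (U 0) t) = 0 := by
      intro t htr e0 e1
      have hm : T.Mem (F 0) (edgePoint g (W 0) (U 0) t) :=
        hmem (L.mem_left 0 L.pos).1 (by rw [hF]; simp) (by rw [hF]; simp) e0 e1
      rw [faceValue_eq hm]
      refine D.nodeValue_base hp ⟨d, hd, e, ⟨_, hm.1, _, hm.2.1, hm.2.2⟩, ?_, ?_, ?_, rfl⟩ ?_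
      · rwa [← hd1, ← hd2]
      · rw [← hd1, ← hd2]; exact hF
      · exact edgePoint_of_ne (tri_ne_trd he) (tri_ne_snd he).symm t
      · rw [extend_pt, level_edgePoint ((hWs 0).trans (hUs 0)).ne]
        exact htr
    rw [← hνl 0 L.pos, sideValue, key t₀ ht.mem₀ le_rfl ht.lt.le, key t₁ ht.mem₁ ht.lt.le le_rfl]
    simp
  · have hlast : W m = d.snd ∧ U m = d.fst := by
      have h := hN m
      rw [L.last, hN 0] at h
      obtain ⟨e1, e2⟩ := DirichletData.edge_unique_of_strict (hWs 0) (hUs 0) (hWs m) (hUs m) h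
      exact ⟨by rw [← e1, hd1], by rw [← e2, hd2]⟩
    obtain ⟨e, he, hF⟩ := hright (m - 1) hm1
    rw [Nat.sub_add_cancel L.pos] at he hF
    rw [hlast.1, hlast.2] at he hF
    have key : ∀ t ∈ Set.range g, t₀ ≤ t → t ≤ t₁ →
        faceValue p E₂ c g (F (m - 1)) (edgePoint g (W m) (U m) t) =
          ∑ v ∈ E₁, T.laplacian c g v := by
      intro t htr e0 e1
      have hm : T.Mem (F (m - 1)) (edgePoint g (W m) (U m) t) :=
        hmem (L.mem_left _ hm1).1 (by rw [hF, hlast.1]; simp) (by rw [hF, hlast.2]; simp) e0 e1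
      rw [hlast.1, hlast.2, hF] at hm
      rw [hlast.1, hlast.2, hF, faceValue_eq hm]
      have w0 := hW m
      have u0 := hU m
      rw [hlast.1] at w0
      rw [hlast.2] at u0
      exact D.nodeValue_top hp hd he htr (w0.trans e0) (e1.trans u0) hm
    have h := hνr (m - 1) hm1
    rw [Nat.sub_add_cancel L.pos] at h
    rw [← h, sideValue, key t₀ ht.mem₀ le_rfl ht.lt.le, key t₁ ht.mem₁ ht.lt.le le_rfl]
    ring
  · intro j hj
    obtain ⟨a, b, e, hF, C⟩ := D.exists_cell_strict ht h0 h1 (L.mem_left j hj)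
      (level_of_mem_nodes (L.nodes j))
    have has : g a ≠ s := fun h => hs ⟨a, h⟩
    -- the two ends of a cell are different at one level at least
    have key : ∀ A B : V, (∀ t ∈ Set.range g, t₀ ≤ t → t ≤ t₁ → g a ≠ t →
        faceValue p E₂ c g (F j) (edgePoint g a A t) <
          faceValue p E₂ c g (F j) (edgePoint g a B t)) →
        sideValue p E₂ c g (F j) t₀ t₁ a A s < sideValue p E₂ c g (F j) t₀ t₁ a B s := by
      intro A B hlt
      have hle : ∀ t ∈ Set.range g, t₀ ≤ t → t ≤ t₁ →
          faceValue p E₂ c g (F j) (edgePoint g a A t) ≤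
            faceValue p E₂ c g (F j) (edgePoint g a B t) := by
        intro t htr e0 e1
        by_cases hat : g a = t
        · rw [← hat, edgePoint_self_left, edgePoint_self_left]
        · exact (hlt t htr e0 e1 hat).le
      rw [sideValue, sideValue]
      have hσ1' := sub_pos.2 hσ1
      by_cases hat : g a = t₀
      · exact add_lt_add_of_le_of_lt
          (mul_le_mul_of_nonneg_left (hle t₀ ht.mem₀ le_rfl ht.lt.le) hσ1'.le)
          (mul_lt_mul_of_pos_left (hlt t₁ ht.mem₁ ht.lt.le le_rfl (hat ▸ ht.lt.ne)) hσ0)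
      · exact add_lt_add_of_lt_of_le
          (mul_lt_mul_of_pos_left (hlt t₀ ht.mem₀ le_rfl ht.lt.le hat) hσ1')
          (mul_le_mul_of_nonneg_left (hle t₁ ht.mem₁ ht.lt.le le_rfl) hσ0.le)
    obtain ⟨i, hi, hFi, hcases⟩ := L.exists_segment_of_cell D.regular C h0.le h1.le has
    have hl : ∀ t, t₀ ≤ t → t ≤ t₁ → T.Mem (F j) (edgePoint g a b t) := fun t e0 e1 =>
      hF ▸ C.left_mem e0 e1
    have hr : ∀ t, t₀ ≤ t → t ≤ t₁ → T.Mem (F j) (edgePoint g a e t) := fun t e0 e1 =>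
      hF ▸ C.right_mem e0 e1
    -- the cell lies in the triangle of the segment, so that it belongs to the segment
    have hij : i = j := L.index_of_face_eq D.regular hi hj (by rw [← hFi, hF])
    subst hij
    rcases hcases with ⟨e1, e2, ha⟩ | ⟨e1, e2, ha⟩
    · rw [← hνl i hi, ← hνr i hi, ← hmatch (hsep C (Or.inl rfl)) e1,
        ← hmatch (hsep C (Or.inr rfl)) e2]
      refine key b e fun t htr u0 u1 hat => ?_
      rw [faceValue_eq (hl t u0 u1), faceValue_eq (hr t u0 u1)]
      exact D.nodeValue_lt hp htr (C.left_mem_nodes u0 u1) (C.right_mem_nodes u0 u1) _ _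
        (hF ▸ C.ahead_low ha hat u0 u1)
    · rw [← hνl i hi, ← hνr i hi, ← hmatch (hsep C (Or.inr rfl)) e1,
        ← hmatch (hsep C (Or.inl rfl)) e2]
      refine key e b fun t htr u0 u1 hat => ?_
      rw [faceValue_eq (hl t u0 u1), faceValue_eq (hr t u0 u1)]
      exact D.nodeValue_lt hp htr (C.right_mem_nodes u0 u1) (C.left_mem_nodes u0 u1) _ _
        (hF ▸ C.ahead_high ha hat u0 u1)
  · intro a b e t₀' t₁' C e0 e1 j hj hF w hw
    obtain ⟨rfl, rfl⟩ := huniq C.toConsecutive e0 e1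
    exact ⟨fun h => (hmatch (hsep C hw) h).trans (hνl j hj),
      fun h => (hmatch (hsep C hw) h).trans (hνr j hj)⟩

end LevelChain

end OrientedTriangulation

namespace OrientedTriangulation

/-! ### The conjugate function is a bijection on every level curve -/

variable {V : Type*} [Fintype V] [DecidableEq V] {T : OrientedTriangulation V}
  {E₁ E₂ : Finset V} {c : V → V → ℝ} {k : ℝ} {g : V → ℝ} {x y : V} {p : T.graph.Walk x y}

namespace LevelChain

variable {s : ℝ} {m : ℕ} {N : ℕ → V → ℝ} {F : ℕ → Finset V} {ν : ℕ → ℝ}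

lemma value_of_cell (L : LevelChain p g s m N F) (D : T.DirichletData E₁ E₂ c k g)
    (hp : T.IsSlit E₁ E₂ g p) (hν : LevelValues p E₁ E₂ c g s m N F ν) {a b e : V} {t₀ t₁ : ℝ}
    (C : T.Cell g a b e t₀ t₁) (h0 : t₀ ≤ s) (h1 : s ≤ t₁) {r : ℝ} (hr0 : 0 ≤ r) (hr1 : r ≤ 1)
    {n : V → ℝ} (h : T.Mem {a, b, e} n)
    (hn : n = (1 - r) • edgePoint g a b s + r • edgePoint g a e s) :
    ∃ j ρ, OnSegment p m N F j ρ (pt p h) ∧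
      (1 - r) * sideValue p E₂ c g {a, b, e} t₀ t₁ a b s +
        r * sideValue p E₂ c g {a, b, e} t₀ t₁ a e s = (1 - ρ) * ν j + ρ * ν (j + 1) := by
  by_cases ha : g a = s
  · have hs : s ∈ Set.range g := ⟨a, ha⟩
    have hna : n = edgePoint g a b s := by
      rw [hn, ← C.eq_of_level_apex ha, ← add_smul, sub_add_cancel, one_smul]
    have hnn : n ∈ T.nodes g s := by rw [hna]; exact C.left_mem_nodes h0 h1
    obtain ⟨j, ρ, hon⟩ := L.exists_onSegment_of_node D hp hnn h
    refine ⟨j, ρ, hon, ?_⟩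
    rw [sideValue_of_eq C.lt (C.eq_of_mem h0 h1 hs), sideValue_of_eq C.lt (C.eq_of_mem h0 h1 hs),
      ← C.eq_of_level_apex ha, ← hna, faceValue_eq h, ← hν.node hs hon hnn]
    ring
  · obtain ⟨j, hj, hF, ⟨e1, e2, -⟩ | ⟨e1, e2, -⟩⟩ := L.exists_segment_of_cell D.regular C h0 h1 ha
    · refine ⟨j, r, onSegment_of_cell hj hF h hr0 hr1 (by rw [hn, e1, e2]), ?_⟩
      rw [← (hν.side C h0 h1 j hj hF b (Or.inl rfl)).1 e1,
        ← (hν.side C h0 h1 j hj hF e (Or.inr rfl)).2 e2, hF]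
    · refine ⟨j, 1 - r, onSegment_of_cell hj hF h (by linarith) (by linarith)
        (by rw [hn, e1, e2, sub_sub_cancel, add_comm]), ?_⟩
      rw [← (hν.side C h0 h1 j hj hF e (Or.inr rfl)).1 e1,
        ← (hν.side C h0 h1 j hj hF b (Or.inl rfl)).2 e2, hF]
      ring

end LevelChain

lemma exists_tri_of_face {a b e : V} (hab : a ≠ b) (hae : a ≠ e)
    (hf : ({a, b, e} : Finset V) ∈ T.faces) : T.tri a b e ∨ T.tri a e b := by
  obtain ⟨u, v, w, h, hf⟩ := hf
  obtain ⟨q, r, h', hf'⟩ := exists_tri_of_mem h (v := a) (by rw [← hf]; simp)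
  rw [← hf] at hf'
  have hq : q = b ∨ q = e := by
    have : q ∈ ({a, b, e} : Finset V) := by rw [← hf']; simp
    simpa [(T.ne h').symm] using this
  have hb : b = q ∨ b = r := by
    have : b ∈ ({a, q, r} : Finset V) := by rw [hf']; simp
    simpa [hab.symm] using this
  have he : e = q ∨ e = r := by
    have : e ∈ ({a, q, r} : Finset V) := by rw [hf']; simp
    simpa [hae.symm] using this
  have hr : r = b ∨ r = e := by
    have : r ∈ ({a, b, e} : Finset V) := by rw [← hf']; simp
    simpa [tri_ne_trd h'] using this
  have hqr := tri_ne_snd h'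
  rcases hq with rfl | rfl
  · rcases hr with rfl | rfl
    · exact absurd rfl hqr
    · exact Or.inl h'
  · rcases hr with rfl | rfl
    · exact Or.inr h'
    · exact absurd rfl hqr

/-- The corners of a cell on one of its sides. -/
lemma eq_edgePoint_of_corner {a b e : V} {A₀ A₁ : T.FacePoint} {t₀ t₁ : ℝ}
    (ht : Consecutive g t₀ t₁) (hf₀ : A₀.face = {a, b, e}) (hf₁ : A₁.face = {a, b, e})
    (h₀ : A₀.wt e = 0) (h₁ : A₁.wt e = 0) (hl₀ : level g A₀.wt = t₀) (hl₁ : level g A₁.wt = t₁) :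
    ((g a ≤ t₀ ∧ t₁ ≤ g b) ∨ (t₁ ≤ g a ∧ g b ≤ t₀)) ∧ A₀.wt = edgePoint g a b t₀ ∧
      A₁.wt = edgePoint g a b t₁ := by
  have hsupp : ∀ {A : T.FacePoint}, A.face = {a, b, e} → A.wt e = 0 →
      ∀ v, v ≠ a → v ≠ b → A.wt v = 0 := by
    intro A hf h v ha hb
    by_cases hv : v = e
    · rwa [hv]
    · exact A.wt_support v (by simp [hf, ha, hb, hv])
  have hab : a ≠ b := by
    rintro rfl
    have hs : ∀ {A : T.FacePoint}, A.face = {a, a, e} → A.wt e = 0 → level g A.wt = g a := by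
      intro A hf h
      have h1 : ∀ v, v ≠ a → A.wt v = 0 := fun v hv => hsupp hf h v hv hv
      have h2 : ∑ v, A.wt v = A.wt a := Finset.sum_eq_single a (fun v _ hv => h1 v hv) (by simp)
      rw [A.wt_mem.2] at h2
      rw [eq_single A.wt_mem h2.symm, level_single]
    have := hs hf₀ h₀
    have := hs hf₁ h₁
    have := ht.lt
    linarith
  have hlev : ∀ {A : T.FacePoint}, A.face = {a, b, e} → A.wt e = 0 →
      A.wt a + A.wt b = 1 ∧ level g A.wt = A.wt a * g a + A.wt b * g b := by
    intro A hf h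
    have h1 := sum_of_support hab (hsupp hf h) (fun _ => 1)
    simp only [mul_one, A.wt_mem.2] at h1
    exact ⟨h1.symm, sum_of_support hab (hsupp hf h) g⟩
  obtain ⟨s0, l0⟩ := hlev hf₀ h₀
  obtain ⟨s1, l1⟩ := hlev hf₁ h₁
  rw [hl₀] at l0
  rw [hl₁] at l1
  have hlt := ht.lt
  have hgab : g a ≠ g b := by
    intro hg
    rw [hg, ← add_mul, s0] at l0
    rw [hg, ← add_mul, s1] at l1
    linarith
  refine ⟨?_, ?_, ?_⟩
  · have a0 := A₀.wt_mem.1 a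
    have b0 := A₀.wt_mem.1 b
    have a1 := A₁.wt_mem.1 a
    have b1 := A₁.wt_mem.1 b
    rcases ht.le_or_ge a with ha | ha <;> rcases ht.le_or_ge b with hb | hb
    · have h2 := mul_nonneg a1 (sub_nonneg.2 ha)
      have h3 := mul_nonneg b1 (sub_nonneg.2 hb)
      have h4 : t₁ - t₀ = -(A₁.wt a * (t₀ - g a)) - A₁.wt b * (t₀ - g b) := by
        rw [l1]; linear_combination t₀ * s1
      linarith
    · exact Or.inl ⟨ha, hb⟩
    · exact Or.inr ⟨ha, hb⟩
    · have h2 := mul_nonneg a0 (sub_nonneg.2 ha)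
      have h3 := mul_nonneg b0 (sub_nonneg.2 hb)
      have h4 : t₁ - t₀ = -(A₀.wt a * (g a - t₁)) - A₀.wt b * (g b - t₁) := by
        rw [l0]; linear_combination -t₁ * s0
      linarith
  · have := eq_edgePoint A₀.wt_mem hgab (hsupp hf₀ h₀)
    rwa [hl₀] at this
  · have := eq_edgePoint A₁.wt_mem hgab (hsupp hf₁ h₁)
    rwa [hl₁] at this

namespace LevelChain

variable {s : ℝ} {m : ℕ} {N : ℕ → V → ℝ} {F : ℕ → Finset V} {ν : ℕ → ℝ}

/-- All cells prescribe the same values of the conjugate function. -/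
lemma value_of_hasConjugateValue (L : LevelChain p g s m N F) (D : T.DirichletData E₁ E₂ c k g)
    (hp : T.IsSlit E₁ E₂ g p) (hν : LevelValues p E₁ E₂ c g s m N F ν) {q : T.SlitAnnulus p}
    (hq : T.extend p g q = s) {X : ℝ} (hX : T.HasConjugateValue p E₂ c g q X) :
    ∃ j ρ, OnSegment p m N F j ρ q ∧ X = (1 - ρ) * ν j + ρ * ν (j + 1) := by
  obtain ⟨a, b, e, A₀, A₁, B₀, B₁, z, t₀, t₁, r, σ, fA₀, fA₁, fB₀, fB₁, wA₀, wA₁, wB₀, wB₁, mt₀, mt₁,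
    hlt, hgap, lA₀, lB₀, lA₁, lB₁, hr, hσ, fz, rfl, hz, rfl⟩ := hX
  have ht : Consecutive g t₀ t₁ := ⟨hlt, hgap, mt₀, mt₁⟩
  have hswap : ({a, b, e} : Finset V) = {a, e, b} := by ext; simp; tauto
  obtain ⟨sepA, eA₀, eA₁⟩ := eq_edgePoint_of_corner ht fA₀ fA₁ wA₀ wA₁ lA₀ lA₁
  obtain ⟨sepB, eB₀, eB₁⟩ := eq_edgePoint_of_corner ht (fB₀.trans hswap) (fB₁.trans hswap)
    wB₀ wB₁ lB₀ lB₁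
  have hab : a ≠ b := by
    rintro rfl; rcases sepA with h | h <;> linarith
  have hae : a ≠ e := by
    rintro rfl; rcases sepB with h | h <;> linarith
  have hs : s = (1 - σ) * t₀ + σ * t₁ := by
    have hq : level g z.wt = s := hq
    rw [← hq, hz, level_combo, level_combo, level_combo, lA₀, lB₀, lA₁, lB₁]
    ring
  have hσ' : (s - t₀) / (t₁ - t₀) = σ := by
    rw [div_eq_iff (sub_pos.2 hlt).ne', hs]; ring
  have h0 : t₀ ≤ s := by
    have := mul_nonneg hσ.1 (sub_pos.2 hlt).le
    rw [hs]; linarith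
  have h1 : s ≤ t₁ := by
    have := mul_nonneg (sub_nonneg.2 hσ.2) (sub_pos.2 hlt).le
    rw [hs]; linarith
  have hwt : z.wt = (1 - r) • edgePoint g a b s + r • edgePoint g a e s := by
    rw [hz, hs, edgePoint_affine, edgePoint_affine, ← eA₀, ← eA₁, ← eB₀, ← eB₁]
    module
  have hm : T.Mem {a, b, e} z.wt := ⟨fz ▸ z.face_mem, z.wt_mem, fz ▸ z.wt_support⟩
  have hval : ∀ {A : T.FacePoint} {n : V → ℝ}, A.face = {a, b, e} → A.wt = n →
      T.nodeValue p E₂ c g (Quot.mk _ A) = faceValue p E₂ c g {a, b, e} n := by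
    rintro A _ hf rfl
    have h : T.Mem {a, b, e} A.wt := ⟨hf ▸ A.face_mem, A.wt_mem, hf ▸ A.wt_support⟩
    rw [faceValue_eq h, mk_eq_pt A h hf rfl]
  rw [hval fA₀ eA₀, hval fA₁ eA₁, hval fB₀ eB₀, hval fB₁ eB₁]
  have hX : ∀ α₀ α₁ β₀ β₁ : ℝ, (1 - σ) * ((1 - r) * α₀ + r * β₀) + σ * ((1 - r) * α₁ + r * β₁) =
      (1 - r) * ((1 - σ) * α₀ + σ * α₁) + r * ((1 - σ) * β₀ + σ * β₁) := fun _ _ _ _ => by ring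
  rw [hX]
  rcases exists_tri_of_face hab hae hm.1 with htri | htri
  · have C : T.Cell g a b e t₀ t₁ := by
      refine ⟨ht, htri, ?_⟩
      rcases sepA with hA | hA <;> rcases sepB with hB | hB
      · exact Or.inl ⟨hA.1, hA.2, hB.2⟩
      · linarith
      · linarith
      · exact Or.inr ⟨hA.1, hA.2, hB.2⟩
    obtain ⟨j, ρ, h2, h3⟩ := L.value_of_cell D hp hν C h0 h1 hr.1 hr.2 hm hwt
    refine ⟨j, ρ, by rwa [mk_eq_pt z hm fz rfl], ?_⟩
    rw [← h3, sideValue, sideValue, hσ']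
  · have C : T.Cell g a e b t₀ t₁ := by
      refine ⟨ht, htri, ?_⟩
      rcases sepA with hA | hA <;> rcases sepB with hB | hB
      · exact Or.inl ⟨hA.1, hB.2, hA.2⟩
      · linarith
      · linarith
      · exact Or.inr ⟨hA.1, hB.2, hA.2⟩
    have hm' := hm
    rw [hswap] at hm'
    obtain ⟨j, ρ, h2, h3⟩ := L.value_of_cell D hp hν C h0 h1 (r := 1 - r) (by linarith [hr.2])
      (by linarith [hr.1]) hm' (by rw [hwt, sub_sub_cancel, add_comm])
    refine ⟨j, ρ, by rwa [mk_eq_pt z hm' (fz.trans hswap) rfl], ?_⟩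
    rw [← h3, sideValue, sideValue, hσ', hswap]
    ring

end LevelChain

namespace DirichletData

lemma exists_hasConjugateValue (D : T.DirichletData E₁ E₂ c k g) (q : T.SlitAnnulus p) :
    ∃ X, T.HasConjugateValue p E₂ c g q X := by
  obtain ⟨f, n, h, rfl⟩ := exists_pt q
  obtain ⟨a, b, e, t₀, t₁, rfl, C, h0, h1⟩ := exists_cell D.not_const h
  obtain ⟨r, hr0, hr1, hr⟩ := C.exists_combo h
  have hlt := C.lt
  have a0 := C.left_mem le_rfl hlt.le
  have a1 := C.left_mem hlt.le le_rfl
  have b0 := C.right_mem le_rfl hlt.le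
  have b1 := C.right_mem hlt.le le_rfl
  set s := level g n with hs
  have hd : 0 < t₁ - t₀ := sub_pos.2 hlt
  have hsσ : s = (1 - (s - t₀) / (t₁ - t₀)) * t₀ + (s - t₀) / (t₁ - t₀) * t₁ := by
    field_simp; ring
  refine ⟨_, a, b, e, ⟨_, a0.1, _, a0.2.1, a0.2.2⟩, ⟨_, a1.1, _, a1.2.1, a1.2.2⟩,
    ⟨_, b0.1, _, b0.2.1, b0.2.2⟩, ⟨_, b1.1, _, b1.2.1, b1.2.2⟩, ⟨_, h.1, n, h.2.1, h.2.2⟩,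
    t₀, t₁, r, (s - t₀) / (t₁ - t₀), rfl, rfl, rfl, rfl,
    edgePoint_of_ne (tri_ne_trd C.tri) (tri_ne_snd C.tri).symm _,
    edgePoint_of_ne (tri_ne_trd C.tri) (tri_ne_snd C.tri).symm _,
    edgePoint_of_ne (T.ne C.tri).symm (tri_ne_snd C.tri) _,
    edgePoint_of_ne (T.ne C.tri).symm (tri_ne_snd C.tri) _,
    C.mem₀, C.mem₁, hlt, C.gap, level_edgePoint C.ne_left _, level_edgePoint C.ne_right _,
    level_edgePoint C.ne_left _, level_edgePoint C.ne_right _, ⟨hr0, hr1⟩,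
    ⟨div_nonneg (by linarith) hd.le, (div_le_one hd).2 (by linarith)⟩, rfl, rfl, ?_, rfl⟩
  change n = _
  rw [hr, hsσ, edgePoint_affine, edgePoint_affine, ← hsσ]
  module

/-- On every level curve of `g`, the conjugate function increases from `0` to the total current,
affinely on every segment. -/
lemma exists_conjugate_eq (D : T.DirichletData E₁ E₂ c k g) (hp : T.IsSlit E₁ E₂ g p) {s : ℝ}
    (h0 : 0 ≤ s) (hk : s ≤ k) : ∃ m N F ν, LevelChain p g s m N F ∧
      LevelValues p E₁ E₂ c g s m N F ν ∧
      (∀ q : T.SlitAnnulus p, T.extend p g q = s → ∃ j ρ, OnSegment p m N F j ρ q ∧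
        T.conjugate p E₂ c g q = (1 - ρ) * ν j + ρ * ν (j + 1)) := by
  obtain ⟨m, N, F, L⟩ := D.exists_levelChain hp h0 hk
  obtain ⟨ν, hν⟩ : ∃ ν, LevelValues p E₁ E₂ c g s m N F ν := by
    by_cases hs : s ∈ Set.range g
    · exact ⟨_, L.levelValues_of_mem D hp hs⟩
    · exact L.exists_levelValues_of_not_mem D hp hs
  exact ⟨m, N, F, ν, L, hν, fun q hq => L.value_of_hasConjugateValue D hp hν hq
    (Classical.epsilon_spec (D.exists_hasConjugateValue q))⟩

end DirichletData

namespace LevelValues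

variable {s : ℝ} {m : ℕ} {N : ℕ → V → ℝ} {F : ℕ → Finset V} {ν : ℕ → ℝ}

lemma mono (hν : LevelValues p E₁ E₂ c g s m N F ν) {i j : ℕ} (hij : i ≤ j) (hj : j ≤ m) :
    ν i ≤ ν j := by
  induction j, hij using Nat.le_induction with
  | base => exact le_rfl
  | succ j hij ih => exact (ih (by omega)).trans (hν.lt j (by omega)).le

lemma mem_Icc (hν : LevelValues p E₁ E₂ c g s m N F ν) {j : ℕ} {ρ : ℝ} (hj : j < m)
    (h0 : 0 ≤ ρ) (h1 : ρ ≤ 1) :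
    (1 - ρ) * ν j + ρ * ν (j + 1) ∈ Set.Icc (ν j) (ν (j + 1)) := by
  have h2 := sub_pos.2 (hν.lt j hj)
  have h3 := mul_nonneg h0 h2.le
  have h4 := mul_nonneg (sub_nonneg.2 h1) h2.le
  constructor <;> linarith

/-- Equal values are taken at equal positions only. -/
lemma position_eq (hν : LevelValues p E₁ E₂ c g s m N F ν) {j j' : ℕ} {ρ ρ' : ℝ}
    {q q' : T.SlitAnnulus p} (h : OnSegment p m N F j ρ q) (h' : OnSegment p m N F j' ρ' q')
    (heq : (1 - ρ) * ν j + ρ * ν (j + 1) = (1 - ρ') * ν j' + ρ' * ν (j' + 1)) :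
    (j : ℝ) + ρ = j' + ρ' := by
  have key : ∀ {j j' : ℕ} {ρ ρ' : ℝ}, j < m → j' < m → ρ ≤ 1 → 0 ≤ ρ' → ρ' ≤ 1 →
      (1 - ρ) * ν j + ρ * ν (j + 1) = (1 - ρ') * ν j' + ρ' * ν (j' + 1) → j < j' →
      (j : ℝ) + ρ = j' + ρ' := by
    intro j j' ρ ρ' hj hj' h1 h0' h1' heq hlt
    have e1 := sub_pos.2 (hν.lt j hj)
    have e2 := sub_pos.2 (hν.lt j' hj')
    have e3 := hν.mono (Nat.succ_le_of_lt hlt) hj'.le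
    have e4 := mul_nonneg (sub_nonneg.2 h1) e1.le
    have e5 := mul_nonneg h0' e2.le
    have z1 : (1 - ρ) * (ν (j + 1) - ν j) = 0 := by linarith
    have z2 : ρ' * (ν (j' + 1) - ν j') = 0 := by linarith
    have z3 : ν (j + 1) = ν j' := by linarith
    have r1 := (mul_eq_zero.1 z1).resolve_right e1.ne'
    have r2 := (mul_eq_zero.1 z2).resolve_right e2.ne'
    have hjj : j + 1 = j' := by
      by_contra hne
      have hlt' : j + 1 < j' := lt_of_le_of_ne (Nat.succ_le_of_lt hlt) hne
      have := hν.lt (j + 1) (by omega)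
      have := hν.mono (Nat.succ_le_of_lt hlt') hj'.le
      linarith
    rw [← hjj]
    push_cast
    linarith
  rcases lt_trichotomy j j' with hlt | rfl | hlt
  · exact key h.1 h'.1 h.2.2.1 h'.2.1 h'.2.2.1 heq hlt
  · have e1 := sub_pos.2 (hν.lt j h.1)
    have : (ρ - ρ') * (ν (j + 1) - ν j) = 0 := by linear_combination heq
    have := (mul_eq_zero.1 this).resolve_right e1.ne'
    linarith
  · exact (key h'.1 h.1 h'.2.2.1 h.2.1 h.2.2.1 heq.symm hlt).symm

lemma exists_segment (hν : LevelValues p E₁ E₂ c g s m N F ν) (hm : 0 < m) {X : ℝ}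
    (h0 : 0 ≤ X) (h1 : X ≤ ∑ v ∈ E₁, T.laplacian c g v) :
    ∃ j < m, ∃ ρ : ℝ, 0 ≤ ρ ∧ ρ ≤ 1 ∧ X = (1 - ρ) * ν j + ρ * ν (j + 1) := by
  obtain ⟨j, hj, hle, hlt⟩ : ∃ j < m, ν j ≤ X ∧ X ≤ ν (j + 1) := by
    by_contra! hcon
    have hall : ∀ j ≤ m, j = m ∨ ν j ≤ X := by
      intro j
      induction j with
      | zero => exact fun _ => Or.inr (hν.zero.trans_le h0)
      | succ j ih =>
        intro hj
        have := ih (by omega)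
        exact Or.inr (hcon j (by omega) (this.resolve_left (by omega))).le
    have h2 := (hall (m - 1) (by omega)).resolve_left (by omega)
    have h3 := hcon (m - 1) (by omega) h2
    rw [Nat.sub_add_cancel hm, hν.last] at h3
    exact h3.not_ge h1
  have hd := sub_pos.2 (hν.lt j hj)
  refine ⟨j, hj, (X - ν j) / (ν (j + 1) - ν j), div_nonneg (by linarith) hd.le,
    (div_le_one hd).2 (by linarith), ?_⟩
  field_simp
  ring

end LevelValues

/-- The conjugate function takes every value between `0` and the total current exactly once on
every level curve of `g`. -/
lemma DirichletData.existsUnique_conjugate (D : T.DirichletData E₁ E₂ c k g)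
    (hp : T.IsSlit E₁ E₂ g p) {s : ℝ} (h0 : 0 ≤ s) (hk : s ≤ k) {X : ℝ} (hX0 : 0 ≤ X)
    (hX1 : X ≤ ∑ v ∈ E₁, T.laplacian c g v) :
    ∃! q : T.SlitAnnulus p, T.extend p g q = s ∧ T.conjugate p E₂ c g q = X := by
  obtain ⟨m, N, F, ν, L, hν, hval⟩ := D.exists_conjugate_eq hp h0 hk
  obtain ⟨j, hj, ρ, hρ0, hρ1, rfl⟩ := hν.exists_segment L.pos hX0 hX1
  have hm := (L.mem_left j hj).combo (L.mem_right j hj) hρ0 hρ1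
  have hon : OnSegment p m N F j ρ (pt p hm) := ⟨hj, hρ0, hρ1, hm, rfl⟩
  refine ⟨pt p hm, ⟨L.extend_eq hon, ?_⟩, ?_⟩
  · obtain ⟨j', ρ', hon', hc⟩ := hval _ (L.extend_eq hon)
    have hpos := L.position_unique D hp hon hon'
    rw [hc]
    rcases lt_trichotomy j j' with hlt | rfl | hlt
    · have e1 : (j : ℝ) + 1 ≤ j' := by exact_mod_cast hlt
      have e2 := hon'.2.1
      have e3 : ρ = 1 := by linarith
      have e4 : ρ' = 0 := by linarith
      have e5 : j' = j + 1 := by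
        have : (j' : ℝ) = (j + 1 : ℕ) := by push_cast; linarith
        exact_mod_cast this
      rw [e3, e4, e5]; ring
    · rw [show ρ' = ρ by linarith]
    · have e1 : (j' : ℝ) + 1 ≤ j := by exact_mod_cast hlt
      have e2 := hon'.2.2.1
      have e3 : ρ' = 1 := by linarith
      have e4 : ρ = 0 := by linarith
      have e5 : j = j' + 1 := by
        have : (j : ℝ) = (j' + 1 : ℕ) := by push_cast; linarith
        exact_mod_cast this
      rw [e3, e4, e5]; ring
  · rintro q ⟨hq, hc⟩
    obtain ⟨j', ρ', hon', hc'⟩ := hval q hq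
    exact L.eq_of_position_eq D hp hon' hon (hν.position_eq hon' hon (hc'.symm.trans hc))

lemma DirichletData.extend_mem_Icc (D : T.DirichletData E₁ E₂ c k g) (q : T.SlitAnnulus p) :
    T.extend p g q ∈ Set.Icc 0 k := by
  obtain ⟨f, n, h, rfl⟩ := exists_pt q
  rw [extend_pt]
  refine ⟨Finset.sum_nonneg fun v _ => mul_nonneg (h.nonneg v) (D.inner_le v), ?_⟩
  calc level g n ≤ ∑ v, n v * k :=
        Finset.sum_le_sum fun v _ => mul_le_mul_of_nonneg_left (D.le_outer v) (h.nonneg v)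
    _ = k := by rw [← Finset.sum_mul, h.2.1.2, one_mul]

lemma DirichletData.conjugate_mem_Icc (D : T.DirichletData E₁ E₂ c k g)
    (hp : T.IsSlit E₁ E₂ g p) (q : T.SlitAnnulus p) :
    T.conjugate p E₂ c g q ∈ Set.Icc 0 (∑ v ∈ E₁, T.laplacian c g v) := by
  obtain ⟨h0, hk⟩ := D.extend_mem_Icc q
  obtain ⟨m, N, F, ν, L, hν, hval⟩ := D.exists_conjugate_eq hp h0 hk
  obtain ⟨j, ρ, hon, hc⟩ := hval q rfl
  have h1 := hν.mem_Icc hon.1 hon.2.1 hon.2.2.1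
  rw [hc, ← hν.zero, ← hν.last]
  exact ⟨(hν.mono (Nat.zero_le j) hon.1.le).trans h1.1, h1.2.trans (hν.mono hon.1 le_rfl)⟩

end OrientedTriangulation

theorem proposition3 {V : Type*} [Fintype V] [DecidableEq V] (T : OrientedTriangulation V)
    (E₁ E₂ : Finset V) (hT : T.IsAnnulus E₁ E₂)
    (c : V → V → ℝ) (hc_symm : ∀ v w, c v w = c w v) (hc_pos : ∀ v w, T.graph.Adj v w → 0 < c v w)
    (k : ℝ) (hk : 0 < k) (g : V → ℝ) (hg : T.IsDirichletSolution E₁ E₂ c k g)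
    (hne : ∀ v w, T.graph.Adj v w → g v = g w → T.boundaryGraph.Adj v w)
    {x y : V} (p : T.graph.Walk x y) (hp : T.IsSlit E₁ E₂ g p)
    (M L : Set (T.SlitAnnulus p)) (hM : IsLevelCurve (T.conjugate p E₂ c g) M)
    (hL : IsLevelCurve (T.extend p g) L) :
    (M ∩ L).ncard = 1 := by
  have D : T.DirichletData E₁ E₂ c k g := ⟨hT, hc_symm, hc_pos, hk, hg, hne⟩
  obtain ⟨⟨q, hq⟩, X, rfl⟩ := hM
  obtain ⟨⟨q', hq'⟩, s, rfl⟩ := hL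
  have hq : T.conjugate p E₂ c g q = X := hq
  have hq' : T.extend p g q' = s := hq'
  obtain ⟨hX0, hX1⟩ := D.conjugate_mem_Icc hp q
  obtain ⟨h0, h1⟩ := D.extend_mem_Icc q'
  rw [hq] at hX0 hX1
  rw [hq'] at h0 h1
  obtain ⟨z, ⟨hz1, hz2⟩, huniq⟩ := D.existsUnique_conjugate hp h0 h1 hX0 hX1
  refine Set.ncard_eq_one.2 ⟨z, Set.ext fun w => ⟨fun hw => huniq w ⟨hw.2, hw.1⟩, ?_⟩⟩
  rintro rfl
  exact ⟨hz2, hz1⟩
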